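/- Let $d\ge 2$, $0<\theta<1$, and let $D\subset\mathbb R^d$ be a bounded domain whose boundary is of class $C^{1,\theta}$: for every $P\in\partial D$ there are Cartesian coordinates $(y',y_d)\in\mathbb R^{d-1}\times\mathbb R$, a radius $\rho>0$ and a function $\phi:\mathbb R^{d-1}\to\mathbb R$, with bounded and $\theta$-Hölder continuous gradient, such that in $B(P,\rho)$ the set $D$ is $\{y_d>\phi(y')\}$ and $\partial D$ is $\{y_d=\phi(y')\}$. We call $(y,\rho,\phi)$ a chart at $P$, of bound at most $L$ if $|\nabla\phi|\le L$ and $|\nabla\phi(x')-\nabla\phi(y')|\le L|x'-y'|^\theta$ for all $x',y'$. Let $\gamma$ be Lipschitz continuous on $\overline D$ with $\gamma\ge\gamma_0>0$. For $f\in H^{1/2}(\partial D)$ let $u\in H^1(D)$ be the weak solution of $\nabla\cdot(\gamma\nabla u)=0$ in $D$, $u|_{\partial D}=f$, and let $\int_{\partial D}\Lambda_\gamma f\,g=\int_D\gamma\nabla u\cdot\nabla v$ for $g\in H^{1/2}(\partial D)$ and any $v\in H^1(D)$ with $v|_{\partial D}=g$. Let $\{e_n:n\in\mathbb N\}$ be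 an orthonormal basis of $L^2(\partial D)$, $(\varphi|\psi)=\int_{\partial D}\varphi\overline\psi$, and let $\{X_\alpha:\alpha\in\mathbb N^2\}$ be independent complex Gaussian random variables on a probability space $(\Omega,\mathcal H,\mathbb P)$ with $\mathbb E X_\alpha=0$, $\mathbb E(X_\alpha\overline{X_\alpha})=1$, $\mathbb E(X_\alpha X_\alpha)=0$. The noisy data are $$\mathcal N_\gamma(f,g)=\int_{\partial D}\Lambda_\gamma f\,g+\sum_{\alpha\in\mathbb N^2}(f|e_{\alpha_1})(g|e_{\alpha_2})X_\alpha ,$$ the series converging in $L^2(\Omega)$. Fix a smooth $\eta:\mathbb R\to[0,1]$ with $\eta(t)=1$ for $|t|\le\frac12$ and $\eta(t)=0$ for $|t|\ge1$. Given a chart at $P=(p',\phi(p'))$, write $x=(y'-p',\,y_d-\phi(y'))$, let $e_d$ be the last coordinate vector, put $$B=\begin{pmatrix} I_{d-1}&0\\ -\nabla\phi(p')&1\end{pmatrix},\qquad A=BB^{t},$$ let $\xi\in\mathbb R^d$ satisfy $\xi\cdot A\xi=e_d\cdot Ae_d$ and $\xi\cdot Ae_d=0$, and for $N\in\mathbb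 N\setminus\{0\}$ define, with $M=N^{1/(1+\theta)}$, $$f_N(y)=N^{-1/2}M^{(d-1)/2}C_P\,\eta(M|x'|)\,\eta(Mx_d)\,e^{N(i\xi-e_d)\cdot x}\quad(y\in\partial D),\qquad C_P=\Big((1+|\nabla\phi(p')|^2)\int_{\mathbb R^{d-1}}\eta(|x'|)^2\,dx'\Big)^{-1/2}.$$ This sequence does not depend on $\gamma$. Then there are $r>0$ and $L$ such that every $P\in\partial D$ has a chart of radius at least $r$ and of bound at most $L$, and an admissible vector $\xi$ for it. Moreover, for all $r>0$ and $L$ there is $c>0$, depending only on $D$, $\theta$, $\eta$, $r$, $L$, and for all $\gamma_0>0$ and $K$ there is $C>0$, depending only on these quantities and on $\gamma_0$, $K$, such that the following holds for every $P\in\partial D$, every chart at $P$ of radius at least $r$ and of bound at most $L$, every such $\xi$, every $\gamma\ge\gamma_0$ on $\overline D$ for which $K$ bounds both $\sup_{\overline D}|\gamma|$ and the Lipschitz constant, every orthonormal basis $\{e_n\}$ and every family $\{X_\alpha\}$ as above: $f_N\in H^{1/2}(\partial D)$, the data $\mathcal N_\gamma(f_N,\overline{f_N})$ are well defined for all $N\ge1$,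 and for every $\epsilon>0$ $$\mathbb P\big\{|\mathcal N_\gamma(f_N,\overline{f_N})-\gamma(P)|\le C N^{-\theta/(1+\theta)}\big\}\ge1-\epsilon\qquad\text{for all integers } N\ge \max\big(1,\ c\,\epsilon^{-\frac{1+\theta}{1-\theta}}\big).$$ -/

import Mathlib

open MeasureTheory ProbabilityTheory Filter Topology
open scoped ContDiff ComplexConjugate

noncomputable section

namespace Calderon

/-! ### Domains with a `C^{1,θ}` boundary -/

/-- The space `ℝ^{d-1} × ℝ` of coordinates `y = (y', y_d)`, with its Euclidean norm. -/
abbrev Coord (d : ℕ) : Type := WithLp 2 (EuclideanSpace ℝ (Fin (d - 1)) × ℝ)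

/-- A Cartesian coordinate system and a function `φ : ℝ^{d-1} → ℝ` of class `C^{1,θ}` that
represent `D` near the point `P` as the region above the graph of `φ`. The number `bound` bounds
the Lipschitz constant of `φ` and the `θ`-Hölder constant of `∇φ`. -/
structure BoundaryChart {d : ℕ} (D : Set (EuclideanSpace ℝ (Fin d))) (θ : ℝ)
    (P : EuclideanSpace ℝ (Fin d)) where
  /-- the change from the ambient coordinates to the coordinates `(y', y_d)` -/
  coord : EuclideanSpace ℝ (Fin d) ≃ᵃⁱ[ℝ] Coord d
  /-- the radius of the ball in which the boundary is represented -/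
  radius : ℝ
  radius_pos : 0 < radius
  /-- the boundary function -/
  φ : EuclideanSpace ℝ (Fin (d - 1)) → ℝ
  /-- a bound for the first-order norms of `φ` -/
  bound : ℝ
  differentiable : Differentiable ℝ φ
  norm_gradient_le : ∀ x, ‖gradient φ x‖ ≤ bound
  holder_gradient : ∀ x y, ‖gradient φ x - gradient φ y‖ ≤ bound * ‖x - y‖ ^ θ
  mem_iff : ∀ y ∈ Metric.ball P radius, y ∈ D ↔ φ (coord y).fst < (coord y).snd
  mem_frontier_iff : ∀ y ∈ Metric.ball P radius, y ∈ frontier D ↔ (coord y).snd = φ (coord y).fst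

/-- The boundary of `D` is of class `C^{1,θ}`. -/
def HasC1HolderBoundary {d : ℕ} (D : Set (EuclideanSpace ℝ (Fin d))) (θ : ℝ) : Prop :=
  ∀ P ∈ frontier D, Nonempty (BoundaryChart D θ P)

/-- The surface measure of `∂D`: the `(d-1)`-dimensional Hausdorff measure (normalized so that it
is the Lebesgue measure on hyperplanes) restricted to `∂D`. -/
def surfaceMeasure {d : ℕ} (D : Set (EuclideanSpace ℝ (Fin d))) :
    Measure (EuclideanSpace ℝ (Fin d)) :=
  (Measure.euclideanHausdorffMeasure (d - 1)).restrict (frontier D)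

/-! ### Sobolev functions, traces, and the Dirichlet-to-Neumann map -/

/-- The partial derivative `∂_i w`. -/
def partialDeriv {d : ℕ} {F : Type*} [NormedAddCommGroup F] [NormedSpace ℝ F] (i : Fin d)
    (w : EuclideanSpace ℝ (Fin d) → F) (x : EuclideanSpace ℝ (Fin d)) : F :=
  fderiv ℝ w x (EuclideanSpace.single i 1)

/-- `u ∈ H¹(D)`, with weak gradient `G = (G_1, …, G_d)`. -/
structure IsH1 {d : ℕ} (D : Set (EuclideanSpace ℝ (Fin d))) (u : EuclideanSpace ℝ (Fin d) → ℂ)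
    (G : Fin d → EuclideanSpace ℝ (Fin d) → ℂ) : Prop where
  memLp : MemLp u 2 (volume.restrict D)
  memLp_grad : ∀ i, MemLp (G i) 2 (volume.restrict D)
  weak_grad : ∀ ψ : EuclideanSpace ℝ (Fin d) → ℝ, ContDiff ℝ ∞ ψ → HasCompactSupport ψ →
    tsupport ψ ⊆ D → ∀ i,
      ∫ x in D, u x * ((partialDeriv i ψ x : ℝ) : ℂ) = - ∫ x in D, G i x * ((ψ x : ℝ) : ℂ)

/-- `u|_{∂D} = f` in the sense of traces: the trace is the continuous extension, from `H¹(D)` to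
`L²(∂D)`, of the restriction to `∂D` of functions that are `C¹` up to the boundary.
Here `G` is the weak gradient of `u`. -/
def HasTrace {d : ℕ} (D : Set (EuclideanSpace ℝ (Fin d))) (u : EuclideanSpace ℝ (Fin d) → ℂ)
    (G : Fin d → EuclideanSpace ℝ (Fin d) → ℂ) (f : EuclideanSpace ℝ (Fin d) → ℂ) : Prop :=
  MemLp f 2 (surfaceMeasure D) ∧
  ∃ w : ℕ → EuclideanSpace ℝ (Fin d) → ℂ,
    (∀ k, ContDiff ℝ 1 (w k)) ∧
    Tendsto (fun k => eLpNorm (fun x => w k x - u x) 2 (volume.restrict D)) atTop (𝓝 0) ∧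
    (∀ i, Tendsto (fun k => eLpNorm (fun x => partialDeriv i (w k) x - G i x) 2
      (volume.restrict D)) atTop (𝓝 0)) ∧
    Tendsto (fun k => eLpNorm (fun x => w k x - f x) 2 (surfaceMeasure D)) atTop (𝓝 0)

/-- `f ∈ H^{1/2}(∂D)`: `f` is the trace of a function in `H¹(D)`. -/
def MemHHalf {d : ℕ} (D : Set (EuclideanSpace ℝ (Fin d)))
    (f : EuclideanSpace ℝ (Fin d) → ℂ) : Prop :=
  ∃ u G, IsH1 D u G ∧ HasTrace D u G f

/-- `∫_D γ ∇u · ∇v` for functions with weak gradients `G` and `H` (no complex conjugation). -/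
def energyForm {d : ℕ} (D : Set (EuclideanSpace ℝ (Fin d))) (γ : EuclideanSpace ℝ (Fin d) → ℝ)
    (G H : Fin d → EuclideanSpace ℝ (Fin d) → ℂ) : ℂ :=
  ∫ x in D, (γ x : ℂ) * ∑ i, G i x * H i x

/-- `u ∈ H¹(D)`, with weak gradient `G`, is a weak solution of `∇ · (γ ∇u) = 0` in `D`,
`u|_{∂D} = f`; the test functions are the functions in `H¹(D)` with zero trace. -/
structure IsDirichletSolution {d : ℕ} (D : Set (EuclideanSpace ℝ (Fin d)))
    (γ : EuclideanSpace ℝ (Fin d) → ℝ) (f u : EuclideanSpace ℝ (Fin d) → ℂ)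
    (G : Fin d → EuclideanSpace ℝ (Fin d) → ℂ) : Prop where
  isH1 : IsH1 D u G
  hasTrace : HasTrace D u G f
  weak_eq : ∀ v H, IsH1 D v H → HasTrace D v H 0 → energyForm D γ G H = 0

/-- `z` is the value of the duality pairing `∫_{∂D} Λ_γ f g` of `Λ_γ f ∈ H^{-1/2}(∂D)` with
`g ∈ H^{1/2}(∂D)`: `z = ∫_D γ ∇u · ∇v`, where `u` solves the Dirichlet problem with data `f` and
`v ∈ H¹(D)` has trace `g`. -/
def IsDNPairing {d : ℕ} (D : Set (EuclideanSpace ℝ (Fin d))) (γ : EuclideanSpace ℝ (Fin d) → ℝ)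
    (f g : EuclideanSpace ℝ (Fin d) → ℂ) (z : ℂ) : Prop :=
  ∃ u G v H, IsDirichletSolution D γ f u G ∧ IsH1 D v H ∧ HasTrace D v H g ∧
    z = energyForm D γ G H

open Classical in
/-- The duality pairing `∫_{∂D} Λ_γ f g`, where `Λ_γ` is the Dirichlet-to-Neumann map. -/
def dnPairing {d : ℕ} (D : Set (EuclideanSpace ℝ (Fin d))) (γ : EuclideanSpace ℝ (Fin d) → ℝ)
    (f g : EuclideanSpace ℝ (Fin d) → ℂ) : ℂ :=
  if h : ∃ z, IsDNPairing D γ f g z then h.choose else 0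

/-- `γ` is a Lipschitz conductivity on `closure D` with lower bound `γ₀`, and `K` bounds `|γ|` and
the Lipschitz constant of `γ`. -/
structure IsLipschitzConductivity {d : ℕ} (D : Set (EuclideanSpace ℝ (Fin d))) (γ₀ K : ℝ)
    (γ : EuclideanSpace ℝ (Fin d) → ℝ) : Prop where
  lower : ∀ x ∈ closure D, γ₀ ≤ γ x
  upper : ∀ x ∈ closure D, |γ x| ≤ K
  lipschitz : ∀ x ∈ closure D, ∀ y ∈ closure D, |γ x - γ y| ≤ K * dist x y

/-! ### Noisy data -/

/-- Independent complex Gaussian random variables `X_α`, `α ∈ ℕ²`, with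
`𝔼 X_α = 0`, `𝔼 (X_α conj X_α) = 1` and `𝔼 (X_α X_α) = 0`. -/
structure IsComplexWhiteNoise {Ω : Type*} [MeasurableSpace Ω] (μ : Measure Ω)
    (X : ℕ × ℕ → Ω → ℂ) : Prop where
  gaussian : ∀ α, HasGaussianLaw (X α) μ
  indep : iIndepFun X μ
  mean : ∀ α, ∫ ϖ, X α ϖ ∂μ = 0
  variance : ∀ α, ∫ ϖ, X α ϖ * conj (X α ϖ) ∂μ = 1
  pseudoVariance : ∀ α, ∫ ϖ, X α ϖ * X α ϖ ∂μ = 0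

theorem IsComplexWhiteNoise.memLp {Ω : Type*} [MeasurableSpace Ω] {μ : Measure Ω}
    {X : ℕ × ℕ → Ω → ℂ} (hX : IsComplexWhiteNoise μ X) (α : ℕ × ℕ) : MemLp (X α) 2 μ :=
  (hX.gaussian α).memLp_two

/-- The coefficient `(f|e_n) = ∫_{∂D} f conj(e_n)`. -/
def coeff {d : ℕ} (D : Set (EuclideanSpace ℝ (Fin d)))
    (e : HilbertBasis ℕ ℂ (Lp ℂ 2 (surfaceMeasure D))) (f : EuclideanSpace ℝ (Fin d) → ℂ)
    (n : ℕ) : ℂ :=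
  ∫ x, f x * conj (e n x) ∂(surfaceMeasure D)

/-- The term `(f|e_{α₁}) (g|e_{α₂}) X_α` of the noise, as an element of `L²(Ω)`. -/
def noiseSummand {d : ℕ} (D : Set (EuclideanSpace ℝ (Fin d)))
    (e : HilbertBasis ℕ ℂ (Lp ℂ 2 (surfaceMeasure D))) {Ω : Type*} [MeasurableSpace Ω]
    {μ : Measure Ω} {X : ℕ × ℕ → Ω → ℂ} (hX : IsComplexWhiteNoise μ X)
    (f g : EuclideanSpace ℝ (Fin d) → ℂ) (α : ℕ × ℕ) : Lp ℂ 2 μ :=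
  (coeff D e f α.1 * coeff D e g α.2) • (hX.memLp α).toLp (X α)

/-- The noisy data `𝒩_γ(f, g) = ∫_{∂D} Λ_γ f g + ∑_α (f|e_{α₁}) (g|e_{α₂}) X_α`,
where the series converges in `L²(Ω)`. -/
def noisyData {d : ℕ} (D : Set (EuclideanSpace ℝ (Fin d))) (γ : EuclideanSpace ℝ (Fin d) → ℝ)
    (e : HilbertBasis ℕ ℂ (Lp ℂ 2 (surfaceMeasure D))) {Ω : Type*} [MeasurableSpace Ω]
    {μ : Measure Ω} {X : ℕ × ℕ → Ω → ℂ} (hX : IsComplexWhiteNoise μ X)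
    (f g : EuclideanSpace ℝ (Fin d) → ℂ) (ϖ : Ω) : ℂ :=
  dnPairing D γ f g + (∑' α, noiseSummand D e hX f g α : Lp ℂ 2 μ) ϖ

/-! ### The explicit boundary data -/

/-- A smooth cutoff `η : ℝ → [0,1]` with `η = 1` on `|t| ≤ 1/2` and `η = 0` on `|t| ≥ 1`. -/
structure IsCutoff (η : ℝ → ℝ) : Prop where
  smooth : ContDiff ℝ ∞ η
  mem_Icc : ∀ t, η t ∈ Set.Icc (0 : ℝ) 1
  eq_one : ∀ t, |t| ≤ 1 / 2 → η t = 1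
  eq_zero : ∀ t, 1 ≤ |t| → η t = 0

namespace BoundaryChart

variable {d : ℕ} {D : Set (EuclideanSpace ℝ (Fin d))} {θ : ℝ} {P : EuclideanSpace ℝ (Fin d)}

/-- The slope `∇φ(p')` of the boundary at `P = (p', φ(p'))`. -/
def slope (κ : BoundaryChart D θ P) : EuclideanSpace ℝ (Fin (d - 1)) :=
  gradient κ.φ (κ.coord P).fst

/-- The flattened coordinates `x = F⁻¹(y) = (y' - p', y_d - φ(y'))`. -/
def flat (κ : BoundaryChart D θ P) (y : EuclideanSpace ℝ (Fin d)) : Coord d :=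
  WithLp.toLp 2 ((κ.coord y).fst - (κ.coord P).fst, (κ.coord y).snd - κ.φ (κ.coord y).fst)

/-- The linear map `ξ ↦ (∇F⁻¹)ᵗ ξ = (ξ' - ξ_d ∇φ(p'), ξ_d)` at the point `P`. -/
def jacT (κ : BoundaryChart D θ P) (ξ : Coord d) : Coord d :=
  WithLp.toLp 2 (ξ.fst - ξ.snd • κ.slope, ξ.snd)

/-- The bilinear form `ξ · A ζ` with the matrix `A = ∇F⁻¹ (∇F⁻¹)ᵗ` at the point `P`. -/
def formA (κ : BoundaryChart D θ P) (ξ ζ : Coord d) : ℝ :=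
  inner ℝ (κ.jacT ξ) (κ.jacT ζ)

/-- The vector `ξ` satisfies `ξ · A ξ = e_d · A e_d` and `ξ · A e_d = 0`. (The matrix of the
conductivity equation at `P` in the flattened coordinates is `γ(P) A`, and the factor `γ(P) > 0`
does not affect these two conditions.) -/
def IsAdmissible (κ : BoundaryChart D θ P) (ξ : Coord d) : Prop :=
  κ.formA ξ ξ = κ.formA (WithLp.toLp 2 (0, 1)) (WithLp.toLp 2 (0, 1)) ∧
    κ.formA ξ (WithLp.toLp 2 (0, 1)) = 0

/-- The constant `C_P = ((1 + |∇φ(p')|²) ∫_{ℝ^{d-1}} η(|x'|)² dx')^{-1/2}`. -/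
def normConst (κ : BoundaryChart D θ P) (η : ℝ → ℝ) : ℝ :=
  ((1 + ‖κ.slope‖ ^ 2) * ∫ x : EuclideanSpace ℝ (Fin (d - 1)), η ‖x‖ ^ 2) ^ (-(1 / 2) : ℝ)

/-- The boundary data
`f_N = N^{-1/2} M^{(d-1)/2} C_P η(M|x'|) η(M x_d) e^{N (iξ - e_d) · x}` with `x = F⁻¹(y)` and
`M = N^{1/(1+θ)}`; only the values at `y ∈ ∂D` matter. -/
def boundaryData (κ : BoundaryChart D θ P) (η : ℝ → ℝ) (ξ : Coord d) (N : ℕ)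
    (y : EuclideanSpace ℝ (Fin d)) : ℂ :=
  let M : ℝ := (N : ℝ) ^ (1 / (1 + θ))
  let x : Coord d := κ.flat y
  (((N : ℝ) ^ (-(1 / 2) : ℝ) * M ^ (((d : ℝ) - 1) / 2) * κ.normConst η *
      (η (M * ‖x.fst‖) * η (M * x.snd)) : ℝ) : ℂ) *
    Complex.exp ((N : ℂ) * (Complex.I * ((inner ℝ ξ x : ℝ) : ℂ) - ((x.snd : ℝ) : ℂ)))

end BoundaryChart

end Calderon

end

/-! The formula for f_N makes sense on all of ℝ^d and defines there a C¹ function: an oscillating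
wave that lives in a box of size 1/M around P, up to the straightening of the boundary, and decays
like e^{-N x_d} into D. This extension nearly solves the conductivity equation, so the quadratic
form of the Dirichlet-to-Neumann map is nearly its energy, and its energy is nearly γ(P).

Reduction to energies (`exists_unique_dnPairing`). In L²(D)^d let a = √γ ∇f, and let p be its
orthogonal projection to the space W of weighted gradients of functions with zero trace. Then a - p
is the weighted gradient of the solution, and the pairing of f with its conjugate is ‖a‖² - ‖p‖². If
|∫ γ ∇f · H| ≤ A ‖H‖ for every zero-trace gradient H, then ‖p‖² ≤ A²/γ₀. The projection exists
because W is closed, which follows from a Poincaré inequality with a boundary term; its constant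
serves only for existence and enters no final bound.

Small divergence (`BoundaryChart.norm_energyForm_le`). The boundary is flattened by a
volume-preserving shear. The leading part of ∇f_N is the wave times the covector iξ - e_d frozen at
P. Admissibility says that this covector is null for A, hence the exponential has zero derivative in
the direction A(iξ - e_d). Integration by parts in the half-space then leaves, for zero trace, only
the term in which the cutoff is differentiated. That term costs a factor M, and the inequality ∫
e^{-Nt}|w| ≤ N⁻¹(|w(0)| + ∫ e^{-Nt}|w'|) gains 1/N. The other errors come from freezing γ at P, of
order 1/M, and from freezing the slope, of order M^{-θ}. The choice M = N^{1/(1+θ)} makes M/N =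
M^{-θ} = N^{-θ/(1+θ)} =: δ, so A = O(δ).

Energy (`BoundaryChart.abs_leadField_energy_sub_le`). The modulus of the leading part does not see
the oscillation; its square integrates to a tangential integral of η² times a half-line integral
close to 1/(2N). The constant C_P normalizes the product to 1 + O(M/N). Together, the pairing is
γ(P) + O(δ).

Noise. The series is an orthogonal expansion whose L²(Ω) norm is ‖f_N‖² in L²(∂D), which is O(1/N).
Chebyshev's inequality with a deviation of order δ bounds the failure probability by (Nδ)^{-2} =
M^{-2}, which is at most ε for the stated N.

The box must lie in the ball of the chart. This can fail only for N below a bound that depends on r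
and L, and for those N crude estimates suffice. -/

noncomputable section

namespace Calderon

/-! ### Uniform charts and admissible vectors -/

namespace BoundaryChart

variable {d : ℕ} {D : Set (EuclideanSpace ℝ (Fin d))} {θ : ℝ} {P : EuclideanSpace ℝ (Fin d)}

/-- A chart at `P` is a chart at every point `Q`, with a radius for which the ball at `Q` is
contained in the original one. -/
def recenter (κ : BoundaryChart D θ P) (Q : EuclideanSpace ℝ (Fin d)) (ρ : ℝ) (hρ : 0 < ρ)
    (h : dist Q P + ρ ≤ κ.radius) : BoundaryChart D θ Q where
  coord := κ.coord
  radius := ρ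
  radius_pos := hρ
  φ := κ.φ
  bound := κ.bound
  differentiable := κ.differentiable
  norm_gradient_le := κ.norm_gradient_le
  holder_gradient := κ.holder_gradient
  mem_iff y hy := κ.mem_iff y (Metric.ball_subset_ball' (by linarith) hy)
  mem_frontier_iff y hy := κ.mem_frontier_iff y (Metric.ball_subset_ball' (by linarith) hy)

theorem bound_nonneg (κ : BoundaryChart D θ P) : 0 ≤ κ.bound :=
  (norm_nonneg _).trans (κ.norm_gradient_le 0)

/-- Admissibility of ξ says that Bᵗξ is orthogonal to a = Bᵗe_d = (-s, 1), s the slope, and as long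
as a. The vector b = (w, s·w) is orthogonal to a, and the shear `jacT` is inverted by hand on a
multiple of b. A nonzero w needs d - 1 ≥ 1. -/
theorem exists_isAdmissible (hd : 2 ≤ d) (κ : BoundaryChart D θ P) :
    ∃ ξ : Coord d, κ.IsAdmissible ξ := by
  obtain ⟨w, hw⟩ : ∃ w : EuclideanSpace ℝ (Fin (d - 1)), w ≠ 0 :=
    ⟨EuclideanSpace.single ⟨0, by omega⟩ 1, by
      intro h
      have := congrArg norm h
      simp at this⟩
  let b : Coord d := WithLp.toLp 2 (w, inner ℝ κ.slope w)
  have hb : 0 < ‖b‖ := by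
    rw [norm_pos_iff]
    intro h
    exact hw (congrArg WithLp.fst h)
  let a : Coord d := κ.jacT (WithLp.toLp 2 (0, 1))
  let t : ℝ := ‖a‖ / ‖b‖
  have hab : inner ℝ b a = 0 := by
    simp [b, a, jacT, WithLp.prod_inner_apply, real_inner_comm]
  have hj : κ.jacT (WithLp.toLp 2 (t • (w + inner ℝ κ.slope w • κ.slope), t * inner ℝ κ.slope w))
      = t • b := by
    have : t • (w + inner ℝ κ.slope w • κ.slope) - (t * inner ℝ κ.slope w) • κ.slope = t • w := by
      module
    change WithLp.toLp 2 (t • (w + inner ℝ κ.slope w • κ.slope) - (t * inner ℝ κ.slope w) • κ.slope,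
      t * inner ℝ κ.slope w) = t • b
    rw [this]
    rfl
  refine ⟨WithLp.toLp 2 (t • (w + inner ℝ κ.slope w • κ.slope), t * inner ℝ κ.slope w), ?_, ?_⟩
  · change inner ℝ (κ.jacT _) (κ.jacT _) = inner ℝ a a
    rw [hj, real_inner_self_eq_norm_sq, real_inner_self_eq_norm_sq, norm_smul, Real.norm_eq_abs,
      abs_of_nonneg (by positivity)]
    simp only [t]
    field_simp
  · change inner ℝ (κ.jacT _) a = 0
    rw [hj, inner_smul_left, hab]
    simp

end BoundaryChart

/-- Finitely many balls of half the chart radius cover the compact boundary, and every point of such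
a ball inherits the chart with half its radius. -/
theorem exists_uniform_charts {d : ℕ} {D : Set (EuclideanSpace ℝ (Fin d))} {θ : ℝ}
    (hDbdd : Bornology.IsBounded D) (hreg : HasC1HolderBoundary D θ) :
    ∃ r : ℝ, 0 < r ∧ ∃ L : ℝ, ∀ P ∈ frontier D, ∃ κ : BoundaryChart D θ P,
      r ≤ κ.radius ∧ κ.bound ≤ L := by
  have hcomp : IsCompact (frontier D) :=
    hDbdd.isCompact_closure.of_isClosed_subset isClosed_frontier frontier_subset_closure
  obtain ⟨t, ht⟩ := hcomp.elim_nhds_subcover'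
    (fun P hP => Metric.ball P ((hreg P hP).some.radius / 2))
    (fun P hP => Metric.ball_mem_nhds _ (half_pos (hreg P hP).some.radius_pos))
  let κ' : frontier D → Σ P, BoundaryChart D θ P := fun P => ⟨P, (hreg P.1 P.2).some⟩
  have hr : ∃ r : ℝ, 0 < r ∧ ∀ P ∈ t, r ≤ (κ' P).2.radius / 2 := by
    rcases t.eq_empty_or_nonempty with h | h
    -- For an empty cover any radius will do.
    · exact ⟨1, one_pos, by simp [h]⟩
    · refine ⟨t.inf' h fun P => (κ' P).2.radius / 2, ?_, fun P hP => Finset.inf'_le _ hP⟩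
      rw [Finset.lt_inf'_iff]
      exact fun P _ => half_pos (κ' P).2.radius_pos
  obtain ⟨r, hr0, hr⟩ := hr
  obtain ⟨L, hL⟩ : ∃ L : ℝ, ∀ P ∈ t, (κ' P).2.bound ≤ L := by
    obtain ⟨L, hL⟩ := (t.image fun P => (κ' P).2.bound).bddAbove
    exact ⟨L, fun P hP => hL (by simpa using ⟨P.1, P.2, hP, rfl⟩)⟩
  refine ⟨r, hr0, L, fun Q hQ => ?_⟩
  obtain ⟨P, hP, hQP⟩ := Set.mem_iUnion₂.mp (ht hQ)
  rw [Metric.mem_ball] at hQP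
  refine ⟨(κ' P).2.recenter Q ((κ' P).2.radius / 2) (half_pos (κ' P).2.radius_pos) ?_, hr P hP,
    hL P hP⟩
  change dist Q P < (κ' P).2.radius / 2 at hQP
  change dist Q P + _ ≤ _
  linarith


/-! ### The noise -/

theorem IsComplexWhiteNoise.orthonormal {Ω : Type*} [MeasurableSpace Ω] {μ : Measure Ω}
    [IsProbabilityMeasure μ] {X : ℕ × ℕ → Ω → ℂ} (hX : IsComplexWhiteNoise μ X) :
    Orthonormal ℂ fun α => (hX.memLp α).toLp (X α) := by
  classical
  rw [orthonormal_iff_ite]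
  intro α β
  rw [L2.inner_def]
  have h1 : ∫ ϖ, inner ℂ (((hX.memLp α).toLp (X α) : Lp ℂ 2 μ) ϖ)
      (((hX.memLp β).toLp (X β) : Lp ℂ 2 μ) ϖ) ∂μ = ∫ ϖ, X β ϖ * conj (X α ϖ) ∂μ := by
    apply integral_congr_ae
    filter_upwards [(hX.memLp α).coeFn_toLp, (hX.memLp β).coeFn_toLp] with ϖ h1 h2
    rw [h1, h2, RCLike.inner_apply]
  rw [h1]
  split_ifs with h
  · subst h
    exact hX.variance α
  · have hind : IndepFun (X β) (fun ϖ => conj (X α ϖ)) μ :=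
      (hX.indep.indepFun (Ne.symm h)).comp measurable_id Complex.continuous_conj.measurable
    rw [hind.integral_fun_mul_eq_mul_integral (hX.memLp β).1
      (Complex.continuous_conj.comp_aestronglyMeasurable (hX.memLp α).1), hX.mean β, zero_mul]

theorem hasSum_smul_orthonormal {H ι : Type*} [NormedAddCommGroup H] [InnerProductSpace ℂ H]
    [CompleteSpace H] {x : ι → H} (hx : Orthonormal ℂ x) {c : ι → ℂ} {S : ℝ}
    (hc : HasSum (fun i => ‖c i‖ ^ 2) S) :
    Summable (fun i => c i • x i) ∧ ‖∑' i, c i • x i‖ ^ 2 = S := by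
  have hmem : Memℓp c 2 := by
    apply memℓp_gen
    simpa using hc.summable
  let C : lp (fun _ : ι => ℂ) 2 := ⟨c, hmem⟩
  have hs := hx.orthogonalFamily.hasSum_linearIsometry C
  have hs' : HasSum (fun i => c i • x i) (hx.orthogonalFamily.linearIsometry C) := by
    simpa [LinearIsometry.toSpanSingleton_apply] using hs
  refine ⟨hs'.summable, ?_⟩
  rw [hs'.tsum_eq, LinearIsometry.norm_map]
  have := lp.norm_rpow_eq_tsum (p := 2) (by norm_num) C
  simp only [ENNReal.toReal_ofNat, Real.rpow_ofNat] at this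
  rw [this]
  exact hc.tsum_eq

theorem hasSum_norm_coeff_sq {d : ℕ} {D : Set (EuclideanSpace ℝ (Fin d))}
    (e : HilbertBasis ℕ ℂ (Lp ℂ 2 (surfaceMeasure D))) {f : EuclideanSpace ℝ (Fin d) → ℂ}
    (hf : MemLp f 2 (surfaceMeasure D)) :
    HasSum (fun n => ‖coeff D e f n‖ ^ 2) (‖hf.toLp f‖ ^ 2) := by
  have h1 : ∀ n, coeff D e f n = e.repr (hf.toLp f) n := by
    intro n
    rw [HilbertBasis.repr_apply_apply, L2.inner_def, coeff]
    apply integral_congr_ae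
    filter_upwards [hf.coeFn_toLp] with x hx
    rw [hx, RCLike.inner_apply]
  have h2 := lp.hasSum_norm (p := 2) (by norm_num) (e.repr (hf.toLp f))
  simp only [ENNReal.toReal_ofNat, Real.rpow_ofNat, LinearIsometryEquiv.norm_map] at h2
  simpa only [h1] using h2

theorem hasSum_mul_of_nonneg {a b : ℕ → ℝ} {s t : ℝ} (ha : HasSum a s) (hb : HasSum b t)
    (ha0 : ∀ n, 0 ≤ a n) (hb0 : ∀ n, 0 ≤ b n) :
    HasSum (fun α : ℕ × ℕ => a α.1 * b α.2) (s * t) :=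
  ha.mul hb (ha.summable.mul_of_nonneg hb.summable ha0 hb0)

/-- The X_α are orthonormal in L²(Ω), so the squared norm of the series is the double sum of the
squared coefficients. This sum factors, and Parseval in L²(∂D) evaluates each factor. -/
theorem noise_summable_and_norm {d : ℕ} {D : Set (EuclideanSpace ℝ (Fin d))}
    (e : HilbertBasis ℕ ℂ (Lp ℂ 2 (surfaceMeasure D))) {Ω : Type*} [MeasurableSpace Ω]
    {μ : Measure Ω} [IsProbabilityMeasure μ] {X : ℕ × ℕ → Ω → ℂ} (hX : IsComplexWhiteNoise μ X)
    {f g : EuclideanSpace ℝ (Fin d) → ℂ} (hf : MemLp f 2 (surfaceMeasure D))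
    (hg : MemLp g 2 (surfaceMeasure D)) :
    Summable (noiseSummand D e hX f g) ∧
      ‖∑' α, noiseSummand D e hX f g α‖ = ‖hf.toLp f‖ * ‖hg.toLp g‖ := by
  have h1 := hasSum_norm_coeff_sq e hf
  have h2 := hasSum_norm_coeff_sq e hg
  have h3 : HasSum (fun α : ℕ × ℕ => ‖coeff D e f α.1 * coeff D e g α.2‖ ^ 2)
      (‖hf.toLp f‖ ^ 2 * ‖hg.toLp g‖ ^ 2) := by
    simp only [norm_mul, mul_pow]
    exact hasSum_mul_of_nonneg h1 h2 (fun _ => sq_nonneg _) fun _ => sq_nonneg _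
  obtain ⟨h4, h5⟩ := hasSum_smul_orthonormal hX.orthonormal h3
  refine ⟨h4, ?_⟩
  rw [← mul_pow, pow_left_inj₀ (norm_nonneg _) (by positivity) two_ne_zero] at h5
  exact h5

/-- Chebyshev's inequality for the second moment. -/
theorem one_sub_le_measureReal_norm_le {Ω : Type*} [MeasurableSpace Ω] {μ : Measure Ω}
    [IsProbabilityMeasure μ] (Y : Lp ℂ 2 μ) {t : ℝ} (ht : 0 < t) :
    1 - ‖Y‖ ^ 2 / t ^ 2 ≤ μ.real {ϖ | ‖Y ϖ‖ ≤ t} := by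
  have h1 := meas_ge_le_mul_pow_eLpNorm_enorm μ (p := 2) two_ne_zero ENNReal.ofNat_ne_top
    (Lp.aestronglyMeasurable Y) (ε := ENNReal.ofReal t) (by simpa using ht)
    (fun h => absurd h ENNReal.ofReal_ne_top)
  have h2 : μ.real {ϖ | t < ‖Y ϖ‖} ≤ ‖Y‖ ^ 2 / t ^ 2 := by
    refine ENNReal.toReal_le_of_le_ofReal (by positivity) ?_
    refine (measure_mono ?_).trans (h1.trans_eq ?_)
    · intro ϖ hϖ
      simp only [Set.mem_ofPred_eq] at hϖ ⊢
      rw [← ofReal_norm]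
      exact ENNReal.ofReal_le_ofReal hϖ.le
    · rw [← Lp.enorm_def, ← ofReal_norm, ENNReal.toReal_ofNat, ENNReal.rpow_ofNat,
        ENNReal.rpow_ofNat, ← ENNReal.ofReal_inv_of_pos ht, ← ENNReal.ofReal_pow (by positivity),
        ← ENNReal.ofReal_pow (by positivity), ← ENNReal.ofReal_mul (by positivity)]
      congr 1
      field_simp
  have h3 : (1 : ℝ) ≤ μ.real {ϖ | ‖Y ϖ‖ ≤ t} + μ.real {ϖ | t < ‖Y ϖ‖} := by
    have : (Set.univ : Set Ω) = {ϖ | ‖Y ϖ‖ ≤ t} ∪ {ϖ | t < ‖Y ϖ‖} := by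
      ext ϖ
      simpa using le_or_gt _ _
    have h4 := measureReal_union_le (μ := μ) {ϖ | ‖Y ϖ‖ ≤ t} {ϖ | t < ‖Y ϖ‖}
    rw [← this] at h4
    simpa using h4
  linarith


/-! ### Straightening the boundary -/

theorem Coord.norm_le_add {d : ℕ} (x : Coord d) : ‖x‖ ≤ ‖x.fst‖ + |x.snd| := by
  rw [WithLp.prod_norm_eq_of_L2]
  refine Real.sqrt_le_iff.mpr ⟨by positivity, ?_⟩
  rw [Real.norm_eq_abs]
  nlinarith [norm_nonneg x.fst, abs_nonneg x.snd]

theorem Coord.norm_fst_le {d : ℕ} (x : Coord d) : ‖x.fst‖ ≤ ‖x‖ := by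
  rw [WithLp.prod_norm_eq_of_L2]
  exact Real.le_sqrt_of_sq_le (by nlinarith [sq_nonneg ‖x.snd‖])

theorem Coord.abs_snd_le {d : ℕ} (x : Coord d) : |x.snd| ≤ ‖x‖ := by
  rw [WithLp.prod_norm_eq_of_L2]
  exact Real.le_sqrt_of_sq_le (by rw [Real.norm_eq_abs]; nlinarith [sq_nonneg ‖x.fst‖])

namespace BoundaryChart

variable {d : ℕ} {D : Set (EuclideanSpace ℝ (Fin d))} {θ : ℝ} {P : EuclideanSpace ℝ (Fin d)}

theorem norm_gradient_eq (κ : BoundaryChart D θ P) (x : EuclideanSpace ℝ (Fin (d - 1))) :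
    ‖fderiv ℝ κ.φ x‖ = ‖gradient κ.φ x‖ := by
  rw [gradient, LinearIsometryEquiv.norm_map]

theorem lipschitz (κ : BoundaryChart D θ P) : LipschitzWith (Real.toNNReal κ.bound) κ.φ := by
  refine lipschitzWith_of_nnnorm_fderiv_le κ.differentiable fun x => ?_
  rw [← NNReal.coe_le_coe, Real.coe_toNNReal _ κ.bound_nonneg, coe_nnnorm, norm_gradient_eq]
  exact κ.norm_gradient_le x

theorem abs_φ_sub_le (κ : BoundaryChart D θ P) (x y : EuclideanSpace ℝ (Fin (d - 1))) :
    |κ.φ x - κ.φ y| ≤ κ.bound * ‖x - y‖ := by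
  have := κ.lipschitz.dist_le_mul x y
  rwa [Real.dist_eq, dist_eq_norm, Real.coe_toNNReal _ κ.bound_nonneg] at this

theorem contDiff (κ : BoundaryChart D θ P) (hθ : 0 < θ) : ContDiff ℝ 1 κ.φ := by
  rw [contDiff_one_iff_fderiv]
  refine ⟨κ.differentiable, ?_⟩
  rw [← toDual_comp_gradient]
  refine (LinearIsometryEquiv.continuous _).comp ?_
  rw [Metric.continuous_iff']
  intro x ε hε
  have h : Tendsto (fun y => κ.bound * ‖y - x‖ ^ θ) (𝓝 x) (𝓝 0) := by
    have h1 : Tendsto (fun y => ‖y - x‖) (𝓝 x) (𝓝 0) := by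
      have : Continuous fun y => ‖y - x‖ := by fun_prop
      simpa using this.tendsto x
    simpa [Real.zero_rpow hθ.ne'] using (h1.rpow_const (Or.inr hθ.le)).const_mul κ.bound
  filter_upwards [h.eventually (gt_mem_nhds hε)] with y hy
  rw [dist_eq_norm]
  exact (κ.holder_gradient y x).trans_lt hy

theorem coord_snd_eq (κ : BoundaryChart D θ P) (hP : P ∈ frontier D) :
    (κ.coord P).snd = κ.φ (κ.coord P).fst :=
  (κ.mem_frontier_iff P (Metric.mem_ball_self κ.radius_pos)).mp hP

/-- The change of variables `F⁻¹` that straightens the boundary. -/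
def straighten (κ : BoundaryChart D θ P) :
    EuclideanSpace ℝ (Fin d) ≃ₜ EuclideanSpace ℝ (Fin (d - 1)) × ℝ where
  toFun y := ((κ.coord y).fst - (κ.coord P).fst, (κ.coord y).snd - κ.φ (κ.coord y).fst)
  invFun x := κ.coord.symm
    (WithLp.toLp 2 (x.1 + (κ.coord P).fst, x.2 + κ.φ (x.1 + (κ.coord P).fst)))
  left_inv y := by
    simp only [sub_add_cancel]
    exact κ.coord.symm_apply_apply y
  right_inv x := by simp
  continuous_toFun := by
    have := κ.differentiable.continuous
    have h := κ.coord.continuous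
    have h0 := (WithLp.prod_continuous_ofLp 2 (EuclideanSpace ℝ (Fin (d - 1))) ℝ).comp h
    have h1 : Continuous fun y => (κ.coord y).fst := continuous_fst.comp h0
    have h2 : Continuous fun y => (κ.coord y).snd := continuous_snd.comp h0
    fun_prop
  continuous_invFun := by
    have := κ.differentiable.continuous
    refine κ.coord.symm.continuous.comp ((WithLp.prod_continuous_toLp 2 _ _).comp ?_)
    fun_prop

theorem measurePreserving_coord (κ : BoundaryChart D θ P) :
    MeasurePreserving κ.coord volume volume := by
  have h1 := κ.coord.linearIsometryEquiv.measurePreserving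
  have h2 : MeasurePreserving (fun x : Coord d => x + κ.coord 0) volume volume :=
    measurePreserving_add_right volume _
  have h3 := h2.comp h1
  have h4 : ⇑κ.coord = (fun x => x + κ.coord 0) ∘ ⇑κ.coord.linearIsometryEquiv := by
    funext y
    have := κ.coord.map_vadd 0 y
    simpa using this
  rw [h4]
  exact h3

/-- After a rigid motion the map is a shear, which translates every vertical line. No Jacobian
factor therefore appears when integrals pass to flat coordinates. -/
theorem measurePreserving_straighten (κ : BoundaryChart D θ P) :
    MeasurePreserving κ.straighten volume volume := by
  have h1 := (WithLp.volume_preserving_ofLp (EuclideanSpace ℝ (Fin (d - 1))) ℝ).comp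
    κ.measurePreserving_coord
  have hc := κ.differentiable.continuous
  have h2 : MeasurePreserving
      (fun x : EuclideanSpace ℝ (Fin (d - 1)) × ℝ => (x.1 - (κ.coord P).fst, x.2 - κ.φ x.1))
      volume volume := by
    refine (measurePreserving_sub_right volume _).skew_product
      (g := fun x t => t - κ.φ x) ?_ ?_
    · have : Continuous (Function.uncurry fun (x : EuclideanSpace ℝ (Fin (d - 1))) (t : ℝ) =>
        t - κ.φ x) := by
        unfold Function.uncurry
        fun_prop
      exact this.measurable
    · exact Eventually.of_forall fun x => (measurePreserving_sub_right volume (κ.φ x)).map_eq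
  exact h2.comp h1

/-- This keeps the support of the data near P: flat coordinates of size 1/M mean a distance of at
most (2 + `bound`)/M. -/
theorem norm_sub_le_of_straighten (κ : BoundaryChart D θ P) (hP : P ∈ frontier D)
    (y : EuclideanSpace ℝ (Fin d)) :
    ‖y - P‖ ≤ (1 + κ.bound) * ‖(κ.straighten y).1‖ + |(κ.straighten y).2| := by
  have h1 : ‖y - P‖ = ‖κ.coord y - κ.coord P‖ := by
    rw [← dist_eq_norm, ← dist_eq_norm, κ.coord.dist_map]
  have h2 := Coord.norm_le_add (κ.coord y - κ.coord P)
  have h3 := κ.abs_φ_sub_le (κ.coord y).fst (κ.coord P).fst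
  have h4 := κ.coord_snd_eq hP
  rw [h1]
  simp only [WithLp.sub_fst, WithLp.sub_snd] at h2
  change _ ≤ (1 + κ.bound) * ‖(κ.coord y).fst - (κ.coord P).fst‖
    + |(κ.coord y).snd - κ.φ (κ.coord y).fst|
  have h5 : |(κ.coord y).snd - (κ.coord P).snd| ≤ |(κ.coord y).snd - κ.φ (κ.coord y).fst|
      + |κ.φ (κ.coord y).fst - κ.φ (κ.coord P).fst| := by
    rw [h4]
    exact abs_sub_le _ _ _
  linarith

theorem mem_iff_straighten (κ : BoundaryChart D θ P) {y : EuclideanSpace ℝ (Fin d)}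
    (hy : y ∈ Metric.ball P κ.radius) : y ∈ D ↔ 0 < (κ.straighten y).2 :=
  (κ.mem_iff y hy).trans sub_pos.symm

theorem mem_frontier_iff_straighten (κ : BoundaryChart D θ P) {y : EuclideanSpace ℝ (Fin d)}
    (hy : y ∈ Metric.ball P κ.radius) : y ∈ frontier D ↔ (κ.straighten y).2 = 0 :=
  (κ.mem_frontier_iff y hy).trans sub_eq_zero.symm

end BoundaryChart

/-! ### The surface measure -/

theorem euclideanHausdorffMeasure_image_le {X Y : Type*} [EMetricSpace X] [MeasurableSpace X]
    [BorelSpace X] [EMetricSpace Y] [MeasurableSpace Y] [BorelSpace Y] {f : X → Y} {C : NNReal}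
    (hf : LipschitzWith C f) (n : ℕ) (s : Set X) :
    Measure.euclideanHausdorffMeasure n (f '' s)
      ≤ (C : ENNReal) ^ n * Measure.euclideanHausdorffMeasure n s := by
  rw [Measure.euclideanHausdorffMeasure_def, Measure.euclideanHausdorffMeasure_def]
  simp only [Measure.smul_apply, ENNReal.smul_def, smul_eq_mul]
  have := hf.hausdorffMeasure_image_le (d := n) (by positivity) s
  rw [ENNReal.rpow_natCast] at this
  rw [mul_left_comm]
  gcongr

namespace BoundaryChart

variable {d : ℕ} {D : Set (EuclideanSpace ℝ (Fin d))} {θ : ℝ} {P : EuclideanSpace ℝ (Fin d)}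

/-- The projection onto the first `d - 1` coordinates does not increase surface measure. -/
theorem volume_image_fst_le (κ : BoundaryChart D θ P) (s : Set (EuclideanSpace ℝ (Fin d))) :
    volume ((fun y => (κ.coord y).fst) '' s) ≤ Measure.euclideanHausdorffMeasure (d - 1) s := by
  have h : LipschitzWith 1 fun y => (κ.coord y).fst := by
    refine LipschitzWith.of_dist_le_mul fun x y => ?_
    rw [NNReal.coe_one, one_mul, ← κ.coord.dist_map x y, dist_eq_norm, dist_eq_norm]
    exact Coord.norm_fst_le (κ.coord x - κ.coord y)
  simpa [EuclideanSpace.euclideanHausdorffMeasure_eq_volume] using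
    euclideanHausdorffMeasure_image_le h (d - 1) s

/-- Inside the chart ball the boundary lies in the image of ℝ^{d-1} under the graph map, which is
Lipschitz with constant 1 + `bound`. -/
theorem surface_graph_le (κ : BoundaryChart D θ P) (s : ℝ) :
    Measure.euclideanHausdorffMeasure (d - 1)
        {y | y ∈ frontier D ∧ y ∈ Metric.ball P κ.radius ∧ ‖(κ.straighten y).1‖ ≤ s}
      ≤ ENNReal.ofReal ((1 + κ.bound) ^ (d - 1)) *
        volume (Metric.closedBall (0 : EuclideanSpace ℝ (Fin (d - 1))) s) := by
  have hf : LipschitzWith (1 + Real.toNNReal κ.bound)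
      (fun x : EuclideanSpace ℝ (Fin (d - 1)) =>
        κ.coord.symm (WithLp.toLp 2 (x + (κ.coord P).fst, κ.φ (x + (κ.coord P).fst)))) := by
    refine LipschitzWith.of_dist_le_mul fun x y => ?_
    rw [κ.coord.symm.dist_map, dist_eq_norm]
    refine (Coord.norm_le_add _).trans ?_
    have := κ.abs_φ_sub_le (x + (κ.coord P).fst) (y + (κ.coord P).fst)
    simp only [add_sub_add_right_eq_sub] at this
    rw [NNReal.coe_add, NNReal.coe_one, Real.coe_toNNReal _ κ.bound_nonneg, dist_eq_norm]
    change ‖x + (κ.coord P).fst - (y + (κ.coord P).fst)‖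
      + |κ.φ (x + (κ.coord P).fst) - κ.φ (y + (κ.coord P).fst)| ≤ _
    rw [add_sub_add_right_eq_sub]
    linarith
  refine (measure_mono ?_).trans ((euclideanHausdorffMeasure_image_le hf (d - 1)
    (Metric.closedBall (0 : EuclideanSpace ℝ (Fin (d - 1))) s)).trans_eq ?_)
  · rintro y ⟨h1, h2, h3⟩
    refine ⟨(κ.straighten y).1, by simpa using h3, ?_⟩
    have h4 := (κ.mem_frontier_iff_straighten h2).mp h1
    have h5 := κ.straighten.symm_apply_apply y
    refine Eq.trans ?_ h5
    change _ = κ.coord.symm _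
    rw [h4, zero_add]
  · rw [EuclideanSpace.euclideanHausdorffMeasure_eq_volume]
    congr 1
    rw [ENNReal.ofReal_pow (by linarith [κ.bound_nonneg]), ENNReal.ofReal_add zero_le_one
      κ.bound_nonneg]
    simp [ENNReal.ofReal]

end BoundaryChart

theorem surfaceMeasure_univ_lt_top {d : ℕ} {D : Set (EuclideanSpace ℝ (Fin d))} {θ : ℝ}
    (hDbdd : Bornology.IsBounded D) (hreg : HasC1HolderBoundary D θ) :
    surfaceMeasure D Set.univ < ⊤ := by
  have hcomp : IsCompact (frontier D) :=
    hDbdd.isCompact_closure.of_isClosed_subset isClosed_frontier frontier_subset_closure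
  rw [surfaceMeasure, Measure.restrict_apply_univ]
  refine hcomp.measure_lt_top_of_nhdsWithin fun P hP => ?_
  obtain ⟨κ⟩ := hreg P hP
  refine ⟨frontier D ∩ Metric.ball P κ.radius,
    inter_mem_nhdsWithin _ (Metric.ball_mem_nhds _ κ.radius_pos), ?_⟩
  refine (measure_mono ?_).trans_lt ((κ.surface_graph_le κ.radius).trans_lt ?_)
  · rintro y ⟨h1, h2⟩
    refine ⟨h1, h2, ?_⟩
    have h3 := Coord.norm_fst_le (κ.coord y - κ.coord P)
    rw [← dist_eq_norm, κ.coord.dist_map] at h3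
    exact h3.trans (Metric.mem_ball.mp h2).le
  · exact ENNReal.mul_lt_top ENNReal.ofReal_lt_top measure_closedBall_lt_top


/-! ### Sobolev functions and traces -/

theorem memLp_of_continuous {X : Type*} [TopologicalSpace X] [MeasurableSpace X] [BorelSpace X]
    [SecondCountableTopology X] {F : X → ℂ} (hF : Continuous F) {μ : Measure X} {s K : Set X}
    (hμ : μ s < ⊤) (hs : MeasurableSet s) (hK : IsCompact K) (hsK : s ⊆ K) {p : ENNReal} :
    MemLp F p (μ.restrict s) := by
  have : IsFiniteMeasure (μ.restrict s) := ⟨by rwa [Measure.restrict_apply_univ]⟩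
  obtain ⟨C, hC⟩ := hK.exists_bound_of_continuousOn hF.continuousOn
  exact MemLp.of_bound hF.aestronglyMeasurable C
    ((ae_restrict_iff' hs).mpr (Eventually.of_forall fun x hx => hC x (hsK hx)))

theorem tendsto_integral_mul_of_tendsto_eLpNorm {X ι : Type*} [MeasurableSpace X] {μ : Measure X}
    {l : Filter ι} {F : ι → X → ℂ} {f g : X → ℂ} (hF : ∀ i, MemLp (F i) 2 μ) (hf : MemLp f 2 μ)
    (hg : MemLp g 2 μ) (h : Tendsto (fun i => eLpNorm (fun x => F i x - f x) 2 μ) l (𝓝 0)) :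
    Tendsto (fun i => ∫ x, F i x * g x ∂μ) l (𝓝 (∫ x, f x * g x ∂μ)) := by
  refine tendsto_integral_of_L1' _ (hf.integrable_mul hg).1
    (Eventually.of_forall fun i => (hF i).integrable_mul hg) ?_
  refine tendsto_of_tendsto_of_tendsto_of_le_of_le tendsto_const_nhds
    (h := fun i => eLpNorm (fun x => F i x - f x) 2 μ * eLpNorm g 2 μ) ?_
    (fun _ => zero_le) fun i => ?_
  · simpa using ENNReal.Tendsto.mul_const h (Or.inr hg.eLpNorm_ne_top)
  · have : ((fun x => F i x * g x) - fun x => f x * g x) = (fun x => F i x - f x) • g := by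
      ext x
      simp [sub_mul]
    change eLpNorm ((fun x => F i x * g x) - fun x => f x * g x) 1 μ ≤ _
    rw [this]
    exact eLpNorm_smul_le_mul_eLpNorm hg.1 ((hF i).sub hf).1

section Sobolev

variable {d : ℕ} {D : Set (EuclideanSpace ℝ (Fin d))}

theorem continuous_partialDeriv {F : Type*} [NormedAddCommGroup F] [NormedSpace ℝ F]
    {w : EuclideanSpace ℝ (Fin d) → F} (hw : ContDiff ℝ 1 w) (i : Fin d) :
    Continuous (partialDeriv i w) :=
  (hw.continuous_fderiv one_ne_zero).clm_apply continuous_const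

theorem memLp_volume_of_continuous (hDbdd : Bornology.IsBounded D) (hDopen : IsOpen D)
    {F : EuclideanSpace ℝ (Fin d) → ℂ} (hF : Continuous F) {p : ENNReal} :
    MemLp F p (volume.restrict D) :=
  memLp_of_continuous hF hDbdd.measure_lt_top hDopen.measurableSet hDbdd.isCompact_closure
    subset_closure

theorem memLp_surface_of_continuous (hDbdd : Bornology.IsBounded D)
    (hσ : surfaceMeasure D Set.univ < ⊤)
    {F : EuclideanSpace ℝ (Fin d) → ℂ} (hF : Continuous F) {p : ENNReal} :
    MemLp F p (surfaceMeasure D) :=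
  memLp_of_continuous hF (by rwa [surfaceMeasure, Measure.restrict_apply_univ] at hσ)
    isClosed_frontier.measurableSet hDbdd.isCompact_closure frontier_subset_closure

theorem IsH1.of_contDiff (hDbdd : Bornology.IsBounded D) (hDopen : IsOpen D)
    {w : EuclideanSpace ℝ (Fin d) → ℂ} (hw : ContDiff ℝ 1 w) :
    IsH1 D w fun i => partialDeriv i w where
  memLp := memLp_volume_of_continuous hDbdd hDopen hw.continuous
  memLp_grad i := memLp_volume_of_continuous hDbdd hDopen (continuous_partialDeriv hw i)
  weak_grad ψ hψ hψc hψD i := by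
    have hψ1 : ContDiff ℝ 1 ψ := hψ.of_le (by exact_mod_cast le_top)
    have hd : ∀ x v, fderiv ℝ (fun x => ((ψ x : ℝ) : ℂ)) x v = ((fderiv ℝ ψ x v : ℝ) : ℂ) := by
      intro x v
      have h := Complex.ofRealCLM.hasFDerivAt.comp x
        (hψ1.differentiable one_ne_zero x).hasFDerivAt
      exact congrArg (fun T => T v) h.fderiv
    have hz : ∀ x, x ∉ D → ψ x = 0 := fun x hx => image_eq_zero_of_notMem_tsupport
      fun h => hx (hψD h)
    have hz' : ∀ x, x ∉ D → fderiv ℝ ψ x = 0 := fun x hx =>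
      fderiv_of_notMem_tsupport (𝕜 := ℝ) fun h => hx (hψD h)
    have hψC : Continuous fun x => ((ψ x : ℝ) : ℂ) :=
      Complex.continuous_ofReal.comp hψ1.continuous
    have hψcC : HasCompactSupport fun x => ((ψ x : ℝ) : ℂ) :=
      hψc.comp_left (g := Complex.ofReal) Complex.ofReal_zero
    -- The test function and its gradient vanish off D, so both integrals extend to the whole space,
    -- where integration by parts has no boundary term.
    rw [setIntegral_eq_integral_of_forall_compl_eq_zero,
      setIntegral_eq_integral_of_forall_compl_eq_zero]
    · have := integral_mul_fderiv_eq_neg_fderiv_mul_of_integrable (μ := volume) (f := w)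
        (g := fun x => ((ψ x : ℝ) : ℂ)) (v := EuclideanSpace.single i (1 : ℝ)) ?_ ?_ ?_ ?_ ?_
      · simp only [hd] at this
        exact this
      · exact ((continuous_partialDeriv hw i).mul hψC).integrable_of_hasCompactSupport
          hψcC.mul_left
      · simp only [hd]
        refine (hw.continuous.mul (Complex.continuous_ofReal.comp
          (continuous_partialDeriv hψ1 i))).integrable_of_hasCompactSupport ?_
        refine HasCompactSupport.mul_left ?_
        refine HasCompactSupport.comp_left (g := Complex.ofReal) ?_ Complex.ofReal_zero
        exact hψc.fderiv_apply ℝ _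
      · exact (hw.continuous.mul hψC).integrable_of_hasCompactSupport hψcC.mul_left
      · exact fun x _ => hw.differentiable one_ne_zero x
      · exact fun x _ => (Complex.ofRealCLM.differentiableAt.comp x
          (hψ1.differentiable one_ne_zero x))
    · intro x hx
      simp [hz x hx]
    · intro x hx
      simp [partialDeriv, hz' x hx]

theorem memLp_and_integrable_mul {u : EuclideanSpace ℝ (Fin d) → ℂ}
    (hu : MemLp u 2 (volume.restrict D)) {ψ : EuclideanSpace ℝ (Fin d) → ℝ}
    (hψ : Continuous ψ) (hψc : HasCompactSupport ψ) :
    MemLp (fun x => ((ψ x : ℝ) : ℂ)) 2 (volume.restrict D) ∧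
      Integrable (fun x => u x * ((ψ x : ℝ) : ℂ)) (volume.restrict D) := by
  have h : MemLp (fun x => ((ψ x : ℝ) : ℂ)) 2 (volume.restrict D) :=
    ((Complex.continuous_ofReal.comp hψ).memLp_of_hasCompactSupport
      (hψc.comp_left (g := Complex.ofReal) Complex.ofReal_zero)).restrict D
  exact ⟨h, hu.integrable_mul h⟩

theorem IsH1.sub {u v : EuclideanSpace ℝ (Fin d) → ℂ}
    {G H : Fin d → EuclideanSpace ℝ (Fin d) → ℂ} (hu : IsH1 D u G) (hv : IsH1 D v H) :
    IsH1 D (fun x => u x - v x) fun i x => G i x - H i x where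
  memLp := hu.memLp.sub hv.memLp
  memLp_grad i := (hu.memLp_grad i).sub (hv.memLp_grad i)
  weak_grad ψ hψ hψc hψD i := by
    have hψ1 : ContDiff ℝ 1 ψ := hψ.of_le (by exact_mod_cast le_top)
    have hc := continuous_partialDeriv hψ1 i
    have hcc : HasCompactSupport (partialDeriv i ψ) := hψc.fderiv_apply ℝ _
    simp only [sub_mul]
    rw [integral_sub (memLp_and_integrable_mul hu.memLp hc hcc).2
      (memLp_and_integrable_mul hv.memLp hc hcc).2,
      integral_sub (memLp_and_integrable_mul (hu.memLp_grad i) hψ1.continuous hψc).2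
      (memLp_and_integrable_mul (hv.memLp_grad i) hψ1.continuous hψc).2,
      hu.weak_grad ψ hψ hψc hψD i, hv.weak_grad ψ hψ hψc hψD i]
    ring

theorem memLp_conj {X : Type*} [MeasurableSpace X] {μ : Measure X} {u : X → ℂ} {p : ENNReal}
    (hu : MemLp u p μ) : MemLp (fun x => conj (u x)) p μ :=
  hu.of_le (Complex.continuous_conj.comp_aestronglyMeasurable hu.1)
    (Eventually.of_forall fun x => by simp)

theorem IsH1.conj {u : EuclideanSpace ℝ (Fin d) → ℂ}
    {G : Fin d → EuclideanSpace ℝ (Fin d) → ℂ} (hu : IsH1 D u G) :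
    IsH1 D (fun x => conj (u x)) fun i x => conj (G i x) where
  memLp := memLp_conj hu.memLp
  memLp_grad i := memLp_conj (hu.memLp_grad i)
  weak_grad ψ hψ hψc hψD i := by
    have h := congrArg conj (hu.weak_grad ψ hψ hψc hψD i)
    rw [map_neg, ← integral_conj, ← integral_conj] at h
    simpa using h

theorem IsH1.of_tendsto {u : ℕ → EuclideanSpace ℝ (Fin d) → ℂ}
    {G : ℕ → Fin d → EuclideanSpace ℝ (Fin d) → ℂ} {v : EuclideanSpace ℝ (Fin d) → ℂ}
    {H : Fin d → EuclideanSpace ℝ (Fin d) → ℂ} (hu : ∀ n, IsH1 D (u n) (G n))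
    (hv : MemLp v 2 (volume.restrict D)) (hH : ∀ i, MemLp (H i) 2 (volume.restrict D))
    (huv : Tendsto (fun n => eLpNorm (fun x => u n x - v x) 2 (volume.restrict D)) atTop (𝓝 0))
    (hGH : ∀ i, Tendsto (fun n => eLpNorm (fun x => G n i x - H i x) 2 (volume.restrict D)) atTop
      (𝓝 0)) : IsH1 D v H where
  memLp := hv
  memLp_grad := hH
  weak_grad ψ hψ hψc hψD i := by
    have hψ1 : ContDiff ℝ 1 ψ := hψ.of_le (by exact_mod_cast le_top)
    have hc := continuous_partialDeriv hψ1 i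
    have hcc : HasCompactSupport (partialDeriv i ψ) := hψc.fderiv_apply ℝ _
    have h1 := tendsto_integral_mul_of_tendsto_eLpNorm (fun n => (hu n).memLp) hv
      (memLp_and_integrable_mul hv hc hcc).1 huv
    have h2 := tendsto_integral_mul_of_tendsto_eLpNorm (fun n => (hu n).memLp_grad i) (hH i)
      (memLp_and_integrable_mul hv hψ1.continuous hψc).1 (hGH i)
    refine tendsto_nhds_unique h1 (h2.neg.congr fun n => ?_)
    exact ((hu n).weak_grad ψ hψ hψc hψD i).symm

theorem tendsto_eLpNorm_sub_sub {X : Type*} [MeasurableSpace X] {μ : Measure X}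
    {F G : ℕ → X → ℂ} {f g : X → ℂ} (hF : ∀ n, AEStronglyMeasurable (fun x => F n x - f x) μ)
    (hG : ∀ n, AEStronglyMeasurable (fun x => G n x - g x) μ)
    (h1 : Tendsto (fun n => eLpNorm (fun x => F n x - f x) 2 μ) atTop (𝓝 0))
    (h2 : Tendsto (fun n => eLpNorm (fun x => G n x - g x) 2 μ) atTop (𝓝 0)) :
    Tendsto (fun n => eLpNorm (fun x => (F n x - G n x) - (f x - g x)) 2 μ) atTop (𝓝 0) := by
  refine tendsto_of_tendsto_of_tendsto_of_le_of_le tendsto_const_nhds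
    (by simpa using h1.add h2) (fun _ => zero_le) fun n => ?_
  have : (fun x => (F n x - G n x) - (f x - g x)) = (fun x => F n x - f x) -
      fun x => G n x - g x := by
    ext x
    simp only [Pi.sub_apply]
    ring
  rw [this]
  exact eLpNorm_sub_le (hF n) (hG n) (by norm_num)

theorem partialDeriv_sub {u v : EuclideanSpace ℝ (Fin d) → ℂ} (hu : ContDiff ℝ 1 u)
    (hv : ContDiff ℝ 1 v) (i : Fin d) (x : EuclideanSpace ℝ (Fin d)) :
    partialDeriv i (fun x => u x - v x) x = partialDeriv i u x - partialDeriv i v x := by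
  simp only [partialDeriv]
  rw [fderiv_fun_sub (hu.differentiable one_ne_zero x) (hv.differentiable one_ne_zero x)]
  rfl

theorem partialDeriv_conj (u : EuclideanSpace ℝ (Fin d) → ℂ) (i : Fin d)
    (x : EuclideanSpace ℝ (Fin d)) :
    partialDeriv i (fun x => conj (u x)) x = conj (partialDeriv i u x) := by
  simp only [partialDeriv]
  have : fderiv ℝ (fun x => conj (u x)) x = _ := Complex.conjCLE.comp_fderiv (f := u) (x := x)
  rw [this]
  rfl

theorem HasTrace.sub {u v : EuclideanSpace ℝ (Fin d) → ℂ}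
    {G H : Fin d → EuclideanSpace ℝ (Fin d) → ℂ} {f g : EuclideanSpace ℝ (Fin d) → ℂ}
    (huG : IsH1 D u G) (hvH : IsH1 D v H) (hu : HasTrace D u G f) (hv : HasTrace D v H g) :
    HasTrace D (fun x => u x - v x) (fun i x => G i x - H i x) fun x => f x - g x := by
  obtain ⟨hf, w, hw, hw1, hw2, hw3⟩ := hu
  obtain ⟨hg, z, hz, hz1, hz2, hz3⟩ := hv
  refine ⟨hf.sub hg, fun k x => w k x - z k x, fun k => (hw k).sub (hz k), ?_, fun i => ?_, ?_⟩
  · exact tendsto_eLpNorm_sub_sub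
      (fun n => (hw n).continuous.aestronglyMeasurable.sub huG.memLp.1)
      (fun n => (hz n).continuous.aestronglyMeasurable.sub hvH.memLp.1) hw1 hz1
  · simp only [partialDeriv_sub (hw _) (hz _)]
    exact tendsto_eLpNorm_sub_sub
      (fun n => (continuous_partialDeriv (hw n) i).aestronglyMeasurable.sub (huG.memLp_grad i).1)
      (fun n => (continuous_partialDeriv (hz n) i).aestronglyMeasurable.sub (hvH.memLp_grad i).1)
      (hw2 i) (hz2 i)
  · exact tendsto_eLpNorm_sub_sub
      (fun n => (hw n).continuous.aestronglyMeasurable.sub hf.1)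
      (fun n => (hz n).continuous.aestronglyMeasurable.sub hg.1) hw3 hz3

theorem eLpNorm_conj_sub {X : Type*} [MeasurableSpace X] {μ : Measure X} (f g : X → ℂ)
    (p : ENNReal) :
    eLpNorm (fun x => conj (f x) - conj (g x)) p μ = eLpNorm (fun x => f x - g x) p μ :=
  eLpNorm_congr_norm_ae (Eventually.of_forall fun x => by rw [← map_sub, RCLike.norm_conj])

theorem HasTrace.conj {u : EuclideanSpace ℝ (Fin d) → ℂ}
    {G : Fin d → EuclideanSpace ℝ (Fin d) → ℂ} {f : EuclideanSpace ℝ (Fin d) → ℂ}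
    (hu : HasTrace D u G f) :
    HasTrace D (fun x => conj (u x)) (fun i x => conj (G i x)) fun x => conj (f x) := by
  obtain ⟨hf, w, hw, hw1, hw2, hw3⟩ := hu
  refine ⟨memLp_conj hf, fun k x => conj (w k x),
    fun k => Complex.conjCLE.contDiff.comp (hw k), ?_, fun i => ?_, ?_⟩
  · simpa only [eLpNorm_conj_sub] using hw1
  · simpa only [partialDeriv_conj, eLpNorm_conj_sub] using hw2 i
  · simpa only [eLpNorm_conj_sub] using hw3

theorem HasTrace.of_contDiff (hDbdd : Bornology.IsBounded D)
    (hσ : surfaceMeasure D Set.univ < ⊤) {w : EuclideanSpace ℝ (Fin d) → ℂ}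
    (hw : ContDiff ℝ 1 w) : HasTrace D w (fun i => partialDeriv i w) w :=
  ⟨memLp_surface_of_continuous hDbdd hσ hw.continuous, fun _ => w, fun _ => hw, by simp,
    fun i => by simp, by simp⟩

end Sobolev


/-! ### A Poincaré inequality -/

theorem sq_lintegral_le {X : Type*} [MeasurableSpace X] {μ : Measure X} {s : Set X}
    {f : X → ENNReal} (hf : AEMeasurable f (μ.restrict s)) :
    (∫⁻ x in s, f x ∂μ) ^ 2 ≤ μ s * ∫⁻ x in s, f x ^ 2 ∂μ := by
  have h := ENNReal.lintegral_mul_le_Lp_mul_Lq (μ.restrict s) Real.HolderConjugate.two_two hf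
    (aemeasurable_const (b := (1 : ENNReal)))
  simp only [Pi.mul_apply, mul_one, ENNReal.rpow_ofNat, one_pow, lintegral_const,
    Measure.restrict_apply_univ, one_mul] at h
  calc (∫⁻ x in s, f x ∂μ) ^ 2
      ≤ ((∫⁻ x in s, f x ^ 2 ∂μ) ^ (1 / 2 : ℝ) * μ s ^ (1 / 2 : ℝ)) ^ 2 := by gcongr
    _ = μ s * ∫⁻ x in s, f x ^ 2 ∂μ := by
      rw [mul_pow, ← ENNReal.rpow_natCast, ← ENNReal.rpow_natCast, ← ENNReal.rpow_mul,
        ← ENNReal.rpow_mul]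
      norm_num
      rw [mul_comm]

theorem ENNReal_add_sq_le (a b : ENNReal) : (a + b) ^ 2 ≤ 2 * a ^ 2 + 2 * b ^ 2 := by
  have h := ENNReal.rpow_add_le_mul_rpow_add_rpow a b (p := 2) (by norm_num)
  norm_num at h
  rwa [mul_add] at h

theorem enorm_sub_le_lintegral_of_hasDerivAt {f f' : ℝ → ℂ} (hf : ∀ s, HasDerivAt f (f' s) s)
    (hf' : Continuous f') {a b : ℝ} (hab : a ≤ b) :
    ‖f b - f a‖ₑ ≤ ∫⁻ s in Set.Ioo a b, ‖f' s‖ₑ := by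
  rw [← intervalIntegral.integral_eq_sub_of_hasDerivAt (fun x _ => hf x)
    (hf'.intervalIntegrable a b), intervalIntegral.integral_of_le hab]
  refine (enorm_integral_le_lintegral_enorm _).trans_eq ?_
  exact setLIntegral_congr Ioo_ae_eq_Ioc.symm

/-- The exit point is the infimum of the complement above t. It lies in the closure of V but not in
V; for a vertical slice of an open set this makes it a boundary point of that set. -/
theorem exists_first_exit {V : Set ℝ} (hV : IsOpen V) {R t : ℝ} (hR : ∀ s ∈ V, |s| ≤ R)
    (ht : t ∈ V) : ∃ b, t ≤ b ∧ b ≤ R ∧ b ∉ V ∧ Set.Ico t b ⊆ V ∧ b ∈ closure V := by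
  let A : Set ℝ := Vᶜ ∩ Set.Ici t
  have hA : IsClosed A := hV.isClosed_compl.inter isClosed_Ici
  have htR : t ≤ R := (le_abs_self t).trans (hR t ht)
  have hmem : ∀ s, R < s → s ∈ A := fun s hs =>
    ⟨fun h => absurd ((le_abs_self s).trans (hR s h)) (not_le.mpr hs), htR.trans hs.le⟩
  have hne : A.Nonempty := ⟨R + 1, hmem _ (by linarith)⟩
  have hbdd : BddBelow A := ⟨t, fun s hs => hs.2⟩
  have hb := hA.csInf_mem hne hbdd
  have hsub : Set.Ico t (sInf A) ⊆ V := by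
    intro s hs
    by_contra h
    exact absurd (csInf_le hbdd ⟨h, hs.1⟩) (not_le.mpr hs.2)
  have hlt : t < sInf A := lt_of_le_of_ne hb.2 fun h => hb.1 (h ▸ ht)
  refine ⟨sInf A, hb.2, ?_, hb.1, hsub, ?_⟩
  · exact le_of_forall_gt_imp_ge_of_dense fun s hs => csInf_le hbdd (hmem s hs)
  · refine closure_mono hsub ?_
    rw [closure_Ico hlt.ne]
    exact ⟨hlt.le, le_rfl⟩

/-- From a point of U one moves up to the first exit: the value there is controlled by `S`, and the
increment is an integral of w' over an interval of length at most 2R, to which Cauchy–Schwarz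
applies. Integration over slices of length at most 2R, then over the base, gives the two terms. -/
theorem lintegral_sq_le_of_slices {X : Type*} [NormedAddCommGroup X] [MeasurableSpace X]
    [BorelSpace X] [SecondCountableTopology X] {μ : Measure X} [SFinite μ] {U : Set (X × ℝ)}
    (hU : IsOpen U) {R : ℝ} (hR : ∀ x ∈ U, |x.2| ≤ R) {w w' : X × ℝ → ℂ} (hw : Continuous w)
    (hw' : Continuous w') (hd : ∀ x s, HasDerivAt (fun s => w (x, s)) (w' (x, s)) s)
    {S : X → ENNReal} (hSm : Measurable S) (hS : ∀ x ∈ frontier U, ‖w x‖ₑ ^ 2 ≤ S x.1) :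
    ∫⁻ x in U, ‖w x‖ₑ ^ 2 ∂(μ.prod volume) ≤ ENNReal.ofReal (2 * R) * (2 * ∫⁻ x, S x ∂μ +
      2 * (ENNReal.ofReal (2 * R) * ∫⁻ x in U, ‖w' x‖ₑ ^ 2 ∂(μ.prod volume))) := by
  have hslice : ∀ x : X, MeasurableSet {t | (x, t) ∈ U} := fun x =>
    (hU.preimage (Continuous.prodMk_right x)).measurableSet
  have hrw : ∀ {F : X × ℝ → ENNReal}, Measurable F →
      ∫⁻ x in U, F x ∂(μ.prod volume) = ∫⁻ x, (∫⁻ t in {t : ℝ | (x, t) ∈ U}, F (x, t)) ∂μ := by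
    intro F hF
    rw [← lintegral_indicator hU.measurableSet,
      lintegral_prod _ (hF.indicator hU.measurableSet).aemeasurable]
    refine lintegral_congr fun x => ?_
    rw [← lintegral_indicator (hslice x)]
    rfl
  have hmw : Measurable fun x => ‖w x‖ₑ ^ 2 := (hw.measurable.enorm).pow_const 2
  have hmw' : Measurable fun x => ‖w' x‖ₑ ^ 2 := (hw'.measurable.enorm).pow_const 2
  have hpt : ∀ x t, (x, t) ∈ U → ‖w (x, t)‖ₑ ^ 2 ≤ 2 * S x +
      2 * (ENNReal.ofReal (2 * R) * ∫⁻ s in {s | (x, s) ∈ U}, ‖w' (x, s)‖ₑ ^ 2) := by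
    intro x t ht
    obtain ⟨b, htb, hbR, hbU, hsub, hcl⟩ := exists_first_exit (V := {s | (x, s) ∈ U})
      (hU.preimage (Continuous.prodMk_right x)) (fun s hs => hR _ hs) ht
    have hfr : (x, b) ∈ frontier U := by
      rw [frontier, hU.interior_eq]
      exact ⟨(Continuous.prodMk_right x).closure_preimage_subset U hcl, hbU⟩
    have h1 := enorm_sub_le_lintegral_of_hasDerivAt (hd x)
      (hw'.comp (Continuous.prodMk_right x)) htb
    have h2 : (∫⁻ s in Set.Ioo t b, ‖w' (x, s)‖ₑ) ^ 2 ≤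
        ENNReal.ofReal (2 * R) * ∫⁻ s in {s | (x, s) ∈ U}, ‖w' (x, s)‖ₑ ^ 2 := by
      refine (sq_lintegral_le (f := fun s => ‖w' (x, s)‖ₑ)
        (hw'.comp (Continuous.prodMk_right x)).enorm.measurable.aemeasurable).trans ?_
      gcongr
      · rw [Real.volume_Ioo]
        refine ENNReal.ofReal_le_ofReal ?_
        have := neg_abs_le t
        have := hR _ ht
        simp only at this
        linarith
      · exact Set.Ioo_subset_Ico_self.trans hsub
    have h3 : ‖w (x, t)‖ₑ ≤ ‖w (x, b)‖ₑ + ∫⁻ s in Set.Ioo t b, ‖w' (x, s)‖ₑ := by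
      have : w (x, t) = w (x, b) - (w (x, b) - w (x, t)) := by ring
      calc ‖w (x, t)‖ₑ = ‖w (x, b) - (w (x, b) - w (x, t))‖ₑ := by rw [← this]
        _ ≤ ‖w (x, b)‖ₑ + ‖w (x, b) - w (x, t)‖ₑ := enorm_sub_le
        _ ≤ _ := by gcongr
    calc ‖w (x, t)‖ₑ ^ 2 ≤ (‖w (x, b)‖ₑ + ∫⁻ s in Set.Ioo t b, ‖w' (x, s)‖ₑ) ^ 2 := by gcongr
      _ ≤ 2 * ‖w (x, b)‖ₑ ^ 2 + 2 * (∫⁻ s in Set.Ioo t b, ‖w' (x, s)‖ₑ) ^ 2 :=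
        ENNReal_add_sq_le _ _
      _ ≤ _ := by
        gcongr
        exact hS _ hfr
  have hvol : ∀ x, volume {t | (x, t) ∈ U} ≤ ENNReal.ofReal (2 * R) := by
    intro x
    refine (measure_mono (t := Set.Icc (-R) R) fun t ht => abs_le.mp (hR _ ht)).trans_eq ?_
    rw [Real.volume_Icc]
    congr 1
    ring
  rw [hrw hmw, hrw hmw']
  calc ∫⁻ x, (∫⁻ t in {t : ℝ | (x, t) ∈ U}, ‖w (x, t)‖ₑ ^ 2) ∂μ
      ≤ ∫⁻ x, ENNReal.ofReal (2 * R) * (2 * S x +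
        2 * (ENNReal.ofReal (2 * R) * ∫⁻ s in {s | (x, s) ∈ U}, ‖w' (x, s)‖ₑ ^ 2)) ∂μ := by
        refine lintegral_mono fun x => ?_
        refine (setLIntegral_mono' (hslice x) fun t ht => hpt x t ht).trans ?_
        rw [setLIntegral_const, mul_comm]
        gcongr
        exact hvol x
    _ = _ := by
        have hm : Measurable fun x => ∫⁻ s in {s | (x, s) ∈ U}, ‖w' (x, s)‖ₑ ^ 2 := by
          have := (hmw'.indicator hU.measurableSet).lintegral_prod_right' (ν := volume)
          convert this using 2 with x
          rw [← lintegral_indicator (hslice x)]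
          rfl
        rw [lintegral_const_mul' _ _ ENNReal.ofReal_ne_top, lintegral_add_left (hSm.const_mul 2),
          lintegral_const_mul' _ _ (by simp), lintegral_const_mul' _ _ (by simp),
          lintegral_const_mul' _ _ ENNReal.ofReal_ne_top]

/-! ### Boundary values along vertical fibres, and the Poincaré inequality for C¹ functions. -/

section Projection

variable {d : ℕ} {D : Set (EuclideanSpace ℝ (Fin d))} {θ : ℝ} {P : EuclideanSpace ℝ (Fin d)}

/-- Given a continuous function on the compact boundary, its supremum over the fibres of the
vertical projection is measurable, and its integral is at most the surface integral. -/
theorem exists_fibre_majorant (hDbdd : Bornology.IsBounded D) (κ : BoundaryChart D θ P)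
    {q : EuclideanSpace ℝ (Fin d) → ℝ} (hq : Continuous q) (hq0 : ∀ y, 0 ≤ q y) :
    ∃ S : EuclideanSpace ℝ (Fin (d - 1)) → ℝ, Measurable S ∧
      (∀ y ∈ frontier D, q y ≤ S (κ.coord y).fst) ∧
      ∫⁻ x, ENNReal.ofReal (S x) ≤ ∫⁻ y, ENNReal.ofReal (q y) ∂(surfaceMeasure D) := by
  have hcomp : IsCompact (frontier D) :=
    hDbdd.isCompact_closure.of_isClosed_subset isClosed_frontier frontier_subset_closure
  have hfst : Continuous fun y => (κ.coord y).fst :=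
    (WithLp.continuous_fst 2 _ _).comp κ.coord.continuous
  let F : EuclideanSpace ℝ (Fin (d - 1)) → Set ℝ := fun x =>
    q '' {y | y ∈ frontier D ∧ (κ.coord y).fst = x}
  let S : EuclideanSpace ℝ (Fin (d - 1)) → ℝ := fun x => sSup (F x)
  obtain ⟨B, hB⟩ := (hcomp.image hq).bddAbove
  have hbdd : ∀ x, BddAbove (F x) := by
    intro x
    refine ⟨B, ?_⟩
    rintro _ ⟨y, hy, rfl⟩
    exact hB ⟨y, hy.1, rfl⟩
  have hS0 : ∀ x, 0 ≤ S x := fun x => Real.sSup_nonneg (by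
    rintro _ ⟨y, -, rfl⟩
    exact hq0 y)
  -- Superlevel sets of `S` are projections of superlevel sets of q on the boundary. Both the
  -- measurability of `S` and the comparison of the integrals rest on this identity.
  have hlt : ∀ s, 0 ≤ s → {x | s < S x} =
      (fun y => (κ.coord y).fst) '' {y | y ∈ frontier D ∧ s < q y} := by
    intro s hs
    ext x
    constructor
    · intro hx
      -- Over a point with empty fibre the supremum takes its default value 0, which cannot exceed s
      -- ≥ 0.
      have hne : (F x).Nonempty := by
        by_contra h
        rw [Set.not_nonempty_iff_eq_empty] at h
        have : S x = 0 := by simp [S, h]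
        have hx' : s < S x := hx
        linarith
      obtain ⟨_, ⟨y, hy, rfl⟩, hsy⟩ := exists_lt_of_lt_csSup hne hx
      exact ⟨y, ⟨hy.1, hsy⟩, hy.2⟩
    · rintro ⟨y, ⟨hy, hsy⟩, rfl⟩
      exact hsy.trans_le (le_csSup (hbdd _) ⟨y, ⟨hy, rfl⟩, rfl⟩)
  have hSm : Measurable S := by
    refine measurable_of_Ioi fun s => ?_
    change MeasurableSet {x | s < S x}
    rcases lt_or_ge s 0 with hs | hs
    · convert MeasurableSet.univ
      ext x
      simp [hs.trans_le (hS0 x)]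
    · rw [hlt s hs]
      -- A countable union of compact sets; the projection maps each one to a compact, hence
      -- measurable, set.
      have : {y | y ∈ frontier D ∧ s < q y} =
          ⋃ n : ℕ, {y | y ∈ frontier D ∧ s + 1 / ((n : ℝ) + 1) ≤ q y} := by
        ext y
        simp only [Set.mem_ofPred_eq, Set.mem_iUnion, exists_and_left, and_congr_right_iff]
        intro _
        constructor
        · intro h
          obtain ⟨n, hn⟩ := exists_nat_one_div_lt (sub_pos.mpr h)
          exact ⟨n, by linarith⟩
        · rintro ⟨n, hn⟩
          have : (0 : ℝ) < 1 / ((n : ℝ) + 1) := by positivity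
          linarith
      rw [this, Set.image_iUnion]
      refine MeasurableSet.iUnion fun n => ?_
      refine (IsCompact.image ?_ hfst).measurableSet
      exact hcomp.inter_right (isClosed_le continuous_const hq)
  refine ⟨S, hSm, fun y hy => le_csSup (hbdd _) ⟨y, ⟨hy, rfl⟩, rfl⟩, ?_⟩
  -- Layer cake on both sides: level by level, the projection does not increase the Hausdorff
  -- measure.
  rw [lintegral_eq_lintegral_meas_lt _ (Eventually.of_forall hS0) hSm.aemeasurable,
    lintegral_eq_lintegral_meas_lt _ (Eventually.of_forall hq0) hq.measurable.aemeasurable]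
  refine setLIntegral_mono' measurableSet_Ioi fun s hs => ?_
  rw [hlt s (le_of_lt hs)]
  refine (κ.volume_image_fst_le _).trans_eq ?_
  rw [surfaceMeasure, Measure.restrict_apply (measurableSet_lt measurable_const hq.measurable)]
  congr 1
  ext y
  exact and_comm

theorem fderiv_apply_eq_sum (w : EuclideanSpace ℝ (Fin d) → ℂ) (y v : EuclideanSpace ℝ (Fin d)) :
    fderiv ℝ w y v = ∑ i, ((v i : ℝ) : ℂ) * partialDeriv i w y := by
  have hv : v = ∑ i, v i • EuclideanSpace.single i (1 : ℝ) := by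
    ext j
    simp [Finset.sum_apply, Pi.single_apply]
  conv_lhs => rw [hv]
  rw [map_sum]
  refine Finset.sum_congr rfl fun i _ => ?_
  rw [map_smul, Complex.real_smul]
  rfl

theorem norm_sum_ofReal_mul_sq_le (v : EuclideanSpace ℝ (Fin d)) (z : Fin d → ℂ) :
    ‖∑ i, ((v i : ℝ) : ℂ) * z i‖ ^ 2 ≤ ‖v‖ ^ 2 * ∑ i, ‖z i‖ ^ 2 := by
  have h1 : ‖∑ i, ((v i : ℝ) : ℂ) * z i‖ ≤ ∑ i, |v i| * ‖z i‖ := by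
    refine (norm_sum_le _ _).trans (Finset.sum_le_sum fun i _ => ?_)
    rw [norm_mul, Complex.norm_real, Real.norm_eq_abs]
  have h2 := Finset.sum_mul_sq_le_sq_mul_sq Finset.univ (fun i => |v i|) fun i => ‖z i‖
  have h3 : ‖v‖ ^ 2 = ∑ i, |v i| ^ 2 := by
    rw [EuclideanSpace.norm_sq_eq]
    simp
  rw [h3]
  exact (pow_le_pow_left₀ (norm_nonneg _) h1 2).trans h2

theorem enorm_fderiv_apply_sq_le (w : EuclideanSpace ℝ (Fin d) → ℂ)
    (y v : EuclideanSpace ℝ (Fin d)) (hv : ‖v‖ ≤ 1) :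
    ‖fderiv ℝ w y v‖ₑ ^ 2 ≤ ∑ i, ‖partialDeriv i w y‖ₑ ^ 2 := by
  have h := norm_sum_ofReal_mul_sq_le v fun i => partialDeriv i w y
  rw [← fderiv_apply_eq_sum] at h
  have h' : ‖fderiv ℝ w y v‖ ^ 2 ≤ ∑ i, ‖partialDeriv i w y‖ ^ 2 := by
    refine h.trans ?_
    have h0 : 0 ≤ ∑ i, ‖partialDeriv i w y‖ ^ 2 := by positivity
    have : ‖v‖ ^ 2 ≤ 1 := pow_le_one₀ (norm_nonneg _) hv
    nlinarith
  have h'' := ENNReal.ofReal_le_ofReal h'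
  rw [ENNReal.ofReal_sum_of_nonneg fun _ _ => by positivity] at h''
  simpa only [ENNReal.ofReal_pow (norm_nonneg _), ofReal_norm] using h''

/-- Only the rigid motion of the chart is used, to single out a vertical direction in which D is
sliced; the boundary function plays no role. The boundary values over a fibre are dominated by
`exists_fibre_majorant`. -/
theorem exists_poincare (hDbdd : Bornology.IsBounded D) (hDopen : IsOpen D)
    (κ : BoundaryChart D θ P) :
    ∃ C : NNReal, ∀ w : EuclideanSpace ℝ (Fin d) → ℂ, ContDiff ℝ 1 w →
      ∫⁻ y in D, ‖w y‖ₑ ^ 2 ≤ C * ((∫⁻ y in D, ∑ i, ‖partialDeriv i w y‖ₑ ^ 2) +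
        ∫⁻ y, ‖w y‖ₑ ^ 2 ∂(surfaceMeasure D)) := by
  let T : EuclideanSpace ℝ (Fin d) ≃ₜ EuclideanSpace ℝ (Fin (d - 1)) × ℝ :=
    κ.coord.toHomeomorph.trans (WithLp.homeomorphProd 2 _ _)
  have hT : MeasurePreserving T volume volume :=
    (WithLp.volume_preserving_ofLp (EuclideanSpace ℝ (Fin (d - 1))) ℝ).comp
      κ.measurePreserving_coord
  let U : Set (EuclideanSpace ℝ (Fin (d - 1)) × ℝ) := T.symm ⁻¹' D
  have hU : IsOpen U := hDopen.preimage T.symm.continuous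
  have hTU : T ⁻¹' U = D := by
    ext y
    simp [U]
  have hfrU : frontier U = T.symm ⁻¹' frontier D := (T.symm.preimage_frontier D).symm
  obtain ⟨R, hR⟩ : ∃ R : ℝ, ∀ x ∈ U, |x.2| ≤ R := by
    have : Bornology.IsBounded (κ.coord '' D) := κ.coord.lipschitz.isBounded_image hDbdd
    obtain ⟨R, hR⟩ := this.exists_norm_le
    refine ⟨R, fun x hx => ?_⟩
    have h1 := hR (κ.coord (T.symm x)) ⟨_, hx, rfl⟩
    have h2 := Coord.abs_snd_le (κ.coord (T.symm x))
    have h3 : (κ.coord (T.symm x)).snd = x.2 := congrArg Prod.snd (T.apply_symm_apply x)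
    rw [h3] at h2
    exact h2.trans h1
  let e : EuclideanSpace ℝ (Fin d) :=
    κ.coord.linearIsometryEquiv.symm (WithLp.toLp 2 (0, 1))
  have he : ‖e‖ ≤ 1 := by
    rw [LinearIsometryEquiv.norm_map]
    refine (Coord.norm_le_add _).trans ?_
    simp
  have hline : ∀ x s, HasDerivAt (fun s => T.symm (x, s)) e s := by
    intro x s
    have h1 : (fun s => T.symm (x, s)) = fun s => s • e + T.symm (x, 0) := by
      funext s
      have h2 := κ.coord.symm.map_vadd (WithLp.toLp 2 (x, (0 : ℝ)))
        (s • (WithLp.toLp 2 ((0 : EuclideanSpace ℝ (Fin (d - 1))), (1 : ℝ)) : Coord d))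
      have h3 : (s • (WithLp.toLp 2 ((0 : EuclideanSpace ℝ (Fin (d - 1))), (1 : ℝ)) : Coord d))
          +ᵥ (WithLp.toLp 2 (x, (0 : ℝ)) : Coord d) = WithLp.toLp 2 (x, s) := by
        rw [← WithLp.toLp_smul]
        change WithLp.toLp 2 (s • ((0 : EuclideanSpace ℝ (Fin (d - 1))), (1 : ℝ)) + (x, (0 : ℝ)))
          = _
        simp
      rw [h3] at h2
      change κ.coord.symm (WithLp.toLp 2 (x, s)) = _
      rw [h2, map_smul]
      rfl
    rw [h1]
    simpa using ((hasDerivAt_id s).smul_const e).add_const (T.symm (x, 0))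
  refine ⟨(Real.toNNReal (2 * R) * (2 + 2 * Real.toNNReal (2 * R))), fun w hw => ?_⟩
  obtain ⟨S, hSm, hS, hSint⟩ := exists_fibre_majorant hDbdd κ (q := fun y => ‖w y‖ ^ 2)
    (by have := hw.continuous; fun_prop) (fun y => by positivity)
  have hq : ∀ y, ENNReal.ofReal (‖w y‖ ^ 2) = ‖w y‖ₑ ^ 2 := fun y => by
    rw [ENNReal.ofReal_pow (norm_nonneg _), ofReal_norm]
  simp only [hq] at hSint
  have key := lintegral_sq_le_of_slices (μ := volume) hU hR (w := fun x => w (T.symm x))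
    (w' := fun x => fderiv ℝ w (T.symm x) e) (hw.continuous.comp T.symm.continuous)
    (((hw.continuous_fderiv one_ne_zero).comp T.symm.continuous).clm_apply continuous_const)
    (fun x s => (hw.differentiable one_ne_zero _).hasFDerivAt.comp_hasDerivAt s (hline x s))
    (S := fun x => ENNReal.ofReal (S x)) hSm.ennreal_ofReal (by
      intro x hx
      rw [hfrU] at hx
      have := hS _ hx
      have h3 : (κ.coord (T.symm x)).fst = x.1 := congrArg Prod.fst (T.apply_symm_apply x)
      rw [h3] at this
      rw [← hq]
      exact ENNReal.ofReal_le_ofReal this)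
  have htr : ∀ F : EuclideanSpace ℝ (Fin d) → ENNReal,
      ∫⁻ x in U, F (T.symm x) ∂((volume : Measure (EuclideanSpace ℝ (Fin (d - 1)))).prod volume)
        = ∫⁻ y in D, F y := by
    intro F
    have := hT.setLIntegral_comp_preimage_emb T.measurableEmbedding
      (fun x => F (T.symm x)) U
    rw [hTU] at this
    simp only [Homeomorph.symm_apply_apply] at this
    exact this.symm
  rw [htr fun y => ‖w y‖ₑ ^ 2, htr fun y => ‖fderiv ℝ w y e‖ₑ ^ 2] at key
  refine key.trans ?_
  have h1 : ∫⁻ y in D, ‖fderiv ℝ w y e‖ₑ ^ 2 ≤ ∫⁻ y in D, ∑ i, ‖partialDeriv i w y‖ₑ ^ 2 :=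
    lintegral_mono fun y => enorm_fderiv_apply_sq_le w y e he
  set I1 := ∫⁻ y in D, ∑ i, ‖partialDeriv i w y‖ₑ ^ 2
  set I2 := ∫⁻ y, ‖w y‖ₑ ^ 2 ∂(surfaceMeasure D)
  change ENNReal.ofReal (2 * R) * (2 * (∫⁻ x, ENNReal.ofReal (S x)) +
    2 * (ENNReal.ofReal (2 * R) * _)) ≤ _
  calc _ ≤ ENNReal.ofReal (2 * R) * (2 * I2 + 2 * (ENNReal.ofReal (2 * R) * I1)) := by gcongr
    _ ≤ ENNReal.ofReal (2 * R) * (2 * (I1 + I2) + 2 * (ENNReal.ofReal (2 * R) * (I1 + I2))) := by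
      gcongr
      · exact le_add_self
      · exact le_self_add
    _ = _ := by
      push_cast
      change _ = ENNReal.ofReal (2 * R) * (2 + 2 * ENNReal.ofReal (2 * R)) * (I1 + I2)
      ring

end Projection


/-! ### The Dirichlet problem -/

section Dirichlet

variable {d : ℕ} {D : Set (EuclideanSpace ℝ (Fin d))} {θ γ₀ K : ℝ}
  {γ : EuclideanSpace ℝ (Fin d) → ℝ}

theorem IsLipschitzConductivity.continuousOn (hγ : IsLipschitzConductivity D γ₀ K γ) :
    ContinuousOn γ D := by
  have h : LipschitzOnWith (Real.toNNReal K) γ D := by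
    refine LipschitzOnWith.of_dist_le_mul fun x hx y hy => ?_
    rw [Real.dist_eq]
    refine (hγ.lipschitz x (subset_closure hx) y (subset_closure hy)).trans ?_
    gcongr
    exact Real.le_coe_toNNReal K
  exact h.continuousOn

theorem IsLipschitzConductivity.ae_bounds (hDopen : IsOpen D)
    (hγ : IsLipschitzConductivity D γ₀ K γ) :
    ∀ᵐ x ∂(volume.restrict D), γ₀ ≤ γ x ∧ γ x ≤ K :=
  (ae_restrict_iff' hDopen.measurableSet).mpr (Eventually.of_forall fun x hx =>
    ⟨hγ.lower x (subset_closure hx), (le_abs_self _).trans (hγ.upper x (subset_closure hx))⟩)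

/-- The vector field `√γ G`. -/
def weighted (γ : EuclideanSpace ℝ (Fin d) → ℝ) (G : Fin d → EuclideanSpace ℝ (Fin d) → ℂ)
    (x : EuclideanSpace ℝ (Fin d)) : EuclideanSpace ℂ (Fin d) :=
  WithLp.toLp 2 fun i => ((√(γ x) : ℝ) : ℂ) * G i x

theorem memLp_weighted (hDopen : IsOpen D) (hγ : IsLipschitzConductivity D γ₀ K γ)
    {G : Fin d → EuclideanSpace ℝ (Fin d) → ℂ} (hG : ∀ i, MemLp (G i) 2 (volume.restrict D)) :
    MemLp (weighted γ G) 2 (volume.restrict D) := by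
  rw [memLp_piLp_iff]
  intro i
  refine (hG i).of_le_mul (c := √K) ?_ ?_
  · refine AEStronglyMeasurable.mul ?_ (hG i).1
    refine Complex.continuous_ofReal.comp_aestronglyMeasurable ?_
    exact (Real.continuous_sqrt.comp_continuousOn hγ.continuousOn).aestronglyMeasurable
      hDopen.measurableSet
  · filter_upwards [hγ.ae_bounds hDopen] with x hx
    simp only [weighted]
    rw [norm_mul, Complex.norm_real, Real.norm_eq_abs, abs_of_nonneg (Real.sqrt_nonneg _)]
    gcongr
    exact hx.2

/-- With the weight √γ the energy form, conjugated in its second slot, becomes the inner product of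
L²(D)^d, and the Dirichlet problem becomes an orthogonal projection. -/
theorem inner_weighted (h0 : 0 < γ₀) (hDopen : IsOpen D) (hγ : IsLipschitzConductivity D γ₀ K γ)
    {G H : Fin d → EuclideanSpace ℝ (Fin d) → ℂ} (hG : ∀ i, MemLp (G i) 2 (volume.restrict D))
    (hH : ∀ i, MemLp (H i) 2 (volume.restrict D)) :
    inner ℂ ((memLp_weighted hDopen hγ hH).toLp _) ((memLp_weighted hDopen hγ hG).toLp _) =
      energyForm D γ G fun i x => conj (H i x) := by
  rw [L2.inner_def, energyForm]
  refine integral_congr_ae ?_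
  filter_upwards [(memLp_weighted hDopen hγ hH).coeFn_toLp,
    (memLp_weighted hDopen hγ hG).coeFn_toLp, hγ.ae_bounds hDopen] with x h1 h2 h3
  rw [h1, h2, PiLp.inner_apply, Finset.mul_sum]
  refine Finset.sum_congr rfl fun i _ => ?_
  simp only [RCLike.inner_apply, weighted, map_mul, Complex.conj_ofReal]
  have : ((√(γ x) : ℝ) : ℂ) * ((√(γ x) : ℝ) : ℂ) = ((γ x : ℝ) : ℂ) := by
    rw [← Complex.ofReal_mul, Real.mul_self_sqrt (h0.le.trans h3.1)]
  rw [← this]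
  ring

theorem toLp_weighted_sub (hDopen : IsOpen D) (hγ : IsLipschitzConductivity D γ₀ K γ)
    {G H : Fin d → EuclideanSpace ℝ (Fin d) → ℂ} (hG : ∀ i, MemLp (G i) 2 (volume.restrict D))
    (hH : ∀ i, MemLp (H i) 2 (volume.restrict D)) :
    (memLp_weighted (G := fun i x => G i x - H i x) hDopen hγ fun i => (hG i).sub (hH i)).toLp _ =
      (memLp_weighted hDopen hγ hG).toLp _ - (memLp_weighted hDopen hγ hH).toLp _ := by
  rw [← MemLp.toLp_sub]
  congr 1
  ext x i
  simp only [weighted, Pi.sub_apply, PiLp.sub_apply]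
  ring

theorem IsH1.const_smul {u : EuclideanSpace ℝ (Fin d) → ℂ}
    {G : Fin d → EuclideanSpace ℝ (Fin d) → ℂ} (hu : IsH1 D u G) (c : ℂ) :
    IsH1 D (fun x => c * u x) fun i x => c * G i x where
  memLp := hu.memLp.const_mul c
  memLp_grad i := (hu.memLp_grad i).const_mul c
  weak_grad ψ hψ hψc hψD i := by
    simp only [mul_assoc]
    rw [integral_const_mul, integral_const_mul, hu.weak_grad ψ hψ hψc hψD i]
    ring

theorem eLpNorm_const_mul_sub {X : Type*} [MeasurableSpace X] {μ : Measure X} (c : ℂ)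
    (f g : X → ℂ) (p : ENNReal) :
    eLpNorm (fun x => c * f x - c * g x) p μ = ‖c‖ₑ * eLpNorm (fun x => f x - g x) p μ := by
  simp only [← mul_sub]
  exact eLpNorm_const_smul c (fun x => f x - g x) p μ

theorem partialDeriv_const_mul {w : EuclideanSpace ℝ (Fin d) → ℂ} (hw : ContDiff ℝ 1 w) (c : ℂ)
    (i : Fin d) (x : EuclideanSpace ℝ (Fin d)) :
    partialDeriv i (fun x => c * w x) x = c * partialDeriv i w x := by
  simp only [partialDeriv]
  rw [fderiv_const_mul (hw.differentiable one_ne_zero x)]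
  rfl

theorem HasTrace.const_smul {u : EuclideanSpace ℝ (Fin d) → ℂ}
    {G : Fin d → EuclideanSpace ℝ (Fin d) → ℂ} {f : EuclideanSpace ℝ (Fin d) → ℂ}
    (hu : HasTrace D u G f) (c : ℂ) :
    HasTrace D (fun x => c * u x) (fun i x => c * G i x) fun x => c * f x := by
  obtain ⟨hf, w, hw, hw1, hw2, hw3⟩ := hu
  have h : ∀ {a : ℕ → ENNReal}, Tendsto a atTop (𝓝 0) →
      Tendsto (fun n => ‖c‖ₑ * a n) atTop (𝓝 0) := fun ha => by
    simpa using ENNReal.Tendsto.const_mul ha (Or.inr enorm_ne_top)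
  refine ⟨hf.const_mul c, fun k x => c * w k x, fun k => contDiff_const.mul (hw k), ?_,
    fun i => ?_, ?_⟩
  · simpa only [eLpNorm_const_mul_sub] using h hw1
  · simpa only [partialDeriv_const_mul (hw _), eLpNorm_const_mul_sub] using h (hw2 i)
  · simpa only [eLpNorm_const_mul_sub] using h hw3

/-- `H` is the weak gradient of a function in `H¹(D)` with zero trace. -/
def IsZeroTraceGradient (D : Set (EuclideanSpace ℝ (Fin d)))
    (H : Fin d → EuclideanSpace ℝ (Fin d) → ℂ) : Prop :=
  ∃ v, IsH1 D v H ∧ HasTrace D v H 0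

theorem IsZeroTraceGradient.memLp {H : Fin d → EuclideanSpace ℝ (Fin d) → ℂ}
    (hH : IsZeroTraceGradient D H) (i : Fin d) : MemLp (H i) 2 (volume.restrict D) :=
  hH.choose_spec.1.memLp_grad i

theorem IsZeroTraceGradient.sub {G H : Fin d → EuclideanSpace ℝ (Fin d) → ℂ}
    (hG : IsZeroTraceGradient D G) (hH : IsZeroTraceGradient D H) :
    IsZeroTraceGradient D fun i x => G i x - H i x := by
  obtain ⟨u, hu, hu0⟩ := hG
  obtain ⟨v, hv, hv0⟩ := hH
  refine ⟨_, hu.sub hv, ?_⟩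
  have := hu0.sub hu hv hv0
  simp only [Pi.zero_apply, sub_zero] at this
  exact this

theorem IsZeroTraceGradient.const_smul {H : Fin d → EuclideanSpace ℝ (Fin d) → ℂ}
    (hH : IsZeroTraceGradient D H) (c : ℂ) : IsZeroTraceGradient D fun i x => c * H i x := by
  obtain ⟨v, hv, hv0⟩ := hH
  refine ⟨_, hv.const_smul c, ?_⟩
  have := hv0.const_smul c
  simp only [Pi.zero_apply, mul_zero] at this
  exact this

theorem IsZeroTraceGradient.conj {H : Fin d → EuclideanSpace ℝ (Fin d) → ℂ}
    (hH : IsZeroTraceGradient D H) : IsZeroTraceGradient D fun i x => conj (H i x) := by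
  obtain ⟨v, hv, hv0⟩ := hH
  refine ⟨_, hv.conj, ?_⟩
  have := hv0.conj
  simp only [Pi.zero_apply, map_zero] at this
  exact this

theorem isZeroTraceGradient_zero (hDbdd : Bornology.IsBounded D) (hDopen : IsOpen D)
    (hσ : surfaceMeasure D Set.univ < ⊤) :
    IsZeroTraceGradient D (0 : Fin d → EuclideanSpace ℝ (Fin d) → ℂ) := by
  have h : ContDiff ℝ 1 (0 : EuclideanSpace ℝ (Fin d) → ℂ) := contDiff_const
  have h1 : (fun i => partialDeriv i (0 : EuclideanSpace ℝ (Fin d) → ℂ)) = 0 := by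
    funext i x
    simp [partialDeriv]
  have h2 := IsH1.of_contDiff hDbdd hDopen h
  have h3 := HasTrace.of_contDiff hDbdd hσ h
  rw [h1] at h2 h3
  exact ⟨0, h2, h3⟩

/-- The weighted gradients of the functions in `H¹(D)` with zero trace, as a subspace of
`L²(D)ᵈ`. -/
def zeroTraceSpace (hDbdd : Bornology.IsBounded D) (hDopen : IsOpen D)
    (hσ : surfaceMeasure D Set.univ < ⊤) (hγ : IsLipschitzConductivity D γ₀ K γ) :
    Submodule ℂ (Lp (EuclideanSpace ℂ (Fin d)) 2 (volume.restrict D)) where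
  carrier := {h | ∃ (H : Fin d → EuclideanSpace ℝ (Fin d) → ℂ) (hH : IsZeroTraceGradient D H),
    h = (memLp_weighted hDopen hγ hH.memLp).toLp _}
  zero_mem' := by
    refine ⟨0, isZeroTraceGradient_zero hDbdd hDopen hσ, ?_⟩
    rw [eq_comm, Lp.eq_zero_iff_ae_eq_zero]
    refine (MemLp.coeFn_toLp _).trans (Eventually.of_forall fun x => ?_)
    ext i
    simp [weighted]
  add_mem' := by
    rintro _ _ ⟨G, hG, rfl⟩ ⟨H, hH, rfl⟩
    -- The sum is written as G - (-1)H, from closure under differences and scalars.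
    refine ⟨_, hG.sub (hH.const_smul (-1)), ?_⟩
    rw [← MemLp.toLp_add]
    congr 1
    ext x i
    simp only [weighted, Pi.add_apply, PiLp.add_apply]
    ring
  smul_mem' := by
    rintro c _ ⟨H, hH, rfl⟩
    refine ⟨_, hH.const_smul c, ?_⟩
    rw [← MemLp.toLp_const_smul]
    congr 1
    ext x i
    simp only [weighted, Pi.smul_apply, PiLp.smul_apply, smul_eq_mul]
    ring

theorem eLpNorm_two_sq {X F : Type*} [MeasurableSpace X] [NormedAddCommGroup F] {μ : Measure X}
    (f : X → F) : eLpNorm f 2 μ ^ 2 = ∫⁻ x, ‖f x‖ₑ ^ 2 ∂μ := by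
  have := eLpNorm_nnreal_pow_eq_lintegral (f := f) (μ := μ) (p := 2) two_ne_zero
  simpa using this

theorem eLpNorm_component_sub_le (h0 : 0 < γ₀) (hDopen : IsOpen D)
    (hγ : IsLipschitzConductivity D γ₀ K γ) (G H : Fin d → EuclideanSpace ℝ (Fin d) → ℂ)
    (i : Fin d) :
    eLpNorm (fun x => G i x - H i x) 2 (volume.restrict D) ≤
      ENNReal.ofReal (√γ₀)⁻¹ *
        eLpNorm (fun x => weighted γ G x - weighted γ H x) 2 (volume.restrict D) := by
  refine eLpNorm_le_mul_eLpNorm_of_ae_le_mul ?_ 2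
  filter_upwards [hγ.ae_bounds hDopen] with x hx
  have h1 : ‖(weighted γ G x - weighted γ H x) i‖ ≤ ‖weighted γ G x - weighted γ H x‖ :=
    PiLp.norm_apply_le _ i
  have h2 : (weighted γ G x - weighted γ H x) i = ((√(γ x) : ℝ) : ℂ) * (G i x - H i x) := by
    simp only [weighted, PiLp.sub_apply]
    ring
  rw [h2, norm_mul, Complex.norm_real, Real.norm_eq_abs, abs_of_nonneg (Real.sqrt_nonneg _)] at h1
  have h3 : 0 < √γ₀ := Real.sqrt_pos.mpr h0
  rw [inv_mul_eq_div, le_div_iff₀ h3, mul_comm]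
  refine le_trans ?_ h1
  gcongr
  exact hx.1

/-- The Poincaré inequality is applied to differences of the sequence, whose gradients are Cauchy
and whose boundary values tend to zero. -/
theorem cauchySeq_toLp_of_poincare {C : NNReal}
    (hC : ∀ w : EuclideanSpace ℝ (Fin d) → ℂ, ContDiff ℝ 1 w →
      ∫⁻ y in D, ‖w y‖ₑ ^ 2 ≤ C * ((∫⁻ y in D, ∑ i, ‖partialDeriv i w y‖ₑ ^ 2) +
        ∫⁻ y, ‖w y‖ₑ ^ 2 ∂(surfaceMeasure D)))
    {w : ℕ → EuclideanSpace ℝ (Fin d) → ℂ} (hw : ∀ n, ContDiff ℝ 1 (w n))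
    (hwm : ∀ n, MemLp (w n) 2 (volume.restrict D)) {H : Fin d → EuclideanSpace ℝ (Fin d) → ℂ}
    (hHm : ∀ i, AEStronglyMeasurable (H i) (volume.restrict D))
    (hH : ∀ i, Tendsto (fun n => eLpNorm (fun x => partialDeriv i (w n) x - H i x) 2
      (volume.restrict D)) atTop (𝓝 0))
    (hσ : Tendsto (fun n => eLpNorm (w n) 2 (surfaceMeasure D)) atTop (𝓝 0)) :
    CauchySeq fun n => (hwm n).toLp (w n) := by
  rw [cauchySeq_iff_tendsto, tendsto_uniformity_iff_dist_tendsto_zero]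
  have hfst : Tendsto (fun p : ℕ × ℕ => p.1) atTop atTop := by
    rw [← prod_atTop_atTop_eq]
    exact tendsto_fst
  have hsnd : Tendsto (fun p : ℕ × ℕ => p.2) atTop atTop := by
    rw [← prod_atTop_atTop_eq]
    exact tendsto_snd
  let e : Fin d → ℕ → ENNReal := fun i n =>
    eLpNorm (fun x => partialDeriv i (w n) x - H i x) 2 (volume.restrict D)
  let s : ℕ → ENNReal := fun n => eLpNorm (w n) 2 (surfaceMeasure D)
  let B : ℕ × ℕ → ENNReal := fun p =>
    (C : ENNReal) * (∑ i, (e i p.1 + e i p.2) ^ 2 + (s p.1 + s p.2) ^ 2)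
  have hB : Tendsto B atTop (𝓝 0) := by
    have h1 : Tendsto (fun p : ℕ × ℕ => ∑ i, (e i p.1 + e i p.2) ^ 2 + (s p.1 + s p.2) ^ 2)
        atTop (𝓝 (∑ _i : Fin d, (0 + 0) ^ 2 + (0 + 0) ^ 2)) := by
      refine Tendsto.add (tendsto_finsetSum _ fun i _ => ?_) ?_
      · exact (ENNReal.continuous_pow 2).tendsto _ |>.comp
          (((hH i).comp hfst).add ((hH i).comp hsnd))
      · exact (ENNReal.continuous_pow 2).tendsto _ |>.comp ((hσ.comp hfst).add (hσ.comp hsnd))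
    have h2 := ENNReal.Tendsto.const_mul (a := (C : ENNReal)) h1 (Or.inr ENNReal.coe_ne_top)
    simpa using h2
  have hle : ∀ p : ℕ × ℕ, eLpNorm (fun x => w p.1 x - w p.2 x) 2 (volume.restrict D) ^ 2 ≤ B p := by
    intro p
    have h1 := hC _ ((hw p.1).sub (hw p.2))
    rw [eLpNorm_two_sq]
    refine h1.trans ?_
    refine mul_le_mul_right (add_le_add ?_ ?_) _
    · rw [lintegral_finsetSum' _ fun i _ => ?_]
      · refine Finset.sum_le_sum fun i _ => ?_
        rw [← eLpNorm_two_sq]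
        refine pow_le_pow_left₀ zero_le ?_ 2
        have : (fun x => partialDeriv i (fun x => w p.1 x - w p.2 x) x) =
            (fun x => partialDeriv i (w p.1) x - H i x) -
              fun x => partialDeriv i (w p.2) x - H i x := by
          funext x
          rw [partialDeriv_sub (hw _) (hw _), Pi.sub_apply]
          ring
        refine (congrArg (fun f => eLpNorm f 2 (volume.restrict D)) this).trans_le ?_
        exact eLpNorm_sub_le
          ((continuous_partialDeriv (hw _) i).aestronglyMeasurable.sub (hHm i))
          ((continuous_partialDeriv (hw _) i).aestronglyMeasurable.sub (hHm i)) (by norm_num)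
      · exact ((continuous_partialDeriv ((hw p.1).sub (hw p.2)) i).enorm.measurable.pow_const
          2).aemeasurable
    · rw [← eLpNorm_two_sq]
      refine pow_le_pow_left₀ zero_le ?_ 2
      exact eLpNorm_sub_le (hw _).continuous.aestronglyMeasurable
        (hw _).continuous.aestronglyMeasurable (by norm_num)
  have hsq : Tendsto (fun p : ℕ × ℕ =>
      eLpNorm (fun x => w p.1 x - w p.2 x) 2 (volume.restrict D)) atTop (𝓝 0) := by
    have h1 := tendsto_of_tendsto_of_tendsto_of_le_of_le tendsto_const_nhds hB
      (fun _ => zero_le) hle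
    have h2 := (ENNReal.continuous_rpow_const (y := 1 / 2)).tendsto 0 |>.comp h1
    simp only [one_div, ENNReal.zero_rpow_of_pos (by norm_num : (0 : ℝ) < 2⁻¹)] at h2
    refine h2.congr fun p => ?_
    rw [Function.comp_apply, ← ENNReal.rpow_natCast, ← ENNReal.rpow_mul]
    norm_num
  have h3 := (ENNReal.tendsto_toReal ENNReal.zero_ne_top).comp hsq
  rw [ENNReal.toReal_zero] at h3
  refine h3.congr fun p => ?_
  simp only [Prod.map, Function.comp_apply]
  rw [Lp.dist_def]
  congr 1
  refine eLpNorm_congr_ae ?_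
  filter_upwards [(hwm p.1).coeFn_toLp, (hwm p.2).coeFn_toLp] with x h1 h2
  rw [Pi.sub_apply, h1, h2]

/-- A limit of weighted zero-trace gradients is √γ H₀ for some field H₀. A diagonal choice of C¹
approximants has gradients tending to H₀ and boundary values tending to zero; the Poincaré
inequality then makes the functions themselves converge, and H₀ is the weak gradient of their limit.
-/
theorem isClosed_zeroTraceSpace (h0 : 0 < γ₀) (hDbdd : Bornology.IsBounded D) (hDopen : IsOpen D)
    (hσ : surfaceMeasure D Set.univ < ⊤) (hγ : IsLipschitzConductivity D γ₀ K γ) {C : NNReal}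
    (hC : ∀ w : EuclideanSpace ℝ (Fin d) → ℂ, ContDiff ℝ 1 w →
      ∫⁻ y in D, ‖w y‖ₑ ^ 2 ≤ C * ((∫⁻ y in D, ∑ i, ‖partialDeriv i w y‖ₑ ^ 2) +
        ∫⁻ y, ‖w y‖ₑ ^ 2 ∂(surfaceMeasure D))) :
    IsClosed (zeroTraceSpace hDbdd hDopen hσ hγ :
      Set (Lp (EuclideanSpace ℂ (Fin d)) 2 (volume.restrict D))) := by
  rw [← isSeqClosed_iff_isClosed]
  intro q p hq hqp
  choose H hH hHq using hq
  have hex := hH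
  choose v hv hv0 using hex
  choose hf w hw hw1 hw2 hw3 using hv0
  let H₀ : Fin d → EuclideanSpace ℝ (Fin d) → ℂ := fun i x => ((√(γ x) : ℝ) : ℂ)⁻¹ * p x i
  have hpw : (p : EuclideanSpace ℝ (Fin d) → EuclideanSpace ℂ (Fin d))
      =ᵐ[volume.restrict D] weighted γ H₀ := by
    filter_upwards [hγ.ae_bounds hDopen] with x hx
    ext i
    have : ((√(γ x) : ℝ) : ℂ) ≠ 0 := by
      rw [Complex.ofReal_ne_zero]
      exact (Real.sqrt_pos.mpr (h0.trans_le hx.1)).ne'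
    simp [weighted, H₀, this]
  have hHH₀ : ∀ i, Tendsto (fun n => eLpNorm (fun x => H n i x - H₀ i x) 2 (volume.restrict D))
      atTop (𝓝 0) := by
    intro i
    have h1 := (Lp.tendsto_Lp_iff_tendsto_eLpNorm' _ _).mp hqp
    have h2 := ENNReal.Tendsto.const_mul (a := ENNReal.ofReal (√γ₀)⁻¹) h1
      (Or.inr ENNReal.ofReal_ne_top)
    rw [mul_zero] at h2
    refine tendsto_of_tendsto_of_tendsto_of_le_of_le tendsto_const_nhds h2 (fun _ => zero_le)
      fun n => ?_
    refine (eLpNorm_component_sub_le h0 hDopen hγ (H n) H₀ i).trans_eq ?_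
    congr 1
    refine eLpNorm_congr_ae ?_
    filter_upwards [hpw, (memLp_weighted hDopen hγ (hv n).memLp_grad).coeFn_toLp] with x h3 h4
    rw [Pi.sub_apply, hHq n, h3, h4]
  have hH₀m : ∀ i, AEStronglyMeasurable (H₀ i) (volume.restrict D) := by
    intro i
    refine AEStronglyMeasurable.mul ?_ ?_
    · have : AEStronglyMeasurable (fun x => (√(γ x))⁻¹) (volume.restrict D) :=
        (ContinuousOn.inv₀ (Real.continuous_sqrt.comp_continuousOn hγ.continuousOn) fun x hx =>
          (Real.sqrt_pos.mpr (h0.trans_le (hγ.lower x (subset_closure hx)))).ne').aestronglyMeasurable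
          hDopen.measurableSet
      simpa only [Complex.ofReal_inv] using Complex.continuous_ofReal.comp_aestronglyMeasurable this
    · exact (PiLp.continuous_apply 2 _ i).comp_aestronglyMeasurable (Lp.aestronglyMeasurable p)
  have hH₀ : ∀ i, MemLp (H₀ i) 2 (volume.restrict D) := by
    intro i
    -- Square integrability of H₀ is read off from a single member of the sequence at finite
    -- distance.
    obtain ⟨n, hn⟩ := ((hHH₀ i).eventually (gt_mem_nhds one_pos)).exists
    have h1 : MemLp (fun x => H n i x - H₀ i x) 2 (volume.restrict D) :=
      ⟨((hv n).memLp_grad i).1.sub (hH₀m i), hn.trans ENNReal.one_lt_top⟩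
    have h2 := ((hv n).memLp_grad i).sub h1
    refine h2.congr_norm (hH₀m i) (Eventually.of_forall fun x => ?_)
    simp
  -- The diagonal choice controls only gradients and boundary values. Convergence of the functions
  -- in L²(D) is not asked for here, because the original functions need not be known to converge.
  have hsel : ∀ n : ℕ, ∃ k, (∀ i, eLpNorm (fun x => partialDeriv i (w n k) x - H n i x) 2
      (volume.restrict D) < ((n : ENNReal) + 1)⁻¹) ∧
      eLpNorm (w n k) 2 (surfaceMeasure D) < ((n : ENNReal) + 1)⁻¹ := by
    intro n
    have hpos : (0 : ENNReal) < ((n : ENNReal) + 1)⁻¹ := by simp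
    have h1 := eventually_all.mpr fun i => (hw2 n i).eventually (gt_mem_nhds hpos)
    have h2 := (hw3 n).eventually (gt_mem_nhds hpos)
    simp only [Pi.zero_apply, sub_zero] at h2
    exact (h1.and h2).exists
  choose k hk1 hk2 using hsel
  have hlim : Tendsto (fun n : ℕ => ((n : ENNReal) + 1)⁻¹) atTop (𝓝 0) := by
    have := (tendsto_add_atTop_iff_nat 1).mpr ENNReal.tendsto_inv_nat_nhds_zero
    simpa using this
  have hz1 : ∀ i, Tendsto (fun n => eLpNorm (fun x => partialDeriv i (w n (k n)) x - H₀ i x) 2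
      (volume.restrict D)) atTop (𝓝 0) := by
    intro i
    refine tendsto_of_tendsto_of_tendsto_of_le_of_le tendsto_const_nhds
      (by simpa using hlim.add (hHH₀ i)) (fun _ => zero_le) fun n => ?_
    have : (fun x => partialDeriv i (w n (k n)) x - H₀ i x) =
        (fun x => partialDeriv i (w n (k n)) x - H n i x) + fun x => H n i x - H₀ i x := by
      funext x
      simp
    rw [this]
    refine (eLpNorm_add_le ((continuous_partialDeriv (hw n _) i).aestronglyMeasurable.sub
      ((hv n).memLp_grad i).1) (((hv n).memLp_grad i).1.sub (hH₀m i)) (by norm_num)).trans ?_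
    exact add_le_add (hk1 n i).le le_rfl
  have hz2 : Tendsto (fun n => eLpNorm (w n (k n)) 2 (surfaceMeasure D)) atTop (𝓝 0) :=
    tendsto_of_tendsto_of_tendsto_of_le_of_le tendsto_const_nhds hlim (fun _ => zero_le)
      fun n => (hk2 n).le
  have hzm : ∀ n, MemLp (w n (k n)) 2 (volume.restrict D) := fun n =>
    memLp_volume_of_continuous hDbdd hDopen (hw n _).continuous
  obtain ⟨v₀, hv₀⟩ := cauchySeq_tendsto_of_complete (cauchySeq_toLp_of_poincare hC
    (fun n => hw n (k n)) hzm hH₀m hz1 hz2)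
  have hv₀' : Tendsto (fun n => eLpNorm (fun x => w n (k n) x - v₀ x) 2 (volume.restrict D)) atTop
      (𝓝 0) := by
    refine ((Lp.tendsto_Lp_iff_tendsto_eLpNorm' _ _).mp hv₀).congr fun n => ?_
    refine eLpNorm_congr_ae ?_
    filter_upwards [(hzm n).coeFn_toLp] with x hx
    rw [Pi.sub_apply, hx]
  have hfin : IsZeroTraceGradient D H₀ := by
    refine ⟨v₀, IsH1.of_tendsto (fun n => IsH1.of_contDiff hDbdd hDopen (hw n (k n)))
      (Lp.memLp v₀) hH₀ hv₀' hz1, MemLp.zero, fun n => w n (k n), fun n => hw n _, hv₀', hz1, ?_⟩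
    simpa using hz2
  refine ⟨H₀, hfin, ?_⟩
  refine Lp.ext ?_
  filter_upwards [hpw, (memLp_weighted hDopen hγ hfin.memLp).coeFn_toLp] with x h1 h2
  rw [h1, h2]

end Dirichlet


/-! ### The Dirichlet-to-Neumann map -/

section DirichletToNeumann

variable {d : ℕ} {D : Set (EuclideanSpace ℝ (Fin d))} {γ₀ K : ℝ}
  {γ : EuclideanSpace ℝ (Fin d) → ℝ}

theorem integrable_energy (h0 : 0 < γ₀) (hDopen : IsOpen D)
    (hγ : IsLipschitzConductivity D γ₀ K γ) {G H : Fin d → EuclideanSpace ℝ (Fin d) → ℂ}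
    (hG : ∀ i, MemLp (G i) 2 (volume.restrict D)) (hH : ∀ i, MemLp (H i) 2 (volume.restrict D)) :
    Integrable (fun x => (γ x : ℂ) * ∑ i, G i x * H i x) (volume.restrict D) := by
  have := L2.integrable_inner (𝕜 := ℂ)
    ((memLp_weighted hDopen hγ fun i => memLp_conj (hH i)).toLp _)
    ((memLp_weighted hDopen hγ hG).toLp _)
  refine this.congr ?_
  filter_upwards [(memLp_weighted hDopen hγ fun i => memLp_conj (hH i)).coeFn_toLp,
    (memLp_weighted hDopen hγ hG).coeFn_toLp, hγ.ae_bounds hDopen] with x h1 h2 h3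
  rw [h1, h2, PiLp.inner_apply, Finset.mul_sum]
  refine Finset.sum_congr rfl fun i _ => ?_
  simp only [RCLike.inner_apply, weighted, map_mul, Complex.conj_ofReal, Complex.conj_conj]
  have : ((√(γ x) : ℝ) : ℂ) * ((√(γ x) : ℝ) : ℂ) = ((γ x : ℝ) : ℂ) := by
    rw [← Complex.ofReal_mul, Real.mul_self_sqrt (h0.le.trans h3.1)]
  rw [← this]
  ring

/-- The gradients of two solutions differ by a zero-trace gradient to which, by the weak equation,
this difference is orthogonal, so they agree almost everywhere. Two extensions of g differ by a
function with zero trace, and the weak equation annihilates that difference. -/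
theorem IsDNPairing.unique (h0 : 0 < γ₀) (hDopen : IsOpen D)
    (hγ : IsLipschitzConductivity D γ₀ K γ)
    {f g : EuclideanSpace ℝ (Fin d) → ℂ} {z z' : ℂ} (hz : IsDNPairing D γ f g z)
    (hz' : IsDNPairing D γ f g z') : z = z' := by
  obtain ⟨u, G, v, H, hu, hv, hvg, rfl⟩ := hz
  obtain ⟨u', G', v', H', hu', hv', hvg', rfl⟩ := hz'
  have hE : ∀ {G H : Fin d → EuclideanSpace ℝ (Fin d) → ℂ}
      (hG : ∀ i, MemLp (G i) 2 (volume.restrict D)) (hH : ∀ i, MemLp (H i) 2 (volume.restrict D)),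
      energyForm D γ G H = inner ℂ ((memLp_weighted hDopen hγ fun i => memLp_conj (hH i)).toLp _)
        ((memLp_weighted hDopen hγ hG).toLp _) := by
    intro G H hG hH
    rw [inner_weighted h0 hDopen hγ hG fun i => memLp_conj (hH i)]
    simp
  have hG := hu.isH1.memLp_grad
  have hG' := hu'.isH1.memLp_grad
  have hH := hv.memLp_grad
  have hH' := hv'.memLp_grad
  have hzero : IsZeroTraceGradient D fun i x => G i x - G' i x := by
    refine ⟨_, hu.isH1.sub hu'.isH1, ?_⟩
    have := hu.hasTrace.sub hu.isH1 hu'.isH1 hu'.hasTrace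
    simp only [sub_self] at this
    exact this
  have hzero' : IsZeroTraceGradient D fun i x => H i x - H' i x := by
    refine ⟨_, hv.sub hv', ?_⟩
    have := hvg.sub hv hv' hvg'
    simp only [sub_self] at this
    exact this
  have h1 : (memLp_weighted hDopen hγ hG).toLp _ - (memLp_weighted hDopen hγ hG').toLp _ = 0 := by
    -- The weak equation is bilinear, so testing against the conjugate produces the Hermitian
    -- square.
    obtain ⟨y, hy, hy0⟩ := hzero.conj
    have h2 := hu.weak_eq _ _ hy hy0
    have h3 := hu'.weak_eq _ _ hy hy0
    rw [← inner_weighted h0 hDopen hγ hG hzero.memLp] at h2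
    rw [← inner_weighted h0 hDopen hγ hG' hzero.memLp] at h3
    have h4 := toLp_weighted_sub hDopen hγ hG hG'
    rw [h4] at h2 h3
    rw [← inner_self_eq_zero (𝕜 := ℂ), inner_sub_right, h2, h3, sub_zero]
  obtain ⟨y, hy, hy0⟩ := hzero'
  have h5 := hu'.weak_eq _ _ hy hy0
  rw [hE hG hH, sub_eq_zero.mp h1, ← hE hG' hH, ← sub_eq_zero, ← h5, energyForm, energyForm,
    energyForm, ← integral_sub]
  · refine integral_congr_ae (Eventually.of_forall fun x => ?_)
    simp only [← mul_sub, ← Finset.sum_sub_distrib]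
  · exact integrable_energy h0 hDopen hγ hG' hH
  · exact integrable_energy h0 hDopen hγ hG' hH'

theorem norm_toLp_weighted_sq (h0 : 0 < γ₀) (hDopen : IsOpen D)
    (hγ : IsLipschitzConductivity D γ₀ K γ) {G : Fin d → EuclideanSpace ℝ (Fin d) → ℂ}
    (hG : ∀ i, MemLp (G i) 2 (volume.restrict D)) :
    ‖(memLp_weighted hDopen hγ hG).toLp _‖ ^ 2 = ∫ x in D, γ x * ∑ i, ‖G i x‖ ^ 2 := by
  have h1 := inner_weighted h0 hDopen hγ hG hG
  rw [inner_self_eq_norm_sq_to_K, energyForm] at h1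
  have h2 : ∫ x in D, (γ x : ℂ) * ∑ i, G i x * conj (G i x) =
      ((∫ x in D, γ x * ∑ i, ‖G i x‖ ^ 2 : ℝ) : ℂ) := by
    refine Eq.trans ?_ (integral_ofReal (𝕜 := ℂ))
    refine integral_congr_ae (Eventually.of_forall fun x => ?_)
    simp only [Complex.mul_conj, Complex.normSq_eq_norm_sq]
    push_cast
    rfl
  rw [h2] at h1
  refine Complex.ofReal_injective ?_
  rw [← h1]
  push_cast
  rfl

theorem integral_sq_le_norm_toLp_weighted (h0 : 0 < γ₀) (hDopen : IsOpen D)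
    (hγ : IsLipschitzConductivity D γ₀ K γ) {G : Fin d → EuclideanSpace ℝ (Fin d) → ℂ}
    (hG : ∀ i, MemLp (G i) 2 (volume.restrict D)) :
    γ₀ * ∫ x in D, ∑ i, ‖G i x‖ ^ 2 ≤ ‖(memLp_weighted hDopen hγ hG).toLp _‖ ^ 2 := by
  have hint : Integrable (fun x => ∑ i, ‖G i x‖ ^ 2) (volume.restrict D) :=
    integrable_finsetSum _ fun i _ => (hG i).integrable_norm_pow two_ne_zero
  rw [norm_toLp_weighted_sq h0 hDopen hγ hG, ← integral_const_mul]
  refine integral_mono_ae (hint.const_mul _) ?_ ?_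
  · refine (hint.const_mul K).mono' ?_ ?_
    · exact (hγ.continuousOn.aestronglyMeasurable hDopen.measurableSet).mul hint.1
    · filter_upwards [hγ.ae_bounds hDopen] with x hx
      have h1 : 0 ≤ ∑ i, ‖G i x‖ ^ 2 := by positivity
      rw [Real.norm_eq_abs, abs_of_nonneg (mul_nonneg (h0.le.trans hx.1) h1)]
      exact mul_le_mul_of_nonneg_right hx.2 h1
  · filter_upwards [hγ.ae_bounds hDopen] with x hx
    exact mul_le_mul_of_nonneg_right hx.1 (by positivity)

theorem IsH1.hasTrace_conj_contDiff (hDbdd : Bornology.IsBounded D) (hDopen : IsOpen D)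
    (hσ : surfaceMeasure D Set.univ < ⊤) {f : EuclideanSpace ℝ (Fin d) → ℂ}
    (hf : ContDiff ℝ 1 f) :
    IsH1 D (fun x => conj (f x)) (fun i x => conj (partialDeriv i f x)) ∧
      HasTrace D (fun x => conj (f x)) (fun i x => conj (partialDeriv i f x))
        fun x => conj (f x) :=
  ⟨(IsH1.of_contDiff hDbdd hDopen hf).conj, (HasTrace.of_contDiff hDbdd hσ hf).conj⟩

/-- For boundary data that are the restriction of a `C¹` function `f`, the quadratic form of the
Dirichlet-to-Neumann map is well defined, it is at most the energy of `f`, and it differs little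
from that energy if `γ ∇f` is almost divergence free in the weak sense. -/
theorem exists_unique_dnPairing (h0 : 0 < γ₀) (hDbdd : Bornology.IsBounded D) (hDopen : IsOpen D)
    (hσ : surfaceMeasure D Set.univ < ⊤) (hγ : IsLipschitzConductivity D γ₀ K γ) {C : NNReal}
    (hC : ∀ w : EuclideanSpace ℝ (Fin d) → ℂ, ContDiff ℝ 1 w →
      ∫⁻ y in D, ‖w y‖ₑ ^ 2 ≤ C * ((∫⁻ y in D, ∑ i, ‖partialDeriv i w y‖ₑ ^ 2) +
        ∫⁻ y, ‖w y‖ₑ ^ 2 ∂(surfaceMeasure D)))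
    {f : EuclideanSpace ℝ (Fin d) → ℂ} (hf : ContDiff ℝ 1 f) :
    (∃! z : ℂ, IsDNPairing D γ f (fun x => conj (f x)) z) ∧
    ‖dnPairing D γ f fun x => conj (f x)‖ ≤ ∫ x in D, γ x * ∑ i, ‖partialDeriv i f x‖ ^ 2 ∧
    ∀ A : ℝ, 0 ≤ A → (∀ H, IsZeroTraceGradient D H →
      ‖energyForm D γ (fun i => partialDeriv i f) H‖ ≤ A * √(∫ x in D, ∑ i, ‖H i x‖ ^ 2)) →
      ‖dnPairing D γ f (fun x => conj (f x)) -
        ((∫ x in D, γ x * ∑ i, ‖partialDeriv i f x‖ ^ 2 : ℝ) : ℂ)‖ ≤ A ^ 2 / γ₀ := by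
  let W := zeroTraceSpace hDbdd hDopen hσ hγ
  have hWc : IsClosed (W : Set (Lp (EuclideanSpace ℂ (Fin d)) 2 (volume.restrict D))) :=
    isClosed_zeroTraceSpace h0 hDbdd hDopen hσ hγ hC
  have : CompleteSpace W := hWc.completeSpace_coe
  have hfH := IsH1.of_contDiff hDbdd hDopen hf
  have hft := HasTrace.of_contDiff hDbdd hσ hf
  obtain ⟨hfcH, hfct⟩ := IsH1.hasTrace_conj_contDiff hDbdd hDopen hσ hf
  let a := (memLp_weighted hDopen hγ hfH.memLp_grad).toLp _
  -- Orthogonality of a - p to W is the weak equation for f - v₀, where p is the weighted gradient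
  -- of v₀.
  obtain ⟨p, hpW, hpo⟩ := Submodule.HasOrthogonalProjection.exists_orthogonal (K := W) a
  have hpW' := hpW
  obtain ⟨H₀, hH₀, hp⟩ := hpW'
  have hH₀' := hH₀
  obtain ⟨v₀, hv₀, hv₀t⟩ := hH₀'
  have hGm : ∀ i, MemLp (fun x => partialDeriv i f x - H₀ i x) 2 (volume.restrict D) := fun i =>
    (hfH.memLp_grad i).sub (hH₀.memLp i)
  have hap : (memLp_weighted hDopen hγ hGm).toLp _ = a - p := by
    rw [hp]
    exact toLp_weighted_sub hDopen hγ hfH.memLp_grad hH₀.memLp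
  have hsol : IsDirichletSolution D γ f (fun x => f x - v₀ x)
      fun i x => partialDeriv i f x - H₀ i x := by
    refine ⟨hfH.sub hv₀, ?_, fun v H hv hvt => ?_⟩
    · have := hft.sub hfH hv₀ hv₀t
      simp only [Pi.zero_apply, sub_zero] at this
      exact this
    · have hz : IsZeroTraceGradient D H := ⟨v, hv, hvt⟩
      have h1 := inner_weighted h0 hDopen hγ hGm hz.conj.memLp
      simp only [Complex.conj_conj] at h1
      rw [← h1, hap]
      exact hpo _ ⟨_, hz.conj, rfl⟩
  let z : ℂ := energyForm D γ (fun i x => partialDeriv i f x - H₀ i x)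
    fun i x => conj (partialDeriv i f x)
  have hz : IsDNPairing D γ f (fun x => conj (f x)) z := ⟨_, _, _, _, hsol, hfcH, hfct, rfl⟩
  -- The pairing is a chosen value; uniqueness identifies it with the one computed from the
  -- projection.
  have hdn : dnPairing D γ f (fun x => conj (f x)) = z := by
    have hex : ∃ z, IsDNPairing D γ f (fun x => conj (f x)) z := ⟨z, hz⟩
    rw [dnPairing, dif_pos hex]
    exact IsDNPairing.unique h0 hDopen hγ hex.choose_spec hz
  have hpa : inner ℂ p (a - p) = 0 := hpo p hpW
  have hzv : z = ((‖a‖ ^ 2 - ‖p‖ ^ 2 : ℝ) : ℂ) := by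
    have h1 : z = inner ℂ a (a - p) := by
      rw [← hap]
      exact (inner_weighted h0 hDopen hγ hGm hfH.memLp_grad).symm
    have h2 : inner ℂ (a - p) p = 0 := by rw [← inner_conj_symm, hpa, map_zero]
    have h3 : inner ℂ a p = inner ℂ p p := by
      rw [inner_sub_left, sub_eq_zero] at h2
      exact h2
    rw [h1, inner_sub_right, h3, inner_self_eq_norm_sq_to_K, inner_self_eq_norm_sq_to_K]
    push_cast
    rfl
  have hEn : ‖a‖ ^ 2 = ∫ x in D, γ x * ∑ i, ‖partialDeriv i f x‖ ^ 2 :=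
    norm_toLp_weighted_sq h0 hDopen hγ hfH.memLp_grad
  have hpale : ‖p‖ ^ 2 ≤ ‖a‖ ^ 2 := by
    have h1 : ‖a‖ ^ 2 = ‖p‖ ^ 2 + ‖a - p‖ ^ 2 := by
      have := norm_add_sq_eq_norm_sq_add_norm_sq_of_inner_eq_zero (𝕜 := ℂ) p (a - p) hpa
      rw [add_sub_cancel] at this
      simpa [sq] using this
    nlinarith [sq_nonneg ‖a - p‖]
  refine ⟨⟨z, hz, fun z' hz' => IsDNPairing.unique h0 hDopen hγ hz' hz⟩, ?_, fun A hA0 hA => ?_⟩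
  · rw [hdn, hzv, ← hEn, Complex.norm_real, Real.norm_eq_abs, abs_of_nonneg (by linarith)]
    nlinarith [sq_nonneg ‖p‖]
  · rw [hdn, hzv, ← hEn, ← Complex.ofReal_sub, Complex.norm_real, Real.norm_eq_abs]
    have h1 : |‖a‖ ^ 2 - ‖p‖ ^ 2 - ‖a‖ ^ 2| = ‖p‖ ^ 2 := by
      rw [show ‖a‖ ^ 2 - ‖p‖ ^ 2 - ‖a‖ ^ 2 = -‖p‖ ^ 2 by ring, abs_neg,
        abs_of_nonneg (sq_nonneg _)]
    rw [h1]
    -- Since p ⟂ a - p, the quantity ‖p‖² equals ⟨p, a⟩, the form of ∇f with a zero-trace gradient,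
    -- to which the hypothesis on A applies. The lower bound γ ≥ γ₀ replaces the unweighted norm by
    -- ‖p‖/√γ₀.
    have h2 : ‖p‖ ^ 2 = ‖inner ℂ p a‖ := by
      rw [inner_sub_right, sub_eq_zero] at hpa
      rw [hpa, inner_self_eq_norm_sq_to_K]
      simp
    have h3 : inner ℂ p a =
        energyForm D γ (fun i => partialDeriv i f) fun i x => conj (H₀ i x) := by
      rw [hp]
      exact inner_weighted h0 hDopen hγ hfH.memLp_grad hH₀.memLp
    have h4 := hA _ hH₀.conj
    simp only [RCLike.norm_conj] at h4
    rw [← h3, ← h2] at h4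
    have h5 := integral_sq_le_norm_toLp_weighted h0 hDopen hγ hH₀.memLp
    rw [← hp] at h5
    set I := ∫ x in D, ∑ i, ‖H₀ i x‖ ^ 2
    have hI : 0 ≤ I := integral_nonneg fun x => by positivity
    have h6 : √γ₀ * √I ≤ ‖p‖ := by
      rw [← Real.sqrt_mul h0.le]
      exact Real.sqrt_le_iff.mpr ⟨norm_nonneg _, h5⟩
    have hs : 0 < √γ₀ := Real.sqrt_pos.mpr h0
    have h7 : √γ₀ * ‖p‖ ≤ A := by
      rcases (norm_nonneg p).eq_or_lt with h | h
      · rw [← h, mul_zero]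
        exact hA0
      · have h8 : √γ₀ * ‖p‖ ^ 2 ≤ A * ‖p‖ := by
          calc √γ₀ * ‖p‖ ^ 2 ≤ √γ₀ * (A * √I) := by gcongr
            _ = A * (√γ₀ * √I) := by ring
            _ ≤ A * ‖p‖ := by gcongr
        have : √γ₀ * ‖p‖ * ‖p‖ ≤ A * ‖p‖ := by linarith [h8, sq ‖p‖]
        exact le_of_mul_le_mul_right this h
    rw [le_div_iff₀ h0]
    calc ‖p‖ ^ 2 * γ₀ = (√γ₀ * ‖p‖) ^ 2 := by rw [mul_pow, Real.sq_sqrt h0.le]; ring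
      _ ≤ A ^ 2 := by gcongr

end DirichletToNeumann


/-! ### The profile of the boundary data -/

theorem IsCutoff.exists_lipschitz {η : ℝ → ℝ} (hη : IsCutoff η) :
    ∃ E : NNReal, LipschitzWith E η := by
  refine ContDiff.lipschitzWith_of_hasCompactSupport ?_ hη.smooth (by simp)
  refine HasCompactSupport.of_support_subset_isCompact (isCompact_Icc (a := -1) (b := 1)) ?_
  intro t ht
  rw [Function.mem_support] at ht
  rw [Set.mem_Icc, ← abs_le]
  by_contra h
  exact ht (hη.eq_zero t (not_le.mp h).le)

/-- At the origin, where the norm is not differentiable, the cutoff is locally constant. -/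
theorem IsCutoff.contDiff_norm {η : ℝ → ℝ} (hη : IsCutoff η) {X : Type*} [NormedAddCommGroup X]
    [InnerProductSpace ℝ X] (M : ℝ) : ContDiff ℝ 1 fun x : X => η (M * ‖x‖) := by
  have hη1 : ContDiff ℝ 1 η := hη.smooth.of_le (by exact_mod_cast le_top)
  rw [contDiff_iff_contDiffAt]
  intro x
  rcases eq_or_ne x 0 with rfl | hx
  · refine (contDiffAt_const (c := (1 : ℝ))).congr_of_eventuallyEq ?_
    have h : Tendsto (fun x : X => |M * ‖x‖|) (𝓝 0) (𝓝 0) := by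
      have : Continuous fun x : X => |M * ‖x‖| := by fun_prop
      simpa using this.tendsto 0
    filter_upwards [h.eventually (gt_mem_nhds (by norm_num : (0 : ℝ) < 1 / 2))] with y hy
    exact hη.eq_one _ hy.le
  · exact hη1.contDiffAt.comp x (contDiffAt_const.mul (contDiffAt_norm ℝ hx))

section Profile

variable {d : ℕ}

/-- The coordinates `(x', x_d)` in which the boundary is flat. -/
abbrev FlatCoord (d : ℕ) : Type := EuclideanSpace ℝ (Fin (d - 1)) × ℝ

/-- The cutoff `η(M|x'|) η(M x_d)`. -/
def cutoff (η : ℝ → ℝ) (M : ℝ) (x : FlatCoord d) : ℝ := η (M * ‖x.1‖) * η (M * x.2)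

variable {η : ℝ → ℝ} {M : ℝ}

theorem contDiff_cutoff (hη : IsCutoff η) : ContDiff ℝ 1 (cutoff (d := d) η M) := by
  have hη1 : ContDiff ℝ 1 η := hη.smooth.of_le (by exact_mod_cast le_top)
  exact ((hη.contDiff_norm M).comp contDiff_fst).mul (hη1.comp (contDiff_const.mul contDiff_snd))

theorem cutoff_nonneg (hη : IsCutoff η) (x : FlatCoord d) : 0 ≤ cutoff η M x :=
  mul_nonneg (hη.mem_Icc _).1 (hη.mem_Icc _).1

theorem cutoff_le_one (hη : IsCutoff η) (x : FlatCoord d) : cutoff η M x ≤ 1 :=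
  mul_le_one₀ (hη.mem_Icc _).2 (hη.mem_Icc _).1 (hη.mem_Icc _).2

/-- The set outside of which the cutoff vanishes. -/
def box (d : ℕ) (M : ℝ) : Set (FlatCoord d) := {x | ‖x.1‖ ≤ M⁻¹ ∧ |x.2| ≤ M⁻¹}

theorem isClosed_box : IsClosed (box d M) :=
  (isClosed_le continuous_fst.norm continuous_const).inter
    (isClosed_le continuous_snd.abs continuous_const)

theorem isCompact_box : IsCompact (box d M) := by
  have : box d M ⊆ Metric.closedBall (0 : EuclideanSpace ℝ (Fin (d - 1))) M⁻¹ ×ˢ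
      Metric.closedBall (0 : ℝ) M⁻¹ := by
    rintro x ⟨h1, h2⟩
    exact ⟨by simpa using h1, by simpa using h2⟩
  exact ((isCompact_closedBall _ _).prod (isCompact_closedBall _ _)).of_isClosed_subset
    isClosed_box this

theorem cutoff_eq_zero (hη : IsCutoff η) (hM : 0 < M) {x : FlatCoord d} (hx : x ∉ box d M) :
    cutoff η M x = 0 := by
  rw [box, Set.mem_ofPred_eq, not_and_or, not_le, not_le] at hx
  rcases hx with h | h
  · rw [cutoff, hη.eq_zero (M * ‖x.1‖), zero_mul]
    rw [abs_of_nonneg (by positivity)]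
    exact ((inv_lt_iff_one_lt_mul₀' hM).mp h).le
  · rw [cutoff, hη.eq_zero (M * x.2), mul_zero]
    rw [abs_mul, abs_of_pos hM]
    exact ((inv_lt_iff_one_lt_mul₀' hM).mp h).le

theorem fderiv_cutoff_eq_zero (hη : IsCutoff η) (hM : 0 < M) {x : FlatCoord d} (hx : x ∉ box d M) :
    fderiv ℝ (cutoff η M) x = 0 := by
  have h : cutoff η M =ᶠ[𝓝 x] fun _ => (0 : ℝ) := by
    filter_upwards [isClosed_box.isOpen_compl.mem_nhds hx] with y hy
    exact cutoff_eq_zero hη hM hy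
  rw [h.fderiv_eq]
  simp

theorem norm_fderiv_cutoff_le (hη : IsCutoff η) {E : NNReal} (hE : LipschitzWith E η)
    (hM : 0 ≤ M) (x : FlatCoord d) : ‖fderiv ℝ (cutoff η M) x‖ ≤ 2 * E * M := by
  have h : LipschitzWith (2 * E * Real.toNNReal M) (cutoff (d := d) η M) := by
    refine LipschitzWith.of_dist_le_mul fun x y => ?_
    have h1 : |η (M * ‖x.1‖) - η (M * ‖y.1‖)| ≤ E * (M * dist x y) := by
      have := hE.dist_le_mul (M * ‖x.1‖) (M * ‖y.1‖)
      rw [Real.dist_eq, Real.dist_eq, ← mul_sub, abs_mul, abs_of_nonneg hM] at this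
      refine this.trans ?_
      have h2 := (abs_norm_sub_norm_le x.1 y.1).trans_eq (dist_eq_norm x.1 y.1).symm
      gcongr
      exact h2.trans (le_max_left _ _)
    have h2 : |η (M * x.2) - η (M * y.2)| ≤ E * (M * dist x y) := by
      have := hE.dist_le_mul (M * x.2) (M * y.2)
      rw [Real.dist_eq, Real.dist_eq, ← mul_sub, abs_mul, abs_of_nonneg hM,
        ← Real.dist_eq x.2] at this
      refine this.trans ?_
      gcongr
      exact le_max_right _ _
    have h3 : cutoff η M x - cutoff η M y =
        (η (M * ‖x.1‖) - η (M * ‖y.1‖)) * η (M * x.2) +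
          η (M * ‖y.1‖) * (η (M * x.2) - η (M * y.2)) := by
      simp only [cutoff]
      ring
    rw [Real.dist_eq, h3]
    refine (abs_add_le _ _).trans ?_
    rw [abs_mul, abs_mul, abs_of_nonneg (hη.mem_Icc (M * x.2)).1,
      abs_of_nonneg (hη.mem_Icc (M * ‖y.1‖)).1]
    have h4 := mul_le_mul h1 (hη.mem_Icc (M * x.2)).2 (hη.mem_Icc (M * x.2)).1 (by positivity)
    have h5 := mul_le_mul (hη.mem_Icc (M * ‖y.1‖)).2 h2 (abs_nonneg _) zero_le_one
    simp only [NNReal.coe_mul, NNReal.coe_ofNat, Real.coe_toNNReal _ hM]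
    linarith
  have := norm_fderiv_le_of_lipschitz ℝ (x₀ := x) h
  simpa [Real.coe_toNNReal _ hM] using this

/-- The linear form `x ↦ (iξ - e_d) · x`. -/
def phase (ξ : Coord d) : (FlatCoord d) →L[ℝ] ℂ :=
  Complex.I • Complex.ofRealCLM.comp ((innerSL ℝ ξ.fst).comp (ContinuousLinearMap.fst ℝ _ _) +
    ξ.snd • ContinuousLinearMap.snd ℝ _ _) -
  Complex.ofRealCLM.comp (ContinuousLinearMap.snd ℝ _ _)

theorem phase_apply (ξ : Coord d) (x : FlatCoord d) :
    phase ξ x = Complex.I * ((inner ℝ ξ.fst x.1 + ξ.snd * x.2 : ℝ) : ℂ) - ((x.2 : ℝ) : ℂ) := by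
  simp [phase, mul_add]

/-- The function `η(M|x'|) η(M x_d) e^{N (iξ - e_d) · x}`. -/
def wave (η : ℝ → ℝ) (M N : ℝ) (ξ : Coord d) (x : FlatCoord d) : ℂ :=
  ((cutoff η M x : ℝ) : ℂ) * Complex.exp ((N : ℂ) * phase ξ x)

theorem norm_exp_phase (N : ℝ) (ξ : Coord d) (x : FlatCoord d) :
    ‖Complex.exp ((N : ℂ) * phase ξ x)‖ = Real.exp (-(N * x.2)) := by
  rw [Complex.norm_exp, phase_apply]
  simp

theorem hasFDerivAt_wave (hη : IsCutoff η) (N : ℝ) (ξ : Coord d) (x : FlatCoord d) :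
    HasFDerivAt (wave η M N ξ) (((cutoff η M x : ℝ) : ℂ) •
        (Complex.exp ((N : ℂ) * phase ξ x) • ((N : ℂ) • phase ξ)) +
      Complex.exp ((N : ℂ) * phase ξ x) • Complex.ofRealCLM.comp (fderiv ℝ (cutoff η M) x)) x := by
  have h1 : HasFDerivAt (fun x => ((cutoff η M x : ℝ) : ℂ))
      (Complex.ofRealCLM.comp (fderiv ℝ (cutoff η M) x)) x :=
    Complex.ofRealCLM.hasFDerivAt.comp x
      ((contDiff_cutoff hη).differentiable one_ne_zero x).hasFDerivAt
  have h2 : HasFDerivAt (fun x => (N : ℂ) * phase ξ x) ((N : ℂ) • phase ξ) x :=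
    (phase ξ).hasFDerivAt.const_mul (N : ℂ)
  exact h1.mul h2.cexp

theorem fderiv_wave_apply (hη : IsCutoff η) (N : ℝ) (ξ : Coord d) (x v : FlatCoord d) :
    fderiv ℝ (wave η M N ξ) x v = Complex.exp ((N : ℂ) * phase ξ x) *
      (((fderiv ℝ (cutoff η M) x v : ℝ) : ℂ) + N * ((cutoff η M x : ℝ) : ℂ) * phase ξ v) := by
  rw [(hasFDerivAt_wave hη N ξ x).fderiv]
  simp only [add_apply, smul_apply, smul_eq_mul,
    ContinuousLinearMap.comp_apply, Complex.ofRealCLM_apply]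
  ring

theorem contDiff_wave (hη : IsCutoff η) (N : ℝ) (ξ : Coord d) : ContDiff ℝ 1 (wave η M N ξ) :=
  (Complex.ofRealCLM.contDiff.comp (contDiff_cutoff hη)).mul
    ((contDiff_const.mul (phase ξ).contDiff).cexp)

theorem hasCompactSupport_wave (hη : IsCutoff η) (hM : 0 < M) (N : ℝ) (ξ : Coord d) :
    HasCompactSupport (wave η M N ξ) :=
  HasCompactSupport.intro isCompact_box fun x hx => by
    rw [wave, cutoff_eq_zero hη hM hx]
    simp

/-! ### The boundary data as pull-back of a wave, and the derivatives of the straightening map. -/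

namespace BoundaryChart

variable {D : Set (EuclideanSpace ℝ (Fin d))} {θ : ℝ} {P : EuclideanSpace ℝ (Fin d)}

theorem coord_eq (κ : BoundaryChart D θ P) :
    ⇑κ.coord = fun x => κ.coord.linearIsometryEquiv x + κ.coord 0 := by
  funext y
  have := κ.coord.map_vadd 0 y
  simpa using this

theorem coord_symm_eq (κ : BoundaryChart D θ P) :
    ⇑κ.coord.symm = fun x => κ.coord.linearIsometryEquiv.symm x + κ.coord.symm 0 := by
  funext y
  have := κ.coord.symm.map_vadd 0 y
  simp only [vadd_eq_add, add_zero] at this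
  exact this

/-- The same formula is read at every point of ℝ^d: this provides the extension of the data into D
whose energy is computed below. -/
theorem boundaryData_eq (κ : BoundaryChart D θ P) (η : ℝ → ℝ) (ξ : Coord d) (N : ℕ)
    (y : EuclideanSpace ℝ (Fin d)) :
    κ.boundaryData η ξ N y =
      (((N : ℝ) ^ (-(1 / 2) : ℝ) * ((N : ℝ) ^ (1 / (1 + θ))) ^ (((d : ℝ) - 1) / 2) *
        κ.normConst η : ℝ) : ℂ) *
      wave η ((N : ℝ) ^ (1 / (1 + θ))) N ξ (κ.straighten y) := by
  have h : inner ℝ ξ (κ.flat y) =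
      inner ℝ ξ.fst (κ.straighten y).1 + ξ.snd * (κ.straighten y).2 := by
    rw [WithLp.prod_inner_apply]
    congr 1
    exact mul_comm _ _
  simp only [boundaryData, wave, phase_apply, cutoff, h, Complex.ofReal_mul]
  simp only [Complex.ofReal_natCast, mul_assoc]
  rfl

/-- The derivative of the straightening map at a point where the slope of the boundary is `s`. -/
def dflat (κ : BoundaryChart D θ P) (s : EuclideanSpace ℝ (Fin (d - 1))) :
    EuclideanSpace ℝ (Fin d) →L[ℝ] FlatCoord d :=
  let Λ : EuclideanSpace ℝ (Fin d) →L[ℝ] Coord d := κ.coord.linearIsometryEquiv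
  let p1 := (WithLp.fstL 2 ℝ (EuclideanSpace ℝ (Fin (d - 1))) ℝ).comp Λ
  p1.prod ((WithLp.sndL 2 ℝ (EuclideanSpace ℝ (Fin (d - 1))) ℝ).comp Λ - (innerSL ℝ s).comp p1)

theorem dflat_apply (κ : BoundaryChart D θ P) (s : EuclideanSpace ℝ (Fin (d - 1)))
    (w : EuclideanSpace ℝ (Fin d)) :
    κ.dflat s w = ((κ.coord.linearIsometryEquiv w).fst,
      (κ.coord.linearIsometryEquiv w).snd - inner ℝ s (κ.coord.linearIsometryEquiv w).fst) := rfl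

theorem hasFDerivAt_φ (κ : BoundaryChart D θ P) (x : EuclideanSpace ℝ (Fin (d - 1))) :
    HasFDerivAt κ.φ (innerSL ℝ (gradient κ.φ x)) x := by
  have := (κ.differentiable x).hasGradientAt.hasFDerivAt
  exact this

theorem hasFDerivAt_straighten (κ : BoundaryChart D θ P) (y : EuclideanSpace ℝ (Fin d)) :
    HasFDerivAt κ.straighten (κ.dflat (gradient κ.φ (κ.coord y).fst)) y := by
  have h0 : HasFDerivAt κ.coord
      (κ.coord.linearIsometryEquiv : EuclideanSpace ℝ (Fin d) →L[ℝ] Coord d) y := by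
    have h4 := κ.coord_eq
    rw [h4]
    exact (ContinuousLinearEquiv.hasFDerivAt
      (κ.coord.linearIsometryEquiv : EuclideanSpace ℝ (Fin d) ≃L[ℝ] Coord d)).add_const _
  have h1 := (WithLp.fstL 2 ℝ (EuclideanSpace ℝ (Fin (d - 1))) ℝ).hasFDerivAt.comp y h0
  have h2 := (WithLp.sndL 2 ℝ (EuclideanSpace ℝ (Fin (d - 1))) ℝ).hasFDerivAt.comp y h0
  have h3 := (κ.hasFDerivAt_φ (κ.coord y).fst).comp y h1
  exact (h1.sub_const (κ.coord P).fst).prodMk (h2.sub h3)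

/-- The derivative of the inverse of the straightening map. -/
def dunflat (κ : BoundaryChart D θ P) (s : EuclideanSpace ℝ (Fin (d - 1))) :
    (FlatCoord d) →L[ℝ] EuclideanSpace ℝ (Fin d) :=
  let Λ : Coord d →L[ℝ] EuclideanSpace ℝ (Fin d) := κ.coord.linearIsometryEquiv.symm
  Λ.comp ((WithLp.prodContinuousLinearEquiv 2 ℝ
    (EuclideanSpace ℝ (Fin (d - 1))) ℝ).symm.toContinuousLinearMap.comp
    ((ContinuousLinearMap.fst ℝ _ _).prod (ContinuousLinearMap.snd ℝ _ _ +
      (innerSL ℝ s).comp (ContinuousLinearMap.fst ℝ _ _))))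

theorem dunflat_apply (κ : BoundaryChart D θ P) (s : EuclideanSpace ℝ (Fin (d - 1)))
    (a : FlatCoord d) :
    κ.dunflat s a =
      κ.coord.linearIsometryEquiv.symm (WithLp.toLp 2 (a.1, a.2 + inner ℝ s a.1)) := rfl

theorem hasFDerivAt_straighten_symm (κ : BoundaryChart D θ P) (x : FlatCoord d) :
    HasFDerivAt κ.straighten.symm
      (κ.dunflat (gradient κ.φ (κ.coord (κ.straighten.symm x)).fst)) x := by
  have h5 : (κ.coord (κ.straighten.symm x)).fst = x.1 + (κ.coord P).fst := by
    have := congrArg Prod.fst (κ.straighten.apply_symm_apply x)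
    change (κ.coord (κ.straighten.symm x)).fst - _ = _ at this
    rw [← this, sub_add_cancel]
  rw [h5]
  have h1 : HasFDerivAt (fun x : FlatCoord d => x.1 + (κ.coord P).fst)
      (ContinuousLinearMap.fst ℝ _ _) x := hasFDerivAt_fst.add_const _
  have h3 := hasFDerivAt_snd.add ((κ.hasFDerivAt_φ (x.1 + (κ.coord P).fst)).comp x h1)
  have h6 := (WithLp.prodContinuousLinearEquiv 2 ℝ (EuclideanSpace ℝ (Fin (d - 1)))
    ℝ).symm.hasFDerivAt.comp x (h1.prodMk h3)
  have h4 := κ.coord_symm_eq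
  have h7 : ∀ z, HasFDerivAt κ.coord.symm
      (κ.coord.linearIsometryEquiv.symm : Coord d →L[ℝ] EuclideanSpace ℝ (Fin d)) z := by
    intro z
    rw [h4]
    exact (ContinuousLinearEquiv.hasFDerivAt
      (κ.coord.linearIsometryEquiv.symm : Coord d ≃L[ℝ] EuclideanSpace ℝ (Fin d))).add_const _
  exact (h7 _).comp x h6

theorem contDiff_straighten (κ : BoundaryChart D θ P) (hθ : 0 < θ) :
    ContDiff ℝ 1 κ.straighten := by
  have h0 : ContDiff ℝ 1 κ.coord := by
    have h4 := κ.coord_eq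
    rw [h4]
    exact κ.coord.linearIsometryEquiv.contDiff.add contDiff_const
  have h1 := (WithLp.fstL 2 ℝ (EuclideanSpace ℝ (Fin (d - 1))) ℝ).contDiff.comp h0
  have h2 := (WithLp.sndL 2 ℝ (EuclideanSpace ℝ (Fin (d - 1))) ℝ).contDiff.comp h0
  exact (h1.sub contDiff_const).prodMk (h2.sub ((κ.contDiff hθ).comp h1))

theorem contDiff_straighten_symm (κ : BoundaryChart D θ P) (hθ : 0 < θ) :
    ContDiff ℝ 1 κ.straighten.symm := by
  have h0 : ContDiff ℝ 1 κ.coord.symm := by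
    have h4 := κ.coord_symm_eq
    rw [h4]
    exact κ.coord.linearIsometryEquiv.symm.contDiff.add contDiff_const
  have h1 : ContDiff ℝ 1 fun x : FlatCoord d => x.1 + (κ.coord P).fst :=
    contDiff_fst.add contDiff_const
  exact h0.comp ((WithLp.prodContinuousLinearEquiv 2 ℝ (EuclideanSpace ℝ (Fin (d - 1)))
    ℝ).symm.contDiff.comp (h1.prodMk (contDiff_snd.add ((κ.contDiff hθ).comp h1))))

theorem contDiff_boundaryData (κ : BoundaryChart D θ P) (hθ : 0 < θ) (hη : IsCutoff η)
    (ξ : Coord d) (N : ℕ) : ContDiff ℝ 1 (κ.boundaryData η ξ N) := by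
  have : κ.boundaryData η ξ N = _ := funext fun y => κ.boundaryData_eq η ξ N y
  rw [this]
  exact contDiff_const.mul ((contDiff_wave hη N ξ).comp (κ.contDiff_straighten hθ))

end BoundaryChart

end Profile


/-! ### Integrals over the half-space -/

section HalfSpace

variable {d : ℕ}

/-- The half-space `x_d > 0`. -/
def halfSpace (d : ℕ) : Set (FlatCoord d) := Set.univ ×ˢ Set.Ioi (0 : ℝ)

theorem measurableSet_halfSpace : MeasurableSet (halfSpace d) :=
  MeasurableSet.univ.prod measurableSet_Ioi

theorem mem_halfSpace {x : FlatCoord d} : x ∈ halfSpace d ↔ 0 < x.2 := by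
  simp [halfSpace]

/-- Integration by parts in the half-space. -/
theorem integral_halfSpace_fderiv {Q : FlatCoord d → ℂ} (hQ : ContDiff ℝ 1 Q)
    (hQc : HasCompactSupport Q) (v : FlatCoord d) :
    ∫ x in halfSpace d, fderiv ℝ Q x v = -((v.2 : ℝ) : ℂ) * ∫ x', Q (x', 0) := by
  have hint : ∀ w : FlatCoord d, Integrable (fun x => fderiv ℝ Q x w) volume := fun w =>
    ((hQ.continuous_fderiv one_ne_zero).clm_apply continuous_const).integrable_of_hasCompactSupport
      (hQc.fderiv_apply ℝ w)
  have hd := hQ.differentiable one_ne_zero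
  have hcs2 : ∀ x', HasCompactSupport fun t => Q (x', t) := fun x' =>
    hQc.comp_isClosedEmbedding
      (Isometry.of_dist_eq fun a b => by simp [Prod.dist_eq]).isClosedEmbedding
  have hcs1 : ∀ t, HasCompactSupport fun x' => Q (x', t) := fun t =>
    hQc.comp_isClosedEmbedding
      (Isometry.of_dist_eq fun a b => by simp [Prod.dist_eq]).isClosedEmbedding
  -- Only the vertical component of v meets the boundary; tangential derivatives integrate to zero
  -- on every horizontal slice.
  have hvert : ∫ x in halfSpace d, fderiv ℝ Q x (0, 1) = -∫ x', Q (x', 0) := by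
    rw [halfSpace, Measure.volume_eq_prod, setIntegral_prod _ (hint (0, 1)).integrableOn,
      setIntegral_univ, ← integral_neg]
    refine integral_congr_ae (Eventually.of_forall fun x' => ?_)
    have h1 : ∀ t, deriv (fun t => Q (x', t)) t = fderiv ℝ Q (x', t) (0, 1) := by
      intro t
      have h2 : HasDerivAt (fun t : ℝ => (x', t)) ((0, 1) : FlatCoord d) t :=
        (hasDerivAt_const t x').prodMk (hasDerivAt_id t)
      exact ((hd (x', t)).hasFDerivAt.comp_hasDerivAt t h2).deriv
    have h3 := HasCompactSupport.integral_Ioi_deriv_eq (hQ.comp (contDiff_prodMk_right x'))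
      (hcs2 x') 0
    refine Eq.trans ?_ h3
    exact integral_congr_ae (Eventually.of_forall fun t => (h1 t).symm)
  have hhor : ∫ x in halfSpace d, fderiv ℝ Q x (v.1, 0) = 0 := by
    rw [halfSpace, Measure.volume_eq_prod, ← Measure.prod_restrict, Measure.restrict_univ,
      integral_prod_symm]
    · refine integral_eq_zero_of_ae (Eventually.of_forall fun t => ?_)
      have hQt : ContDiff ℝ 1 fun x' => Q (x', t) := hQ.comp (contDiff_prodMk_left t)
      have h1 : ∀ x', fderiv ℝ (fun x' => Q (x', t)) x' v.1 = fderiv ℝ Q (x', t) (v.1, 0) := by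
        intro x'
        have h2 : HasFDerivAt (fun x' => (x', t))
            ((ContinuousLinearMap.id ℝ (EuclideanSpace ℝ (Fin (d - 1)))).prod 0) x' :=
          (hasFDerivAt_id x').prodMk (hasFDerivAt_const t x')
        have h3 := ((hd (x', t)).hasFDerivAt.comp x' h2).fderiv
        exact congrArg (fun T => T v.1) h3
      -- Integration by parts against the constant 1.
      have h4 := integral_mul_fderiv_eq_neg_fderiv_mul_of_integrable (μ := volume)
        (f := fun _ : EuclideanSpace ℝ (Fin (d - 1)) => (1 : ℂ)) (g := fun x' => Q (x', t))
        (v := v.1) (by simp) ?_ ?_ (fun x _ => by fun_prop)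
        (fun x _ => hQt.differentiable one_ne_zero x)
      · simp only [one_mul, fderiv_fun_const, Pi.zero_apply, zero_apply,
          zero_mul, integral_zero, neg_zero] at h4
        simp only [Pi.zero_apply]
        rw [← h4]
        exact integral_congr_ae (Eventually.of_forall fun x' => (h1 x').symm)
      · simp only [one_mul]
        exact ((hQt.continuous_fderiv one_ne_zero).clm_apply
          continuous_const).integrable_of_hasCompactSupport ((hcs1 t).fderiv_apply ℝ _)
      · simp only [one_mul]
        exact hQt.continuous.integrable_of_hasCompactSupport (hcs1 t)
    · have := (hint (v.1, 0)).integrableOn (s := halfSpace d)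
      rwa [IntegrableOn, halfSpace, Measure.volume_eq_prod, ← Measure.prod_restrict,
        Measure.restrict_univ] at this
  have hv : v = (v.1, 0) + v.2 • ((0, 1) : FlatCoord d) := by
    ext <;> simp
  have hsplit : ∀ x, fderiv ℝ Q x v =
      fderiv ℝ Q x (v.1, 0) + ((v.2 : ℝ) : ℂ) * fderiv ℝ Q x (0, 1) := by
    intro x
    conv_lhs => rw [hv]
    rw [map_add, map_smul, Complex.real_smul]
  simp only [hsplit]
  rw [integral_add (hint _).integrableOn ((hint _).integrableOn.const_mul _), hhor,
    integral_const_mul, hvert]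
  ring

theorem lintegral_exp_Ioi {N : ℝ} (hN : 0 < N) (a : ℝ) :
    ∫⁻ t in Set.Ioi a, ENNReal.ofReal (Real.exp (-(N * t))) =
      ENNReal.ofReal (Real.exp (-(N * a)) / N) := by
  have h1 : IntegrableOn (fun t => Real.exp (-(N * t))) (Set.Ioi a) := by
    have := integrableOn_exp_mul_Ioi (a := -N) (by linarith) a
    simpa only [neg_mul] using this
  rw [← ofReal_integral_eq_lintegral_ofReal h1 (Eventually.of_forall fun t => (Real.exp_pos _).le)]
  have h2 := integral_exp_mul_Ioi (a := -N) (by linarith) a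
  simp only [neg_mul] at h2
  rw [h2]
  congr 1
  field_simp

/-- Exponential damping absorbs a primitive. -/
theorem lintegral_exp_mul_enorm_le {N : ℝ} (hN : 0 < N) {ρ : ℝ} {w w' : ℝ → ℂ}
    (hw : ∀ t, HasDerivAt w (w' t) t) (hw' : Continuous w') :
    ∫⁻ t in Set.Ioc 0 ρ, ENNReal.ofReal (Real.exp (-(N * t))) * ‖w t‖ₑ ≤
      ENNReal.ofReal (1 / N) * (‖w 0‖ₑ +
        ∫⁻ t in Set.Ioc 0 ρ, ENNReal.ofReal (Real.exp (-(N * t))) * ‖w' t‖ₑ) := by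
  let E : ℝ → ENNReal := fun t => ENNReal.ofReal (Real.exp (-(N * t)))
  have hE : Measurable E := by
    refine Measurable.ennreal_ofReal ?_
    fun_prop
  have hw'm : Measurable fun t => ‖w' t‖ₑ := hw'.enorm.measurable
  have hpt : ∀ t ∈ Set.Ioc 0 ρ, E t * ‖w t‖ₑ ≤ E t * ‖w 0‖ₑ +
      ∫⁻ s in Set.Ioc 0 ρ, (Set.Iio t).indicator (fun s => E t * ‖w' s‖ₑ) s := by
    intro t ht
    have h1 := enorm_sub_le_lintegral_of_hasDerivAt hw hw' ht.1.le
    have h2 : ‖w t‖ₑ ≤ ‖w 0‖ₑ + ∫⁻ s in Set.Ioo 0 t, ‖w' s‖ₑ := by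
      calc ‖w t‖ₑ = ‖w 0 + (w t - w 0)‖ₑ := by rw [add_sub_cancel]
        _ ≤ ‖w 0‖ₑ + ‖w t - w 0‖ₑ := enorm_add_le _ _
        _ ≤ _ := by gcongr
    rw [lintegral_indicator measurableSet_Iio, Measure.restrict_restrict measurableSet_Iio,
      lintegral_const_mul _ hw'm, ← mul_add]
    gcongr
    refine h2.trans ?_
    gcongr
    intro s hs
    exact ⟨hs.2, hs.1, hs.2.le.trans ht.2⟩
  -- After Tonelli the inner integral is at most ∫_s^∞ e^{-Nt} dt = e^{-Ns}/N, so the weight returns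
  -- with a gain of 1/N.
  have hswap : ∫⁻ t in Set.Ioc 0 ρ, ∫⁻ s in Set.Ioc 0 ρ,
      (Set.Iio t).indicator (fun s => E t * ‖w' s‖ₑ) s ≤
      ∫⁻ s in Set.Ioc 0 ρ, ENNReal.ofReal (1 / N) * (E s * ‖w' s‖ₑ) := by
    rw [lintegral_lintegral_swap]
    · refine lintegral_mono fun s => ?_
      have h1 : ∀ t, (Set.Iio t).indicator (fun s => E t * ‖w' s‖ₑ) s =
          (Set.Ioi s).indicator (fun t => E t * ‖w' s‖ₑ) t := by
        intro t
        by_cases h : s < t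
        · rw [Set.indicator_of_mem (by exact h), Set.indicator_of_mem (by exact h)]
        · rw [Set.indicator_of_notMem (by exact h), Set.indicator_of_notMem (by exact h)]
      simp only [h1]
      calc ∫⁻ t in Set.Ioc 0 ρ, (Set.Ioi s).indicator (fun t => E t * ‖w' s‖ₑ) t
          ≤ ∫⁻ t, (Set.Ioi s).indicator (fun t => E t * ‖w' s‖ₑ) t := setLIntegral_le_lintegral _ _
        _ = ENNReal.ofReal (1 / N) * (E s * ‖w' s‖ₑ) := by
          rw [lintegral_indicator measurableSet_Ioi, lintegral_mul_const _ hE,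
            lintegral_exp_Ioi hN s, ← mul_assoc, ← ENNReal.ofReal_mul (by positivity)]
          congr 2
          ring
    · have h2 : Measurable (Function.uncurry fun t s =>
          (Set.Iio t).indicator (fun s => E t * ‖w' s‖ₑ) s) := by
        have : (Function.uncurry fun t s => (Set.Iio t).indicator (fun s => E t * ‖w' s‖ₑ) s) =
            {p : ℝ × ℝ | p.2 < p.1}.indicator fun p => E p.1 * ‖w' p.2‖ₑ := by
          funext p
          simp only [Function.uncurry, Set.indicator, Set.mem_Iio, Set.mem_ofPred_eq]
        rw [this]
        exact ((hE.comp measurable_fst).mul (hw'm.comp measurable_snd)).indicator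
          (measurableSet_lt measurable_snd measurable_fst)
      exact h2.aemeasurable
  calc ∫⁻ t in Set.Ioc 0 ρ, E t * ‖w t‖ₑ
      ≤ ∫⁻ t in Set.Ioc 0 ρ, (E t * ‖w 0‖ₑ +
          ∫⁻ s in Set.Ioc 0 ρ, (Set.Iio t).indicator (fun s => E t * ‖w' s‖ₑ) s) :=
        setLIntegral_mono' measurableSet_Ioc hpt
    _ = (∫⁻ t in Set.Ioc 0 ρ, E t * ‖w 0‖ₑ) + ∫⁻ t in Set.Ioc 0 ρ, ∫⁻ s in Set.Ioc 0 ρ,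
          (Set.Iio t).indicator (fun s => E t * ‖w' s‖ₑ) s :=
        lintegral_add_left (hE.mul_const _) _
    _ ≤ ENNReal.ofReal (1 / N) * ‖w 0‖ₑ +
          ∫⁻ s in Set.Ioc 0 ρ, ENNReal.ofReal (1 / N) * (E s * ‖w' s‖ₑ) := by
        refine add_le_add ?_ hswap
        rw [lintegral_mul_const _ hE]
        gcongr
        refine (lintegral_mono_set Set.Ioc_subset_Ioi_self).trans_eq ?_
        rw [lintegral_exp_Ioi hN 0]
        simp
    _ = _ := by
        rw [lintegral_const_mul' _ _ ENNReal.ofReal_ne_top, mul_add]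

/-- The function `k e^{-N x_d}`, restricted to the set that contains the support of the cutoff. -/
def weight (d : ℕ) (k N M : ℝ) (x : FlatCoord d) : ℝ :=
  (box d M).indicator (fun x => k * Real.exp (-(N * x.2))) x

theorem weight_nonneg {k N M : ℝ} (hk : 0 ≤ k) (x : FlatCoord d) : 0 ≤ weight d k N M x :=
  Set.indicator_nonneg (fun _ _ => by positivity) _

theorem measurable_weight {k N M : ℝ} : Measurable (weight d k N M) := by
  refine Measurable.indicator ?_ isClosed_box.measurableSet
  fun_prop

/-- The weight is dominated by a product: a ball of radius 1/M tangentially, and e^{-2Nt} with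
integral 1/(2N) vertically. -/
theorem lintegral_weight_sq_le {k N M : ℝ} (hN : 0 < N) (hM : 0 < M) :
    ∫⁻ x in halfSpace d, ENNReal.ofReal (weight d k N M x ^ 2) ≤
      ENNReal.ofReal (k ^ 2 * (M⁻¹) ^ (d - 1) / (2 * N)) *
        volume (Metric.closedBall (0 : EuclideanSpace ℝ (Fin (d - 1))) 1) := by
  let f : EuclideanSpace ℝ (Fin (d - 1)) → ENNReal :=
    (Metric.closedBall 0 M⁻¹).indicator fun _ => ENNReal.ofReal (k ^ 2)
  let g : ℝ → ENNReal := fun t => ENNReal.ofReal (Real.exp (-(2 * N * t)))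
  have hf : Measurable f := measurable_const.indicator Metric.isClosed_closedBall.measurableSet
  have hg : Measurable g := by
    refine Measurable.ennreal_ofReal ?_
    fun_prop
  have hle : ∀ x : FlatCoord d, ENNReal.ofReal (weight d k N M x ^ 2) ≤ f x.1 * g x.2 := by
    intro x
    by_cases hx : x ∈ box d M
    · have h1 : x.1 ∈ Metric.closedBall (0 : EuclideanSpace ℝ (Fin (d - 1))) M⁻¹ := by
        simpa using hx.1
      rw [weight, Set.indicator_of_mem hx]
      simp only [f, g]
      rw [Set.indicator_of_mem h1, ← ENNReal.ofReal_mul (sq_nonneg k), mul_pow, ← Real.exp_nat_mul]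
      refine (congrArg ENNReal.ofReal ?_).le
      congr 2
      push_cast
      ring
    · rw [weight, Set.indicator_of_notMem hx]
      simp
  calc ∫⁻ x in halfSpace d, ENNReal.ofReal (weight d k N M x ^ 2)
      ≤ ∫⁻ x in halfSpace d, f x.1 * g x.2 := lintegral_mono hle
    _ = (∫⁻ x, f x) * ∫⁻ t in Set.Ioi 0, g t := by
      rw [halfSpace, Measure.volume_eq_prod, ← Measure.prod_restrict, Measure.restrict_univ]
      exact lintegral_prod_mul hf.aemeasurable hg.aemeasurable
    _ = _ := by
      simp only [f, g]
      rw [lintegral_indicator Metric.isClosed_closedBall.measurableSet, setLIntegral_const,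
        lintegral_exp_Ioi (by positivity), Measure.addHaar_closedBall' _ _ (by positivity),
        finrank_euclideanSpace_fin, mul_zero, neg_zero, Real.exp_zero]
      rw [mul_comm, ← mul_assoc, ← mul_assoc, ← ENNReal.ofReal_mul (by positivity),
        ← ENNReal.ofReal_mul (by positivity)]
      congr 2
      ring

theorem lintegral_weight_mul_le {k N M : ℝ} (hk : 0 ≤ k) (hN : 0 < N)
    {w w' : FlatCoord d → ℂ}
    (hw : ∀ x t, HasDerivAt (fun t => w (x, t)) (w' (x, t)) t) (hwc : Continuous w)
    (hw' : Continuous w') :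
    ∫⁻ x in halfSpace d, ENNReal.ofReal (weight d k N M x) * ‖w x‖ₑ ≤
      ENNReal.ofReal (1 / N) *
        (ENNReal.ofReal k * (∫⁻ x' in Metric.closedBall 0 M⁻¹, ‖w (x', 0)‖ₑ) +
        ∫⁻ x in halfSpace d, ENNReal.ofReal (weight d k N M x) * ‖w' x‖ₑ) := by
  have key : ∀ {v : FlatCoord d → ℂ}, Continuous v →
      ∫⁻ x in halfSpace d, ENNReal.ofReal (weight d k N M x) * ‖v x‖ₑ =
        ENNReal.ofReal k * ∫⁻ x' in Metric.closedBall 0 M⁻¹, ∫⁻ t in Set.Ioc 0 M⁻¹,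
          ENNReal.ofReal (Real.exp (-(N * t))) * ‖v (x', t)‖ₑ := by
    intro v hv
    let F : FlatCoord d → ENNReal := fun x =>
      ENNReal.ofReal (Real.exp (-(N * x.2))) * ‖v x‖ₑ
    have hF : Measurable F := by
      refine Measurable.mul (Measurable.ennreal_ofReal ?_) hv.enorm.measurable
      fun_prop
    have hset : box d M ∩ halfSpace d = Metric.closedBall 0 M⁻¹ ×ˢ Set.Ioc 0 M⁻¹ := by
      ext x
      simp only [box, halfSpace, Set.mem_inter_iff, Set.mem_ofPred_eq, Set.mem_prod,
        Set.mem_univ, true_and, Set.mem_Ioi, Metric.mem_closedBall, dist_zero_right, Set.mem_Ioc]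
      constructor
      · rintro ⟨⟨h1, h2⟩, h3⟩
        exact ⟨h1, h3, (le_abs_self _).trans h2⟩
      · rintro ⟨h1, h2, h3⟩
        exact ⟨⟨h1, by rwa [abs_of_pos h2]⟩, h2⟩
    have h1 : ∀ x, ENNReal.ofReal (weight d k N M x) * ‖v x‖ₑ =
        (box d M).indicator (fun x => ENNReal.ofReal k * F x) x := by
      intro x
      by_cases hx : x ∈ box d M
      · rw [weight, Set.indicator_of_mem hx, Set.indicator_of_mem hx, ENNReal.ofReal_mul hk,
          mul_assoc]
      · rw [weight, Set.indicator_of_notMem hx, Set.indicator_of_notMem hx]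
        simp
    simp only [h1]
    rw [lintegral_indicator isClosed_box.measurableSet,
      Measure.restrict_restrict isClosed_box.measurableSet, hset,
      lintegral_const_mul' _ _ ENNReal.ofReal_ne_top, Measure.volume_eq_prod,
      setLIntegral_prod _ hF.aemeasurable]
  rw [key hwc, key hw']
  have hm : Measurable fun x' => ‖w (x', 0)‖ₑ :=
    (hwc.comp (Continuous.prodMk_left 0)).enorm.measurable
  calc ENNReal.ofReal k * ∫⁻ x' in Metric.closedBall 0 M⁻¹, ∫⁻ t in Set.Ioc 0 M⁻¹,
          ENNReal.ofReal (Real.exp (-(N * t))) * ‖w (x', t)‖ₑ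
      ≤ ENNReal.ofReal k * ∫⁻ x' in Metric.closedBall 0 M⁻¹, ENNReal.ofReal (1 / N) *
        (‖w (x', 0)‖ₑ + ∫⁻ t in Set.Ioc 0 M⁻¹,
          ENNReal.ofReal (Real.exp (-(N * t))) * ‖w' (x', t)‖ₑ) := by
        gcongr with x'
        exact lintegral_exp_mul_enorm_le hN (hw x') (hw'.comp (Continuous.prodMk_right x'))
    _ = _ := by
        rw [lintegral_const_mul' _ _ ENNReal.ofReal_ne_top, lintegral_add_left hm]
        ring

/-- The half-line factor of the energy. -/
theorem abs_integral_cutoff_sq_exp_sub_le {η : ℝ → ℝ} (hη : IsCutoff η) {M N : ℝ} (hM : 0 < M)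
    (hN : 0 < N) :
    |2 * N * (∫ t in Set.Ioi (0 : ℝ), η (M * t) ^ 2 * Real.exp (-(2 * N * t))) - 1| ≤ M / N := by
  have h2N : 0 < 2 * N := by positivity
  have hexp : ∀ a, IntegrableOn (fun t => Real.exp (-(2 * N * t))) (Set.Ioi a) := by
    intro a
    have := integrableOn_exp_mul_Ioi (a := -(2 * N)) (by linarith) a
    simpa only [neg_mul] using this
  have hval : ∀ a, ∫ t in Set.Ioi a, Real.exp (-(2 * N * t)) =
      Real.exp (-(2 * N * a)) / (2 * N) := by
    intro a
    have := integral_exp_mul_Ioi (a := -(2 * N)) (by linarith) a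
    simp only [neg_mul] at this
    rw [this]
    field_simp
  have hη2 : ∀ t, 0 ≤ η (M * t) ^ 2 ∧ η (M * t) ^ 2 ≤ 1 := fun t =>
    ⟨sq_nonneg _, pow_le_one₀ (hη.mem_Icc _).1 (hη.mem_Icc _).2⟩
  have hint : IntegrableOn (fun t => η (M * t) ^ 2 * Real.exp (-(2 * N * t))) (Set.Ioi 0) := by
    refine (hexp 0).mono' ?_ (Eventually.of_forall fun t => ?_)
    · have := hη.smooth.continuous
      exact Continuous.aestronglyMeasurable (by fun_prop)
    · rw [Real.norm_eq_abs, abs_of_nonneg (mul_nonneg (hη2 t).1 (Real.exp_pos _).le)]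
      exact mul_le_of_le_one_left (Real.exp_pos _).le (hη2 t).2
  have hupper : ∫ t in Set.Ioi (0 : ℝ), η (M * t) ^ 2 * Real.exp (-(2 * N * t)) ≤ 1 / (2 * N) := by
    have := setIntegral_mono hint (hexp 0) fun t =>
      mul_le_of_le_one_left (Real.exp_pos _).le (hη2 t).2
    rw [hval 0] at this
    simpa using this
  -- The cutoff equals 1 for 0 < t ≤ 1/(2M), and the exponential beyond that interval is lost at a
  -- cost of e^{-N/M}.
  have hlower : (1 - Real.exp (-(N / M))) / (2 * N) ≤
      ∫ t in Set.Ioi (0 : ℝ), η (M * t) ^ 2 * Real.exp (-(2 * N * t)) := by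
    have h1 : (1 - Real.exp (-(N / M))) / (2 * N) =
        ∫ t in Set.Ioc (0 : ℝ) (1 / (2 * M)), Real.exp (-(2 * N * t)) := by
      have h2 := setIntegral_union (Set.Ioc_disjoint_Ioi_same (a := (0 : ℝ)) (b := 1 / (2 * M)))
        measurableSet_Ioi ((hexp 0).mono_set Set.Ioc_subset_Ioi_self) (hexp (1 / (2 * M)))
      rw [Set.Ioc_union_Ioi_eq_Ioi (by positivity), hval, hval] at h2
      have h3 : 2 * N * (1 / (2 * M)) = N / M := by field_simp
      rw [h3, mul_zero, neg_zero, Real.exp_zero] at h2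
      rw [sub_div]
      linarith
    rw [h1]
    calc ∫ t in Set.Ioc (0 : ℝ) (1 / (2 * M)), Real.exp (-(2 * N * t))
        = ∫ t in Set.Ioc (0 : ℝ) (1 / (2 * M)), η (M * t) ^ 2 * Real.exp (-(2 * N * t)) := by
          refine setIntegral_congr_fun measurableSet_Ioc fun t ht => ?_
          have : η (M * t) = 1 := by
            refine hη.eq_one _ ?_
            rw [abs_of_pos (mul_pos hM ht.1)]
            have := mul_le_mul_of_nonneg_left ht.2 hM.le
            refine this.trans_eq ?_
            field_simp
          simp [this]
      _ ≤ _ := setIntegral_mono_set hint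
          (Eventually.of_forall fun t => mul_nonneg (hη2 t).1 (Real.exp_pos _).le)
          (Eventually.of_forall Set.Ioc_subset_Ioi_self)
  -- From e^s ≥ 1 + s; the relative error M/N is all that is needed.
  have hexp1 : Real.exp (-(N / M)) ≤ M / N := by
    rw [Real.exp_neg, ← inv_div N M]
    have h1 : 0 < N / M := by positivity
    have h2 := Real.add_one_le_exp (N / M)
    exact inv_anti₀ h1 (by linarith)
  rw [abs_le]
  rw [le_div_iff₀ h2N] at hupper
  rw [div_le_iff₀ h2N] at hlower
  have : 0 < M / N := by positivity
  constructor <;> nlinarith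

theorem integral_cutoff_norm_scale (η : ℝ → ℝ) {M : ℝ} (hM : 0 < M) :
    ∫ x : EuclideanSpace ℝ (Fin (d - 1)), η (M * ‖x‖) ^ 2 =
      (M⁻¹) ^ (d - 1) * ∫ x : EuclideanSpace ℝ (Fin (d - 1)), η ‖x‖ ^ 2 := by
  have := Measure.integral_comp_smul (volume : Measure (EuclideanSpace ℝ (Fin (d - 1))))
    (fun x => η ‖x‖ ^ 2) M
  simp only [norm_smul, Real.norm_eq_abs, abs_of_pos hM, finrank_euclideanSpace_fin] at this
  rw [this, smul_eq_mul, abs_of_pos (by positivity), inv_pow]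

theorem integral_halfSpace_cutoff_sq (η : ℝ → ℝ) {M N : ℝ} (hM : 0 < M) :
    ∫ x in halfSpace d, cutoff η M x ^ 2 * Real.exp (-(2 * N * x.2)) =
      (M⁻¹) ^ (d - 1) * (∫ x : EuclideanSpace ℝ (Fin (d - 1)), η ‖x‖ ^ 2) *
        ∫ t in Set.Ioi (0 : ℝ), η (M * t) ^ 2 * Real.exp (-(2 * N * t)) := by
  rw [← integral_cutoff_norm_scale η hM, halfSpace, Measure.volume_eq_prod,
    ← Measure.prod_restrict, Measure.restrict_univ, ← integral_prod_mul]
  refine integral_congr_ae (Eventually.of_forall fun x => ?_)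
  simp only [cutoff]
  ring

/-! ### Transfer of integrals over D to the half-space. -/

namespace BoundaryChart

variable {D : Set (EuclideanSpace ℝ (Fin d))} {θ : ℝ} {P : EuclideanSpace ℝ (Fin d)} {M : ℝ}

theorem mem_ball_of_straighten_mem_box (κ : BoundaryChart D θ P) (hP : P ∈ frontier D)
    (hr : (2 + κ.bound) * M⁻¹ < κ.radius) {y : EuclideanSpace ℝ (Fin d)}
    (hy : κ.straighten y ∈ box d M) : y ∈ Metric.ball P κ.radius := by
  rw [Metric.mem_ball, dist_eq_norm]
  refine (κ.norm_sub_le_of_straighten hP y).trans_lt (lt_of_le_of_lt ?_ hr)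
  have h1 := mul_le_mul_of_nonneg_left hy.1 (by linarith [κ.bound_nonneg] : 0 ≤ 1 + κ.bound)
  linarith [hy.2]

theorem mem_iff_of_straighten_mem_box (κ : BoundaryChart D θ P) (hP : P ∈ frontier D)
    (hr : (2 + κ.bound) * M⁻¹ < κ.radius) {y : EuclideanSpace ℝ (Fin d)}
    (hy : κ.straighten y ∈ box d M) : y ∈ D ↔ κ.straighten y ∈ halfSpace d := by
  rw [κ.mem_iff_straighten (κ.mem_ball_of_straighten_mem_box hP hr hy), mem_halfSpace]

/-- On the box, D and the half-space correspond exactly because the box lies in the chart ball; off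
the box the integrand vanishes, so the shape of D elsewhere is irrelevant. -/
theorem indicator_straighten (κ : BoundaryChart D θ P) (hP : P ∈ frontier D)
    (hr : (2 + κ.bound) * M⁻¹ < κ.radius) {F : Type*} [Zero F] {Φ : FlatCoord d → F}
    (hΦ : ∀ x, x ∉ box d M → Φ x = 0) (y : EuclideanSpace ℝ (Fin d)) :
    D.indicator (fun y => Φ (κ.straighten y)) y =
      (κ.straighten ⁻¹' halfSpace d).indicator (fun y => Φ (κ.straighten y)) y := by
  classical
  simp only [Set.indicator_apply, Set.mem_preimage]
  by_cases hy : κ.straighten y ∈ box d M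
  · simp only [κ.mem_iff_of_straighten_mem_box hP hr hy]
  · simp only [hΦ _ hy, ite_self]

theorem setIntegral_straighten (κ : BoundaryChart D θ P) (hDopen : IsOpen D)
    (hP : P ∈ frontier D) (hr : (2 + κ.bound) * M⁻¹ < κ.radius) {F : Type*}
    [NormedAddCommGroup F] [NormedSpace ℝ F] {Φ : FlatCoord d → F}
    (hΦ : ∀ x, x ∉ box d M → Φ x = 0) :
    ∫ y in D, Φ (κ.straighten y) = ∫ x in halfSpace d, Φ x := by
  rw [← κ.measurePreserving_straighten.setIntegral_preimage_emb κ.straighten.measurableEmbedding,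
    ← integral_indicator hDopen.measurableSet,
    ← integral_indicator (κ.straighten.measurable measurableSet_halfSpace)]
  exact congrArg _ (funext (κ.indicator_straighten hP hr hΦ))

theorem setLIntegral_straighten (κ : BoundaryChart D θ P) (hDopen : IsOpen D)
    (hP : P ∈ frontier D) (hr : (2 + κ.bound) * M⁻¹ < κ.radius) {Φ : FlatCoord d → ENNReal}
    (hΦ : ∀ x, x ∉ box d M → Φ x = 0) :
    ∫⁻ y in D, Φ (κ.straighten y) = ∫⁻ x in halfSpace d, Φ x := by
  rw [← κ.measurePreserving_straighten.setLIntegral_comp_preimage_emb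
    κ.straighten.measurableEmbedding,
    ← lintegral_indicator hDopen.measurableSet,
    ← lintegral_indicator (κ.straighten.measurable measurableSet_halfSpace)]
  exact congrArg _ (funext (κ.indicator_straighten hP hr hΦ))

end BoundaryChart

end HalfSpace


/-! ### Pointwise approximation of the gradient of the boundary data -/

namespace BoundaryChart

section Fields

variable {d : ℕ} {D : Set (EuclideanSpace ℝ (Fin d))} {θ : ℝ} {P : EuclideanSpace ℝ (Fin d)}

theorem norm_slope_le (κ : BoundaryChart D θ P) : ‖κ.slope‖ ≤ κ.bound := κ.norm_gradient_le _

theorem norm_jacT_vertical_sq (κ : BoundaryChart D θ P) :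
    ‖κ.jacT (WithLp.toLp 2 (0, 1))‖ ^ 2 = 1 + ‖κ.slope‖ ^ 2 := by
  rw [WithLp.prod_norm_sq_eq_of_L2]
  change ‖(0 : EuclideanSpace ℝ (Fin (d - 1))) - (1 : ℝ) • κ.slope‖ ^ 2 + ‖(1 : ℝ)‖ ^ 2 = _
  simp
  ring

theorem IsAdmissible.norm_jacT_sq {κ : BoundaryChart D θ P} {ξ : Coord d}
    (hξ : κ.IsAdmissible ξ) : ‖κ.jacT ξ‖ ^ 2 = 1 + ‖κ.slope‖ ^ 2 := by
  rw [← norm_jacT_vertical_sq, ← real_inner_self_eq_norm_sq, ← real_inner_self_eq_norm_sq]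
  exact hξ.1

theorem norm_le_of_sq_eq {κ : BoundaryChart D θ P} {c : Coord d}
    (hc : ‖c‖ ^ 2 = 1 + ‖κ.slope‖ ^ 2) : ‖c‖ ≤ 1 + κ.bound := by
  have h := κ.norm_slope_le
  have hb := κ.bound_nonneg
  refine le_of_sq_le_sq ?_ (by linarith)
  rw [hc]
  nlinarith [norm_nonneg κ.slope]

theorem IsAdmissible.abs_snd_le {κ : BoundaryChart D θ P} {ξ : Coord d}
    (hξ : κ.IsAdmissible ξ) : |ξ.snd| ≤ 1 + κ.bound :=
  (Coord.abs_snd_le (κ.jacT ξ)).trans (norm_le_of_sq_eq hξ.norm_jacT_sq)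

theorem phase_dflat_sub (κ : BoundaryChart D θ P) (ξ : Coord d)
    (s t : EuclideanSpace ℝ (Fin (d - 1))) (w : EuclideanSpace ℝ (Fin d)) :
    phase ξ (κ.dflat s w) - phase ξ (κ.dflat t w) =
      ((inner ℝ (s - t) (κ.coord.linearIsometryEquiv w).fst : ℝ) : ℂ) *
        (1 - Complex.I * ((ξ.snd : ℝ) : ℂ)) := by
  simp only [phase_apply, dflat_apply, inner_sub_left]
  push_cast
  ring

theorem phase_dflat_slope (κ : BoundaryChart D θ P) (ξ : Coord d)
    (w : EuclideanSpace ℝ (Fin d)) :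
    phase ξ (κ.dflat κ.slope w) =
      Complex.I * ((inner ℝ (κ.jacT ξ) (κ.coord.linearIsometryEquiv w) : ℝ) : ℂ) -
        ((inner ℝ (κ.jacT (WithLp.toLp 2 (0, 1))) (κ.coord.linearIsometryEquiv w) : ℝ) : ℂ) := by
  simp only [phase_apply, dflat_apply, jacT, WithLp.prod_inner_apply,
    inner_sub_left, inner_smul_left]
  simp only [RCLike.inner_apply, conj_trivial, WithLp.fst, WithLp.snd, inner_zero_left]
  push_cast
  ring

theorem phase_dflat_slope_single (κ : BoundaryChart D θ P) (ξ : Coord d) (i : Fin d) :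
    phase ξ (κ.dflat κ.slope (EuclideanSpace.single i 1)) =
      Complex.I * ((κ.coord.linearIsometryEquiv.symm (κ.jacT ξ) i : ℝ) : ℂ) -
        ((κ.coord.linearIsometryEquiv.symm (κ.jacT (WithLp.toLp 2 (0, 1))) i : ℝ) : ℂ) := by
  have h : ∀ c : Coord d,
      inner ℝ c (κ.coord.linearIsometryEquiv (EuclideanSpace.single i (1 : ℝ))) =
        κ.coord.linearIsometryEquiv.symm c i := by
    intro c
    rw [← κ.coord.linearIsometryEquiv.symm.inner_map_map, LinearIsometryEquiv.symm_apply_apply,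
      EuclideanSpace.inner_single_right]
    simp
  rw [phase_dflat_slope, h, h]

theorem norm_sq_I_mul_sub (a b : ℝ) : ‖Complex.I * (a : ℂ) - (b : ℂ)‖ ^ 2 = a ^ 2 + b ^ 2 := by
  rw [Complex.sq_norm, Complex.normSq_apply]
  simp
  ring

theorem norm_I_mul_sub_le (a b : ℝ) : ‖Complex.I * (a : ℂ) - (b : ℂ)‖ ≤ |a| + |b| := by
  refine (norm_sub_le _ _).trans ?_
  simp

/-- Real and imaginary part of the covector are rotated copies of Bᵗe_d and Bᵗξ, up to sign, and
both have squared length 1 + |s|² by admissibility. This is the origin of the factor 1 + |∇φ|² in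
C_P; the factor 2 cancels against ∫ e^{-2Nt} dt = 1/(2N). -/
theorem sum_norm_phase_sq (κ : BoundaryChart D θ P) {ξ : Coord d} (hξ : κ.IsAdmissible ξ) :
    ∑ i, ‖phase ξ (κ.dflat κ.slope (EuclideanSpace.single i 1))‖ ^ 2 =
      2 * (1 + ‖κ.slope‖ ^ 2) := by
  simp only [phase_dflat_slope_single, norm_sq_I_mul_sub]
  have h : ∀ c : Coord d, ∑ i, (κ.coord.linearIsometryEquiv.symm c i) ^ 2 = ‖c‖ ^ 2 := by
    intro c
    rw [← κ.coord.linearIsometryEquiv.symm.norm_map c, EuclideanSpace.norm_sq_eq]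
    simp
  rw [Finset.sum_add_distrib, h, h, hξ.norm_jacT_sq, norm_jacT_vertical_sq]
  ring

theorem norm_phase_dflat_le (κ : BoundaryChart D θ P) {ξ : Coord d} (hξ : κ.IsAdmissible ξ)
    (i : Fin d) :
    ‖phase ξ (κ.dflat κ.slope (EuclideanSpace.single i 1))‖ ≤ 2 * (1 + κ.bound) := by
  have h : ∀ c : Coord d, ‖c‖ ^ 2 = 1 + ‖κ.slope‖ ^ 2 →
      |κ.coord.linearIsometryEquiv.symm c i| ≤ 1 + κ.bound := fun c hc =>
    (PiLp.norm_apply_le (κ.coord.linearIsometryEquiv.symm c) i).trans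
      ((κ.coord.linearIsometryEquiv.symm.norm_map c).trans_le (norm_le_of_sq_eq hc))
  rw [phase_dflat_slope_single]
  refine (norm_I_mul_sub_le _ _).trans ?_
  have h1 := h _ hξ.norm_jacT_sq
  have h2 := h _ κ.norm_jacT_vertical_sq
  linarith

/-- The vector `A c` for the matrix `A` at `P`, where `c = Bᵗ ξ`. -/
def imageA (κ : BoundaryChart D θ P) (c : Coord d) : FlatCoord d :=
  κ.dflat κ.slope (κ.coord.linearIsometryEquiv.symm c)

theorem imageA_eq (κ : BoundaryChart D θ P) (c : Coord d) :
    κ.imageA c = (c.fst, c.snd - inner ℝ κ.slope c.fst) := by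
  rw [imageA, dflat_apply, LinearIsometryEquiv.apply_symm_apply]

theorem norm_dflat_le (κ : BoundaryChart D θ P) {s : EuclideanSpace ℝ (Fin (d - 1))}
    (hs : ‖s‖ ≤ κ.bound) (w : EuclideanSpace ℝ (Fin d)) :
    ‖κ.dflat s w‖ ≤ (1 + κ.bound) * ‖w‖ := by
  rw [dflat_apply, Prod.norm_def]
  have h0 := κ.coord.linearIsometryEquiv.norm_map w
  have h1 := Coord.norm_fst_le (κ.coord.linearIsometryEquiv w)
  have h2 := Coord.abs_snd_le (κ.coord.linearIsometryEquiv w)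
  have h3 := abs_real_inner_le_norm s (κ.coord.linearIsometryEquiv w).fst
  rw [h0] at h1 h2
  have h4 : ‖s‖ * ‖(κ.coord.linearIsometryEquiv w).fst‖ ≤ κ.bound * ‖w‖ :=
    mul_le_mul hs h1 (norm_nonneg _) κ.bound_nonneg
  have hb := mul_nonneg κ.bound_nonneg (norm_nonneg w)
  refine max_le (by simp only; linarith) ?_
  rw [Real.norm_eq_abs]
  refine (abs_sub _ _).trans ?_
  linarith

theorem norm_imageA_le (κ : BoundaryChart D θ P) {c : Coord d}
    (hc : ‖c‖ ^ 2 = 1 + ‖κ.slope‖ ^ 2) : ‖κ.imageA c‖ ≤ (1 + κ.bound) ^ 2 := by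
  refine (κ.norm_dflat_le κ.norm_slope_le _).trans ?_
  rw [LinearIsometryEquiv.norm_map, sq]
  have := norm_le_of_sq_eq hc
  have hb := κ.bound_nonneg
  gcongr

theorem phase_imageA (κ : BoundaryChart D θ P) (ξ : Coord d) (c : Coord d) :
    phase ξ (κ.imageA c) = Complex.I * ((inner ℝ (κ.jacT ξ) c : ℝ) : ℂ) -
      ((inner ℝ (κ.jacT (WithLp.toLp 2 (0, 1))) c : ℝ) : ℂ) := by
  rw [imageA, phase_dflat_slope, LinearIsometryEquiv.apply_symm_apply]

/-- The complex vector `iξ - e_d` is null for the bilinear form of the matrix `A`. -/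
theorem IsAdmissible.phase_null {κ : BoundaryChart D θ P} {ξ : Coord d}
    (hξ : κ.IsAdmissible ξ) :
    Complex.I * phase ξ (κ.imageA (κ.jacT ξ)) -
      phase ξ (κ.imageA (κ.jacT (WithLp.toLp 2 (0, 1)))) = 0 := by
  have h1 := hξ.1
  have h2 := hξ.2
  simp only [formA] at h1 h2
  have h3 : inner ℝ (κ.jacT (WithLp.toLp 2 (0, 1))) (κ.jacT ξ) = 0 := by
    rw [real_inner_comm]
    exact h2
  rw [phase_imageA, phase_imageA, h2, h3, ← h1, Complex.ofReal_zero, mul_zero, sub_zero, zero_sub,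
    ← mul_assoc, Complex.I_mul_I]
  ring

/-- Since A = BBᵗ, undoing the flattening at P turns A ξ back into c = Bᵗξ; at another point only
the change of slope remains, in the vertical direction. Hence the null field agrees with the leading
field up to the oscillation of the slope. -/
theorem dunflat_imageA (κ : BoundaryChart D θ P) (s : EuclideanSpace ℝ (Fin (d - 1)))
    (c : Coord d) :
    κ.dunflat s (κ.imageA c) = κ.coord.linearIsometryEquiv.symm c +
      inner ℝ (s - κ.slope) c.fst • κ.coord.linearIsometryEquiv.symm (WithLp.toLp 2 (0, 1)) := by
  rw [imageA_eq, dunflat_apply, ← map_smul, ← map_add]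
  congr 1
  have : c = WithLp.toLp 2 (c.fst, c.snd) := rfl
  conv_rhs => rw [this]
  rw [← WithLp.toLp_smul, ← WithLp.toLp_add]
  congr 1
  ext1
  · simp
  · simp [inner_sub_left]
    ring

/-- The slope of the boundary over the point `y`. -/
def slopeAt (κ : BoundaryChart D θ P) (y : EuclideanSpace ℝ (Fin d)) :
    EuclideanSpace ℝ (Fin (d - 1)) :=
  gradient κ.φ (κ.coord y).fst

theorem norm_slopeAt_sub_le (κ : BoundaryChart D θ P) (hθ : 0 ≤ θ) {M : ℝ}
    {y : EuclideanSpace ℝ (Fin d)} (hy : κ.straighten y ∈ box d M) :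
    ‖κ.slopeAt y - κ.slope‖ ≤ κ.bound * (M⁻¹) ^ θ := by
  refine (κ.holder_gradient _ _).trans ?_
  have := κ.bound_nonneg
  have h : ‖(κ.coord y).fst - (κ.coord P).fst‖ ≤ M⁻¹ := hy.1
  gcongr

/-- The oscillating factor `k η(M|x'|) η(M x_d) e^{N (iξ - e_d) · x}` of the leading part. -/
def amplitude (κ : BoundaryChart D θ P) (η : ℝ → ℝ) (k M N : ℝ) (ξ : Coord d)
    (y : EuclideanSpace ℝ (Fin d)) : ℂ :=
  (k : ℂ) * wave η M N ξ (κ.straighten y)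

/-- The leading part of the gradient of the boundary data. -/
def leadField (κ : BoundaryChart D θ P) (η : ℝ → ℝ) (k M N : ℝ) (ξ : Coord d) (i : Fin d)
    (y : EuclideanSpace ℝ (Fin d)) : ℂ :=
  κ.amplitude η k M N ξ y * phase ξ (κ.dflat κ.slope (EuclideanSpace.single i 1))

/-- An approximation of the leading part whose divergence is small: in flat coordinates it is a
scalar multiple of a constant vector. -/
def nullField (κ : BoundaryChart D θ P) (η : ℝ → ℝ) (k M N : ℝ) (ξ : Coord d) (i : Fin d)
    (y : EuclideanSpace ℝ (Fin d)) : ℂ :=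
  κ.amplitude η k M N ξ y *
    (Complex.I * ((κ.dunflat (κ.slopeAt y) (κ.imageA (κ.jacT ξ)) i : ℝ) : ℂ) -
      ((κ.dunflat (κ.slopeAt y) (κ.imageA (κ.jacT (WithLp.toLp 2 (0, 1)))) i : ℝ) : ℂ))

variable {η : ℝ → ℝ} {k M N : ℝ}

theorem norm_amplitude_le (κ : BoundaryChart D θ P) (hη : IsCutoff η) (hk : 0 ≤ k) (hM : 0 < M)
    (ξ : Coord d) (y : EuclideanSpace ℝ (Fin d)) :
    ‖κ.amplitude η k M N ξ y‖ ≤ weight d k N M (κ.straighten y) := by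
  rw [amplitude, wave, norm_mul, norm_mul, norm_exp_phase, Complex.norm_real, Complex.norm_real,
    Real.norm_eq_abs, Real.norm_eq_abs, abs_of_nonneg hk, abs_of_nonneg (cutoff_nonneg hη _)]
  by_cases hy : κ.straighten y ∈ box d M
  · rw [weight, Set.indicator_of_mem hy]
    have := mul_le_of_le_one_left (Real.exp_pos (-(N * (κ.straighten y).2))).le
      (cutoff_le_one (M := M) hη (κ.straighten y))
    gcongr
  · rw [cutoff_eq_zero hη hM hy, zero_mul, mul_zero]
    exact weight_nonneg hk _

theorem amplitude_eq_zero (κ : BoundaryChart D θ P) (hη : IsCutoff η) (hM : 0 < M)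
    (ξ : Coord d) {y : EuclideanSpace ℝ (Fin d)} (hy : κ.straighten y ∉ box d M) :
    κ.amplitude η k M N ξ y = 0 := by
  simp [amplitude, wave, cutoff_eq_zero hη hM hy]

theorem norm_leadField_le (κ : BoundaryChart D θ P) (hη : IsCutoff η) (hk : 0 ≤ k) (hM : 0 < M)
    {ξ : Coord d} (hξ : κ.IsAdmissible ξ) (i : Fin d) (y : EuclideanSpace ℝ (Fin d)) :
    ‖κ.leadField η k M N ξ i y‖ ≤ 2 * (1 + κ.bound) * weight d k N M (κ.straighten y) := by
  rw [leadField, norm_mul, mul_comm]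
  have h1 := κ.norm_phase_dflat_le hξ i
  have h2 := κ.norm_amplitude_le (N := N) hη hk hM ξ y
  have hb := κ.bound_nonneg
  gcongr

/-- The Hölder condition for ∇φ on a box of size 1/M provides the factor M^{-θ}. -/
theorem norm_nullField_sub_le (κ : BoundaryChart D θ P) (hθ : 0 ≤ θ) (hη : IsCutoff η)
    (hk : 0 ≤ k) (hM : 0 < M) {ξ : Coord d} (hξ : κ.IsAdmissible ξ) (i : Fin d)
    (y : EuclideanSpace ℝ (Fin d)) :
    ‖κ.nullField η k M N ξ i y - κ.leadField η k M N ξ i y‖ ≤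
      2 * (1 + κ.bound) * κ.bound * (M⁻¹) ^ θ * weight d k N M (κ.straighten y) := by
  by_cases hy : κ.straighten y ∈ box d M
  swap
  · rw [nullField, leadField, κ.amplitude_eq_zero hη hM ξ hy]
    simp only [zero_mul, sub_zero, norm_zero]
    have := weight_nonneg (d := d) (N := N) (M := M) hk (κ.straighten y)
    have hb := κ.bound_nonneg
    positivity
  rw [nullField, leadField, ← mul_sub, norm_mul, mul_comm]
  have h2 := κ.norm_amplitude_le (N := N) hη hk hM ξ y
  have hs := κ.norm_slopeAt_sub_le hθ hy
  have hb := κ.bound_nonneg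
  refine mul_le_mul ?_ h2 (norm_nonneg _) (by positivity)
  rw [phase_dflat_slope_single]
  set σ := κ.slopeAt y - κ.slope
  have hv : |κ.coord.linearIsometryEquiv.symm (WithLp.toLp 2 (0, 1)) i| ≤ 1 := by
    refine (PiLp.norm_apply_le (κ.coord.linearIsometryEquiv.symm (WithLp.toLp 2 (0, 1))) i).trans ?_
    rw [LinearIsometryEquiv.norm_map]
    refine (Coord.norm_le_add _).trans ?_
    simp
  have hc : ∀ c : Coord d, ‖c‖ ^ 2 = 1 + ‖κ.slope‖ ^ 2 →
      |(κ.dunflat (κ.slopeAt y) (κ.imageA c)) i - κ.coord.linearIsometryEquiv.symm c i| ≤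
        (κ.bound * (M⁻¹) ^ θ) * (1 + κ.bound) := by
    intro c hc
    rw [dunflat_imageA, PiLp.add_apply, add_sub_cancel_left, PiLp.smul_apply, smul_eq_mul, abs_mul]
    have h3 := abs_real_inner_le_norm σ c.fst
    have h4 := (Coord.norm_fst_le c).trans (norm_le_of_sq_eq hc)
    calc |inner ℝ σ c.fst| * |κ.coord.linearIsometryEquiv.symm (WithLp.toLp 2 (0, 1)) i|
        ≤ ‖σ‖ * ‖c.fst‖ * 1 := by gcongr
      _ ≤ _ := by rw [mul_one]; gcongr
  have h5 := hc _ hξ.norm_jacT_sq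
  have h6 := hc _ κ.norm_jacT_vertical_sq
  have h7 : ∀ a b a' b' : ℝ, Complex.I * (a : ℂ) - (b : ℂ) - (Complex.I * (a' : ℂ) - (b' : ℂ)) =
      Complex.I * ((a - a' : ℝ) : ℂ) - ((b - b' : ℝ) : ℂ) := by
    intro a b a' b'
    push_cast
    ring
  rw [h7]
  refine (norm_I_mul_sub_le _ _).trans ?_
  linarith

theorem partialDeriv_amplitude (κ : BoundaryChart D θ P) (hη : IsCutoff η) (k₀ : ℝ)
    (ξ : Coord d) (i : Fin d) (y : EuclideanSpace ℝ (Fin d)) :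
    partialDeriv i (κ.amplitude η k₀ M N ξ) y =
      (k₀ : ℂ) * (Complex.exp ((N : ℂ) * phase ξ (κ.straighten y)) *
      (((fderiv ℝ (cutoff η M) (κ.straighten y)
          (κ.dflat (κ.slopeAt y) (EuclideanSpace.single i 1)) : ℝ) : ℂ) +
        N * ((cutoff η M (κ.straighten y) : ℝ) : ℂ) *
          phase ξ (κ.dflat (κ.slopeAt y) (EuclideanSpace.single i 1)))) := by
  have h1 := (((contDiff_wave (M := M) hη N ξ).differentiable one_ne_zero
    (κ.straighten y)).hasFDerivAt.comp y (κ.hasFDerivAt_straighten y)).const_mul (k₀ : ℂ)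
  have h2 : fderiv ℝ (κ.amplitude η k₀ M N ξ) y = _ := h1.fderiv
  rw [partialDeriv, h2, ← fderiv_wave_apply hη]
  rfl

/-- Two errors occur, relative to the factor N that the exponential produces: differentiating the
cutoff costs M, hence M/N, and freezing the slope at P costs M^{-θ}. -/
theorem norm_partialDeriv_sub_leadField_le (κ : BoundaryChart D θ P) (hθ : 0 ≤ θ)
    (hη : IsCutoff η) {E : NNReal} (hE : LipschitzWith E η) {k₀ : ℝ} (hk : 0 ≤ k₀)
    (hM : 0 < M) (hN : 0 < N) {ξ : Coord d} (hξ : κ.IsAdmissible ξ) (i : Fin d)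
    (y : EuclideanSpace ℝ (Fin d)) :
    ‖partialDeriv i (κ.amplitude η k₀ M N ξ) y - κ.leadField η (k₀ * N) M N ξ i y‖ ≤
      (2 * E * (1 + κ.bound) * (M / N) + (2 + κ.bound) * κ.bound * (M⁻¹) ^ θ) *
        weight d (k₀ * N) N M (κ.straighten y) := by
  rw [partialDeriv_amplitude κ hη]
  set x := κ.straighten y
  set w : EuclideanSpace ℝ (Fin d) := EuclideanSpace.single i 1
  have hw : ‖w‖ = 1 := by simp [w]
  have hb := κ.bound_nonneg
  by_cases hy : x ∈ box d M
  swap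
  · have h0 : weight d (k₀ * N) N M x = 0 := Set.indicator_of_notMem hy _
    rw [leadField, κ.amplitude_eq_zero hη hM ξ hy, cutoff_eq_zero hη hM hy,
      fderiv_cutoff_eq_zero hη hM hy, h0]
    simp
  have hsplit : (k₀ : ℂ) * (Complex.exp ((N : ℂ) * phase ξ x) *
      (((fderiv ℝ (cutoff η M) x (κ.dflat (κ.slopeAt y) w) : ℝ) : ℂ) +
        N * ((cutoff η M x : ℝ) : ℂ) * phase ξ (κ.dflat (κ.slopeAt y) w))) -
      κ.leadField η (k₀ * N) M N ξ i y =
      (k₀ : ℂ) * Complex.exp ((N : ℂ) * phase ξ x) *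
        (((fderiv ℝ (cutoff η M) x (κ.dflat (κ.slopeAt y) w) : ℝ) : ℂ) +
          N * ((cutoff η M x : ℝ) : ℂ) *
            (phase ξ (κ.dflat (κ.slopeAt y) w) - phase ξ (κ.dflat κ.slope w))) := by
    rw [leadField, amplitude, wave]
    push_cast
    ring
  have hdist : ‖phase ξ (κ.dflat (κ.slopeAt y) w) - phase ξ (κ.dflat κ.slope w)‖ ≤
      (2 + κ.bound) * κ.bound * (M⁻¹) ^ θ := by
    rw [phase_dflat_sub, norm_mul, Complex.norm_real, Real.norm_eq_abs]
    have h1 := (abs_real_inner_le_norm (κ.slopeAt y - κ.slope)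
      (κ.coord.linearIsometryEquiv w).fst)
    have h2 := Coord.norm_fst_le (κ.coord.linearIsometryEquiv w)
    rw [LinearIsometryEquiv.norm_map, hw] at h2
    have h3 : ‖(1 : ℂ) - Complex.I * ((ξ.snd : ℝ) : ℂ)‖ ≤ 2 + κ.bound := by
      refine (norm_sub_le _ _).trans ?_
      have := hξ.abs_snd_le
      simp only [norm_one, norm_mul, Complex.norm_I, one_mul, Complex.norm_real, Real.norm_eq_abs]
      linarith
    have h4 := κ.norm_slopeAt_sub_le hθ hy
    calc |inner ℝ (κ.slopeAt y - κ.slope) (κ.coord.linearIsometryEquiv w).fst| *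
          ‖(1 : ℂ) - Complex.I * ((ξ.snd : ℝ) : ℂ)‖
        ≤ (‖κ.slopeAt y - κ.slope‖ * ‖(κ.coord.linearIsometryEquiv w).fst‖) *
          (2 + κ.bound) := by gcongr
      _ ≤ (κ.bound * (M⁻¹) ^ θ * 1) * (2 + κ.bound) := by gcongr
      _ = _ := by ring
  have hder : |fderiv ℝ (cutoff η M) x (κ.dflat (κ.slopeAt y) w)| ≤
      2 * E * M * (1 + κ.bound) := by
    have h1 := (fderiv ℝ (cutoff η M) x).le_opNorm (κ.dflat (κ.slopeAt y) w)
    have h2 := norm_fderiv_cutoff_le hη hE hM.le x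
    have h3 := κ.norm_dflat_le (κ.norm_gradient_le (κ.coord y).fst) w
    rw [hw, mul_one] at h3
    calc _ ≤ ‖fderiv ℝ (cutoff η M) x‖ * ‖κ.dflat (κ.slopeAt y) w‖ := h1
      _ ≤ _ := mul_le_mul h2 h3 (norm_nonneg _) (by positivity)
  rw [hsplit, norm_mul, norm_mul, norm_exp_phase, Complex.norm_real, Real.norm_eq_abs,
    abs_of_nonneg hk, weight, Set.indicator_of_mem hy]
  have hsum : ‖((fderiv ℝ (cutoff η M) x (κ.dflat (κ.slopeAt y) w) : ℝ) : ℂ) +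
      N * ((cutoff η M x : ℝ) : ℂ) *
        (phase ξ (κ.dflat (κ.slopeAt y) w) - phase ξ (κ.dflat κ.slope w))‖ ≤
      2 * E * M * (1 + κ.bound) + N * ((2 + κ.bound) * κ.bound * (M⁻¹) ^ θ) := by
    refine (norm_add_le _ _).trans (add_le_add ?_ ?_)
    · rwa [Complex.norm_real, Real.norm_eq_abs]
    · rw [norm_mul, norm_mul, Complex.norm_real, Complex.norm_real, Real.norm_eq_abs,
        Real.norm_eq_abs, abs_of_pos hN, abs_of_nonneg (cutoff_nonneg hη x), mul_assoc]
      exact mul_le_mul_of_nonneg_left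
        ((mul_le_of_le_one_left (norm_nonneg _) (cutoff_le_one hη x)).trans hdist) hN.le
  calc k₀ * Real.exp (-(N * x.2)) * _
      ≤ k₀ * Real.exp (-(N * x.2)) *
        (2 * E * M * (1 + κ.bound) + N * ((2 + κ.bound) * κ.bound * (M⁻¹) ^ θ)) := by gcongr
    _ = _ := by
      field_simp

end Fields

end BoundaryChart


/-! ### The almost divergence-free field -/

theorem lintegral_enorm_mul_le_eLpNorm {X F : Type*} [MeasurableSpace X] [NormedAddCommGroup F]
    [NormedSpace ℝ F] {μ : Measure X} {w : X → ℝ} {f : X → F} (hw : AEStronglyMeasurable w μ)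
    (hf : AEStronglyMeasurable f μ) :
    ∫⁻ x, ‖w x‖ₑ * ‖f x‖ₑ ∂μ ≤ eLpNorm w 2 μ * eLpNorm f 2 μ := by
  have h := eLpNorm_smul_le_mul_eLpNorm (p := 2) (q := 2) (r := 1) hf hw
  rw [eLpNorm_one_eq_lintegral_enorm] at h
  refine (lintegral_congr fun x => ?_).trans_le h
  rw [Pi.smul_apply', enorm_smul]

/-- A crude bound, since x_d ≥ -1/M on the box. It needs no chart around the box, so it also serves
the small values of N. -/
theorem weight_le {d : ℕ} {k M N : ℝ} (hk : 0 ≤ k) (hN : 0 ≤ N) (x : FlatCoord d) :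
    weight d k N M x ≤ k * Real.exp (N * M⁻¹) := by
  by_cases hx : x ∈ box d M
  · rw [weight, Set.indicator_of_mem hx]
    have := (abs_le.mp hx.2).1
    gcongr
    nlinarith
  · rw [weight, Set.indicator_of_notMem hx]
    positivity

namespace BoundaryChart

section Divergence

variable {d : ℕ} {D : Set (EuclideanSpace ℝ (Fin d))} {θ : ℝ} {P : EuclideanSpace ℝ (Fin d)}
  {η : ℝ → ℝ} {k M N : ℝ}

/-- In flat coordinates, the null field acts on functions as a constant complex vector field. -/
theorem sum_nullField_mul (κ : BoundaryChart D θ P) (ξ : Coord d)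
    {h : EuclideanSpace ℝ (Fin d) → ℂ} (hh : ContDiff ℝ 1 h) (y : EuclideanSpace ℝ (Fin d)) :
    ∑ i, κ.nullField η k M N ξ i y * partialDeriv i h y =
      (k : ℂ) * (wave η M N ξ (κ.straighten y) *
        (Complex.I * fderiv ℝ (h ∘ κ.straighten.symm) (κ.straighten y) (κ.imageA (κ.jacT ξ)) -
          fderiv ℝ (h ∘ κ.straighten.symm) (κ.straighten y)
            (κ.imageA (κ.jacT (WithLp.toLp 2 (0, 1)))))) := by
  have hψ : ∀ v, fderiv ℝ (h ∘ κ.straighten.symm) (κ.straighten y) v =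
      ∑ i, ((κ.dunflat (κ.slopeAt y) v i : ℝ) : ℂ) * partialDeriv i h y := by
    intro v
    have h1 := κ.hasFDerivAt_straighten_symm (κ.straighten y)
    have h2 := κ.straighten.symm_apply_apply y
    have h3 := (hh.differentiable one_ne_zero (κ.straighten.symm (κ.straighten y))).hasFDerivAt.comp
      _ h1
    rw [h2] at h3
    rw [h3.fderiv, ContinuousLinearMap.comp_apply, fderiv_apply_eq_sum]
    rfl
  rw [hψ, hψ, Finset.mul_sum, ← Finset.sum_sub_distrib, Finset.mul_sum, Finset.mul_sum]
  refine Finset.sum_congr rfl fun i _ => ?_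
  rw [nullField, amplitude]
  ring

theorem wave_mul_fderiv (hη : IsCutoff η) (ξ : Coord d) {ψ : FlatCoord d → ℂ}
    (hψ : ContDiff ℝ 1 ψ) (x v : FlatCoord d) :
    wave η M N ξ x * fderiv ℝ ψ x v = fderiv ℝ (fun x => wave η M N ξ x * ψ x) x v -
      ψ x * (Complex.exp ((N : ℂ) * phase ξ x) *
        (((fderiv ℝ (cutoff η M) x v : ℝ) : ℂ) + N * ((cutoff η M x : ℝ) : ℂ) * phase ξ v)) := by
  have h1 := ((contDiff_wave (M := M) hη N ξ).differentiable one_ne_zero x).hasFDerivAt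
  have h2 := (hψ.differentiable one_ne_zero x).hasFDerivAt
  have h3 : HasFDerivAt (fun x => wave η M N ξ x * ψ x) _ x := h1.mul h2
  rw [← fderiv_wave_apply hη, h3.fderiv]
  simp only [add_apply, smul_apply, smul_eq_mul]
  ring

/-- Product rule: the term with N, in which the exponential is differentiated, contains the
quadratic form of A at iξ - e_d and vanishes by admissibility. What remains is a derivative of a
compactly supported function and a term with the derivative of the cutoff. -/
theorem wave_mul_null (κ : BoundaryChart D θ P) (hη : IsCutoff η) {ξ : Coord d}
    (hξ : κ.IsAdmissible ξ) {ψ : FlatCoord d → ℂ} (hψ : ContDiff ℝ 1 ψ) (x : FlatCoord d) :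
    wave η M N ξ x * (Complex.I * fderiv ℝ ψ x (κ.imageA (κ.jacT ξ)) -
        fderiv ℝ ψ x (κ.imageA (κ.jacT (WithLp.toLp 2 (0, 1))))) =
      (Complex.I * fderiv ℝ (fun x => wave η M N ξ x * ψ x) x (κ.imageA (κ.jacT ξ)) -
        fderiv ℝ (fun x => wave η M N ξ x * ψ x) x (κ.imageA (κ.jacT (WithLp.toLp 2 (0, 1))))) -
      ψ x * Complex.exp ((N : ℂ) * phase ξ x) *
        (Complex.I * ((fderiv ℝ (cutoff η M) x (κ.imageA (κ.jacT ξ)) : ℝ) : ℂ) -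
          ((fderiv ℝ (cutoff η M) x (κ.imageA (κ.jacT (WithLp.toLp 2 (0, 1)))) : ℝ) : ℂ)) := by
  have h1 := wave_mul_fderiv (M := M) (N := N) hη ξ hψ x (κ.imageA (κ.jacT ξ))
  have h2 := wave_mul_fderiv (M := M) (N := N) hη ξ hψ x
    (κ.imageA (κ.jacT (WithLp.toLp 2 (0, 1))))
  have h3 := hξ.phase_null
  linear_combination Complex.I * h1 - h2 -
    ψ x * Complex.exp ((N : ℂ) * phase ξ x) * N * ((cutoff η M x : ℝ) : ℂ) * h3

/-- The flat points (x', 0) over the small ball represent boundary points, and the vertical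
projection does not increase surface measure. -/
theorem lintegral_straighten_boundary_le (κ : BoundaryChart D θ P)
    (hDbdd : Bornology.IsBounded D) (hP : P ∈ frontier D) (hM : 0 < M)
    (hr : (2 + κ.bound) * M⁻¹ < κ.radius) {h : EuclideanSpace ℝ (Fin d) → ℂ}
    (hh : Continuous h) :
    ∫⁻ x' in Metric.closedBall (0 : EuclideanSpace ℝ (Fin (d - 1))) M⁻¹,
        ‖h (κ.straighten.symm (x', 0))‖ₑ ≤ ∫⁻ y, ‖h y‖ₑ ∂(surfaceMeasure D) := by
  obtain ⟨S, hS, hle, hint⟩ := exists_fibre_majorant hDbdd κ hh.norm fun y => norm_nonneg _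
  simp only [ofReal_norm] at hint
  refine le_trans ?_ hint
  -- Flat coordinates are centred at p', so the fibre majorant is translated accordingly.
  rw [← lintegral_add_right_eq_self (fun x => ENNReal.ofReal (S x)) (κ.coord P).fst]
  refine le_trans (setLIntegral_mono' measurableSet_closedBall fun x' hx' => ?_)
    (setLIntegral_le_lintegral _ _)
  have h1 := κ.straighten.apply_symm_apply ((x', 0) : FlatCoord d)
  have hbox : κ.straighten (κ.straighten.symm (x', 0)) ∈ box d M := by
    rw [h1]
    exact ⟨mem_closedBall_zero_iff.mp hx', by simpa using hM.le⟩
  have h2 := (κ.mem_frontier_iff_straighten (κ.mem_ball_of_straighten_mem_box hP hr hbox)).mpr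
    (by rw [h1])
  have h3 := hle _ h2
  have h5 : (κ.coord (κ.straighten.symm (x', 0))).fst = x' + (κ.coord P).fst := by
    have := congrArg Prod.fst h1
    exact sub_eq_iff_eq_add.mp this
  rw [h5] at h3
  rw [← ofReal_norm]
  exact ENNReal.ofReal_le_ofReal h3

/-- The damping inequality on vertical lines trades h for its vertical derivative and a factor 1/N.
This derivative is taken along a unit vector, so it is at most the sum of the |∂_i h|;
Cauchy–Schwarz against the weight finishes. -/
theorem lintegral_weight_mul_straighten_le (κ : BoundaryChart D θ P) (hθ : 0 < θ)
    (hDbdd : Bornology.IsBounded D) (hDopen : IsOpen D) (hP : P ∈ frontier D)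
    (hk : 0 ≤ k) (hM : 0 < M) (hN : 0 < N)
    (hr : (2 + κ.bound) * M⁻¹ < κ.radius) {h : EuclideanSpace ℝ (Fin d) → ℂ}
    (hh : ContDiff ℝ 1 h) :
    ∫⁻ x in halfSpace d, ENNReal.ofReal (weight d k N M x) * ‖h (κ.straighten.symm x)‖ₑ ≤
      ENNReal.ofReal (1 / N) * (ENNReal.ofReal k * (∫⁻ y, ‖h y‖ₑ ∂(surfaceMeasure D)) +
        eLpNorm (fun y => weight d k N M (κ.straighten y)) 2 (volume.restrict D) *
          ∑ i, eLpNorm (partialDeriv i h) 2 (volume.restrict D)) := by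
  set ψ : FlatCoord d → ℂ := h ∘ κ.straighten.symm with hψdef
  have hψ : ContDiff ℝ 1 ψ := hh.comp (κ.contDiff_straighten_symm hθ)
  have hψ' : Continuous fun x => fderiv ℝ ψ x (0, 1) :=
    (hψ.continuous_fderiv one_ne_zero).clm_apply continuous_const
  have hder : ∀ (x : EuclideanSpace ℝ (Fin (d - 1))) (t : ℝ),
      HasDerivAt (fun t => ψ (x, t)) (fderiv ℝ ψ (x, t) (0, 1)) t := by
    intro x t
    have h1 : HasDerivAt (fun t : ℝ => (x, t)) ((0 : EuclideanSpace ℝ (Fin (d - 1))), (1 : ℝ)) t :=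
      (hasDerivAt_const t x).prodMk (hasDerivAt_id t)
    exact (hψ.differentiable one_ne_zero (x, t)).hasFDerivAt.comp_hasDerivAt t h1
  refine (lintegral_weight_mul_le hk hN hder hψ.continuous hψ').trans ?_
  refine mul_le_mul_right (add_le_add (mul_le_mul_right
    (κ.lintegral_straighten_boundary_le hDbdd hP hM hr hh.continuous) _) ?_) _
  rw [← κ.setLIntegral_straighten hDopen hP hr (Φ := fun x =>
    ENNReal.ofReal (weight d k N M x) * ‖fderiv ℝ ψ x (0, 1)‖ₑ)]
  swap
  · intro x hx
    simp [weight, Set.indicator_of_notMem hx]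
  have hmeas : Measurable fun y => weight d k N M (κ.straighten y) :=
    measurable_weight.comp κ.straighten.measurable
  have hpt : ∀ y, ENNReal.ofReal (weight d k N M (κ.straighten y)) *
      ‖fderiv ℝ ψ (κ.straighten y) (0, 1)‖ₑ ≤
      ∑ i, ‖weight d k N M (κ.straighten y)‖ₑ * ‖partialDeriv i h y‖ₑ := by
    intro y
    rw [← Finset.mul_sum, ← ofReal_norm (weight d k N M _), Real.norm_eq_abs,
      abs_of_nonneg (weight_nonneg hk _)]
    gcongr
    have h1 := κ.hasFDerivAt_straighten_symm (κ.straighten y)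
    have h3 := (hh.differentiable one_ne_zero (κ.straighten.symm (κ.straighten y))).hasFDerivAt.comp
      _ h1
    rw [κ.straighten.symm_apply_apply y] at h3
    rw [h3.fderiv, ContinuousLinearMap.comp_apply, fderiv_apply_eq_sum]
    refine (enorm_sum_le _ _).trans (Finset.sum_le_sum fun i _ => ?_)
    rw [enorm_mul]
    refine mul_le_of_le_one_left zero_le ?_
    rw [← ofReal_norm, Complex.norm_real, ENNReal.ofReal_le_one]
    refine (PiLp.norm_apply_le _ i).trans ?_
    rw [dunflat_apply, LinearIsometryEquiv.norm_map]
    refine (Coord.norm_le_add _).trans ?_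
    simp
  refine (lintegral_mono hpt).trans ?_
  rw [lintegral_finsetSum' _ fun i _ => ?_, Finset.mul_sum]
  · exact Finset.sum_le_sum fun i _ => lintegral_enorm_mul_le_eLpNorm hmeas.aestronglyMeasurable
      (continuous_partialDeriv hh i).aestronglyMeasurable
  · exact (hmeas.enorm.mul (continuous_partialDeriv hh i).measurable.enorm).aemeasurable

theorem enorm_integral_wave_mul_le (hη : IsCutoff η) (hk : 0 ≤ k) (hM : 0 < M) (ξ : Coord d)
    {ψ : FlatCoord d → ℂ} :
    ‖(k : ℂ) * ∫ x', wave η M N ξ (x', 0) * ψ (x', 0)‖ₑ ≤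
      ENNReal.ofReal k * ∫⁻ x' in Metric.closedBall 0 M⁻¹, ‖ψ (x', 0)‖ₑ := by
  rw [enorm_mul, ← ofReal_norm (k : ℂ), Complex.norm_real, Real.norm_eq_abs, abs_of_nonneg hk]
  refine mul_le_mul_right ((enorm_integral_le_lintegral_enorm _).trans ?_) _
  rw [← lintegral_indicator measurableSet_closedBall]
  refine lintegral_mono fun x' => ?_
  by_cases hx : x' ∈ Metric.closedBall 0 M⁻¹
  · rw [Set.indicator_of_mem hx, enorm_mul]
    refine mul_le_of_le_one_left zero_le ?_
    rw [← ofReal_norm, ENNReal.ofReal_le_one, wave, norm_mul, norm_exp_phase, Complex.norm_real,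
      Real.norm_eq_abs, abs_of_nonneg (cutoff_nonneg hη _)]
    have := cutoff_le_one (M := M) hη ((x', 0) : FlatCoord d)
    simpa using this
  · have h0 : ((x', 0) : FlatCoord d) ∉ box d M := fun h => hx (mem_closedBall_zero_iff.mpr h.1)
    rw [Set.indicator_of_notMem hx, wave, cutoff_eq_zero hη hM h0]
    simp

/-- The null field is almost orthogonal to gradients, up to boundary terms. -/
theorem enorm_integral_nullField_le (κ : BoundaryChart D θ P) (hθ : 0 < θ) (hη : IsCutoff η)
    {E : NNReal} (hE : LipschitzWith E η)
    (hDbdd : Bornology.IsBounded D) (hDopen : IsOpen D) (hP : P ∈ frontier D)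
    (hk : 0 ≤ k) (hM : 0 < M) (hN : 0 < N)
    (hr : (2 + κ.bound) * M⁻¹ < κ.radius) {ξ : Coord d} (hξ : κ.IsAdmissible ξ)
    {h : EuclideanSpace ℝ (Fin d) → ℂ} (hh : ContDiff ℝ 1 h) :
    ‖∫ y in D, ∑ i, κ.nullField η k M N ξ i y * partialDeriv i h y‖ₑ ≤
      ENNReal.ofReal (2 * (1 + κ.bound) ^ 2 * k) * (∫⁻ y, ‖h y‖ₑ ∂(surfaceMeasure D)) +
      ENNReal.ofReal (4 * E * M * (1 + κ.bound) ^ 2) *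
        (ENNReal.ofReal (1 / N) * (ENNReal.ofReal k * (∫⁻ y, ‖h y‖ₑ ∂(surfaceMeasure D)) +
        eLpNorm (fun y => weight d k N M (κ.straighten y)) 2 (volume.restrict D) *
          ∑ i, eLpNorm (partialDeriv i h) 2 (volume.restrict D))) := by
  set ψ : FlatCoord d → ℂ := h ∘ κ.straighten.symm with hψdef
  have hψ : ContDiff ℝ 1 ψ := hh.comp (κ.contDiff_straighten_symm hθ)
  set a := κ.imageA (κ.jacT ξ)
  set b := κ.imageA (κ.jacT (WithLp.toLp 2 (0, 1)))
  have ha : ‖a‖ ≤ (1 + κ.bound) ^ 2 := κ.norm_imageA_le hξ.norm_jacT_sq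
  have hb : ‖b‖ ≤ (1 + κ.bound) ^ 2 := κ.norm_imageA_le κ.norm_jacT_vertical_sq
  let Q : FlatCoord d → ℂ := fun x => wave η M N ξ x * ψ x
  have hQ : ContDiff ℝ 1 Q := (contDiff_wave hη N ξ).mul hψ
  have hQc : HasCompactSupport Q := (hasCompactSupport_wave hη hM N ξ).mul_right
  have hQi : ∀ v, Integrable (fun x => fderiv ℝ Q x v) := fun v =>
    ((hQ.continuous_fderiv one_ne_zero).clm_apply continuous_const).integrable_of_hasCompactSupport
      (hQc.fderiv_apply ℝ v)
  let R : FlatCoord d → ℂ := fun x => ψ x * Complex.exp ((N : ℂ) * phase ξ x) *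
        (Complex.I * ((fderiv ℝ (cutoff η M) x a : ℝ) : ℂ) -
          ((fderiv ℝ (cutoff η M) x b : ℝ) : ℂ))
  have hRc : Continuous R := by
    have h1 : ∀ v, Continuous fun x => ((fderiv ℝ (cutoff (d := d) η M) x v : ℝ) : ℂ) := fun v =>
      Complex.continuous_ofReal.comp
        (((contDiff_cutoff hη).continuous_fderiv one_ne_zero).clm_apply continuous_const)
    exact (hψ.continuous.mul (continuous_const.mul (phase ξ).continuous).cexp).mul
      ((continuous_const.mul (h1 a)).sub (h1 b))
  have hR0 : ∀ x, x ∉ box d M → R x = 0 := by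
    intro x hx
    simp [R, fderiv_cutoff_eq_zero hη hM hx]
  have hRi : Integrable R :=
    hRc.integrable_of_hasCompactSupport (HasCompactSupport.intro isCompact_box hR0)
  have hQR : ∀ x, wave η M N ξ x * (Complex.I * fderiv ℝ ψ x a - fderiv ℝ ψ x b) =
      (Complex.I * fderiv ℝ Q x a - fderiv ℝ Q x b) - R x := fun x =>
    κ.wave_mul_null hη hξ hψ x
  have hswap : ∫ y in D, ∑ i, κ.nullField η k M N ξ i y * partialDeriv i h y =
      ∫ x in halfSpace d, (k : ℂ) * (wave η M N ξ x *
        (Complex.I * fderiv ℝ ψ x a - fderiv ℝ ψ x b)) := by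
    rw [← κ.setIntegral_straighten hDopen hP hr (Φ := fun x => (k : ℂ) * (wave η M N ξ x *
        (Complex.I * fderiv ℝ ψ x a - fderiv ℝ ψ x b)))]
    · exact integral_congr_ae (Eventually.of_forall fun y => κ.sum_nullField_mul ξ hh y)
    · intro x hx
      simp [wave, cutoff_eq_zero hη hM hx]
  -- The constant complex field passes through the integration by parts; its vertical component
  -- multiplies the boundary integral, and R collects the derivatives of the cutoff.
  have heq : ∫ y in D, ∑ i, κ.nullField η k M N ξ i y * partialDeriv i h y =
      (((b.2 : ℝ) : ℂ) - Complex.I * ((a.2 : ℝ) : ℂ)) * ((k : ℂ) * ∫ x', Q (x', 0)) -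
        (k : ℂ) * ∫ x in halfSpace d, R x := by
    rw [hswap, integral_const_mul]
    simp only [hQR]
    have hi1 : Integrable (fun x => Complex.I * fderiv ℝ Q x a) := (hQi a).const_mul _
    have hi2 : Integrable (fun x => Complex.I * fderiv ℝ Q x a - fderiv ℝ Q x b) :=
      hi1.sub (hQi b)
    rw [integral_sub hi2.integrableOn hRi.integrableOn,
      integral_sub hi1.integrableOn (hQi b).integrableOn, integral_const_mul,
      integral_halfSpace_fderiv hQ hQc, integral_halfSpace_fderiv hQ hQc]
    ring
  rw [heq]
  refine (enorm_sub_le).trans (add_le_add ?_ ?_)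
  · rw [enorm_mul, ENNReal.ofReal_mul (by positivity), mul_assoc]
    refine mul_le_mul' ?_ ?_
    · rw [← ofReal_norm]
      refine ENNReal.ofReal_le_ofReal ?_
      rw [norm_sub_rev]
      refine (norm_I_mul_sub_le _ _).trans ?_
      have h1 := (norm_snd_le a).trans ha
      have h2 := (norm_snd_le b).trans hb
      rw [Real.norm_eq_abs] at h1 h2
      linarith
    · refine (enorm_integral_wave_mul_le hη hk hM ξ).trans ?_
      exact mul_le_mul_right (κ.lintegral_straighten_boundary_le hDbdd hP hM hr hh.continuous) _
  · refine le_trans ?_ (mul_le_mul_right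
      (κ.lintegral_weight_mul_straighten_le hθ hDbdd hDopen hP hk hM hN hr hh) _)
    rw [← integral_const_mul, ← lintegral_const_mul' _ _ ENNReal.ofReal_ne_top]
    refine (enorm_integral_le_lintegral_enorm _).trans (lintegral_mono fun x => ?_)
    by_cases hx : x ∈ box d M
    swap
    · rw [hR0 x hx]
      simp
    rw [weight, Set.indicator_of_mem hx, enorm_mul, enorm_mul, enorm_mul,
      ← ofReal_norm (k : ℂ), Complex.norm_real, Real.norm_eq_abs, abs_of_nonneg hk,
      ← ofReal_norm (Complex.exp _), norm_exp_phase, ENNReal.ofReal_mul hk]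
    have h1 : ‖Complex.I * ((fderiv ℝ (cutoff η M) x a : ℝ) : ℂ) -
        ((fderiv ℝ (cutoff η M) x b : ℝ) : ℂ)‖ₑ ≤
        ENNReal.ofReal (4 * E * M * (1 + κ.bound) ^ 2) := by
      rw [← ofReal_norm]
      refine ENNReal.ofReal_le_ofReal ((norm_I_mul_sub_le _ _).trans ?_)
      have h2 := norm_fderiv_cutoff_le (d := d) hη hE hM.le x
      have h3 : ∀ v : FlatCoord d, ‖v‖ ≤ (1 + κ.bound) ^ 2 →
          |fderiv ℝ (cutoff η M) x v| ≤ 2 * E * M * (1 + κ.bound) ^ 2 := fun v hv =>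
        ((fderiv ℝ (cutoff η M) x).le_opNorm v).trans
          (mul_le_mul h2 hv (norm_nonneg _) (by positivity))
      linarith [h3 a ha, h3 b hb]
    calc _ ≤ ENNReal.ofReal k * (‖ψ x‖ₑ * ENNReal.ofReal (Real.exp (-(N * x.2))) *
          ENNReal.ofReal (4 * E * M * (1 + κ.bound) ^ 2)) := by gcongr
      _ = _ := by
        simp only [hψdef, Function.comp_apply]
        ring

/-- The null field is almost orthogonal to the gradients of functions with zero trace. -/
theorem enorm_integral_nullField_zeroTrace_le (κ : BoundaryChart D θ P) (hθ : 0 < θ)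
    (hη : IsCutoff η) {E : NNReal} (hE : LipschitzWith E η)
    (hDbdd : Bornology.IsBounded D) (hDopen : IsOpen D)
    (hσ : surfaceMeasure D Set.univ < ⊤) (hP : P ∈ frontier D)
    (hk : 0 ≤ k) (hM : 0 < M) (hN : 0 < N)
    (hr : (2 + κ.bound) * M⁻¹ < κ.radius) {ξ : Coord d} (hξ : κ.IsAdmissible ξ)
    (hJ : ∀ i, MemLp (κ.nullField η k M N ξ i) 2 (volume.restrict D))
    {H : Fin d → EuclideanSpace ℝ (Fin d) → ℂ} (hH : IsZeroTraceGradient D H) :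
    ‖∫ y in D, ∑ i, κ.nullField η k M N ξ i y * H i y‖ₑ ≤
      ENNReal.ofReal (4 * E * (1 + κ.bound) ^ 2 * (M / N)) *
        (eLpNorm (fun y => weight d k N M (κ.straighten y)) 2 (volume.restrict D) *
          ∑ i, eLpNorm (H i) 2 (volume.restrict D)) := by
  have hHm := hH.memLp
  -- H is a limit of gradients of C¹ functions whose boundary values tend to zero. The estimate for
  -- C¹ functions passes to the limit, and its boundary terms disappear.
  obtain ⟨v, -, -, w, hw, -, hwH, hw0⟩ := hH
  have hwm : ∀ i n, MemLp (partialDeriv i (w n)) 2 (volume.restrict D) := fun i n =>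
    memLp_volume_of_continuous hDbdd hDopen (continuous_partialDeriv (hw n) i)
  have hlhs : Tendsto (fun n => ‖∫ y in D, ∑ i, κ.nullField η k M N ξ i y *
      partialDeriv i (w n) y‖ₑ) atTop
      (𝓝 ‖∫ y in D, ∑ i, κ.nullField η k M N ξ i y * H i y‖ₑ) := by
    refine (continuous_enorm.tendsto _).comp ?_
    have hlim := integral_finsetSum (μ := volume.restrict D)
      (f := fun i y => κ.nullField η k M N ξ i y * H i y) Finset.univ
      fun i _ => (hJ i).integrable_mul (hHm i)
    have hseq : ∀ n, _ := fun n => integral_finsetSum (μ := volume.restrict D)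
      (f := fun i y => κ.nullField η k M N ξ i y * partialDeriv i (w n) y) Finset.univ
      fun i _ => (hJ i).integrable_mul (hwm i n)
    simp only [hlim, hseq]
    refine tendsto_finsetSum _ fun i _ => ?_
    have := tendsto_integral_mul_of_tendsto_eLpNorm (hwm i) (hHm i) (hJ i) (hwH i)
    simpa only [mul_comm] using this
  set W := eLpNorm (fun y => weight d k N M (κ.straighten y)) 2 (volume.restrict D)
  -- On a surface of finite measure, convergence in L² implies convergence in L¹.
  have hb0 : Tendsto (fun n => ∫⁻ y, ‖w n y‖ₑ ∂(surfaceMeasure D)) atTop (𝓝 0) := by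
    have h1 : Tendsto (fun n => eLpNorm (fun y => w n y - (0 : EuclideanSpace ℝ (Fin d) → ℂ) y) 2
        (surfaceMeasure D) * surfaceMeasure D Set.univ ^ (1 / 1 - 1 / 2 : ℝ)) atTop (𝓝 0) := by
      have := ENNReal.Tendsto.mul_const hw0 (b := surfaceMeasure D Set.univ ^ (1 / 1 - 1 / 2 : ℝ))
        (Or.inr (ENNReal.rpow_ne_top_of_nonneg (by norm_num) hσ.ne))
      rwa [zero_mul] at this
    refine tendsto_of_tendsto_of_tendsto_of_le_of_le tendsto_const_nhds h1
      (fun _ => zero_le) fun n => ?_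
    have := eLpNorm_le_eLpNorm_mul_rpow_measure_univ (p := 1) (q := 2) (by norm_num)
      (hw n).continuous.aestronglyMeasurable (μ := surfaceMeasure D)
    rw [eLpNorm_one_eq_lintegral_enorm] at this
    simpa using this
  have hWtop : W ≠ ⊤ := by
    have h1 : MemLp (fun y => weight d k N M (κ.straighten y)) 2 (volume.restrict D) := by
      have : IsFiniteMeasure (volume.restrict D) := ⟨by
        rw [Measure.restrict_apply_univ]
        exact hDbdd.measure_lt_top⟩
      refine MemLp.of_bound (measurable_weight.comp
        κ.straighten.measurable).aestronglyMeasurable (k * Real.exp (N * M⁻¹))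
        (Eventually.of_forall fun y => ?_)
      rw [Real.norm_eq_abs, abs_of_nonneg (weight_nonneg hk _)]
      exact weight_le hk hN.le _
    exact h1.eLpNorm_ne_top
  have hsum : Tendsto (fun n => ∑ i, (eLpNorm (fun y => partialDeriv i (w n) y - H i y) 2
      (volume.restrict D) + eLpNorm (H i) 2 (volume.restrict D))) atTop
      (𝓝 (∑ i, eLpNorm (H i) 2 (volume.restrict D))) := by
    refine tendsto_finsetSum _ fun i _ => ?_
    simpa using (hwH i).add_const (eLpNorm (H i) 2 (volume.restrict D))
  have hrhs : Tendsto (fun n =>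
      ENNReal.ofReal (2 * (1 + κ.bound) ^ 2 * k) * (∫⁻ y, ‖w n y‖ₑ ∂(surfaceMeasure D)) +
      ENNReal.ofReal (4 * E * M * (1 + κ.bound) ^ 2) *
        (ENNReal.ofReal (1 / N) * (ENNReal.ofReal k * (∫⁻ y, ‖w n y‖ₑ ∂(surfaceMeasure D)) +
        W * ∑ i, (eLpNorm (fun y => partialDeriv i (w n) y - H i y) 2
      (volume.restrict D) + eLpNorm (H i) 2 (volume.restrict D))))) atTop
      (𝓝 (ENNReal.ofReal (2 * (1 + κ.bound) ^ 2 * k) * 0 +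
        ENNReal.ofReal (4 * E * M * (1 + κ.bound) ^ 2) *
        (ENNReal.ofReal (1 / N) * (ENNReal.ofReal k * 0 +
        W * ∑ i, eLpNorm (H i) 2 (volume.restrict D))))) := by
    refine (ENNReal.Tendsto.const_mul hb0 (Or.inr ENNReal.ofReal_ne_top)).add
      (ENNReal.Tendsto.const_mul (ENNReal.Tendsto.const_mul
        ((ENNReal.Tendsto.const_mul hb0 (Or.inr ENNReal.ofReal_ne_top)).add
          (ENNReal.Tendsto.const_mul hsum (Or.inr hWtop))) (Or.inr ENNReal.ofReal_ne_top))
        (Or.inr ENNReal.ofReal_ne_top))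
  have hfin := le_of_tendsto_of_tendsto' hlhs hrhs fun n =>
    (κ.enorm_integral_nullField_le hθ hη hE hDbdd hDopen hP hk hM hN hr hξ (hw n)).trans ?_
  · refine hfin.trans_eq ?_
    rw [mul_zero, mul_zero, zero_add, zero_add, ← mul_assoc, ← ENNReal.ofReal_mul (by positivity)]
    congr 2
    ring
  · have : ∀ i, eLpNorm (partialDeriv i (w n)) 2 (volume.restrict D) ≤
        eLpNorm (fun y => partialDeriv i (w n) y - H i y) 2 (volume.restrict D) +
          eLpNorm (H i) 2 (volume.restrict D) := by
      intro i
      have h1 := eLpNorm_add_le ((hwm i n).sub (hHm i)).1 (hHm i).1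
        (by norm_num : (1 : ENNReal) ≤ 2)
      rw [sub_add_cancel] at h1
      exact h1
    gcongr with i
    exact this i

end Divergence

end BoundaryChart


/-! ### The energy of the boundary data -/

theorem eLpNorm_two_le_ofReal_sqrt {X F : Type*} [MeasurableSpace X] [NormedAddCommGroup F]
    {μ : Measure X} {f : X → F} {A : ℝ} (hA : 0 ≤ A)
    (h : ∫⁻ x, ‖f x‖ₑ ^ 2 ∂μ ≤ ENNReal.ofReal A) : eLpNorm f 2 μ ≤ ENNReal.ofReal √A := by
  rw [← ENNReal.pow_le_pow_left_iff two_ne_zero, eLpNorm_two_sq,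
    ← ENNReal.ofReal_pow (Real.sqrt_nonneg _), Real.sq_sqrt hA]
  exact h

theorem sum_eLpNorm_le {X : Type*} [MeasurableSpace X] {μ : Measure X} {d : ℕ}
    {H : Fin d → X → ℂ} (hH : ∀ i, MemLp (H i) 2 μ) :
    ∑ i, eLpNorm (H i) 2 μ ≤ ENNReal.ofReal (d * √(∫ x, ∑ i, ‖H i x‖ ^ 2 ∂μ)) := by
  have hint : ∀ i, Integrable (fun x => ‖H i x‖ ^ 2) μ := fun i => (hH i).norm.integrable_sq
  have h0 : 0 ≤ ∫ x, ∑ i, ‖H i x‖ ^ 2 ∂μ := integral_nonneg fun x => by positivity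
  have h1 : ∀ i, eLpNorm (H i) 2 μ ≤ ENNReal.ofReal √(∫ x, ∑ i, ‖H i x‖ ^ 2 ∂μ) := by
    intro i
    refine eLpNorm_two_le_ofReal_sqrt h0 ?_
    have h2 : ∀ x, ‖H i x‖ₑ ^ 2 = ENNReal.ofReal (‖H i x‖ ^ 2) := fun x => by
      rw [ENNReal.ofReal_pow (norm_nonneg _), ofReal_norm]
    simp only [h2]
    rw [← ofReal_integral_eq_lintegral_ofReal (hint i)
      (Eventually.of_forall fun x => by positivity)]
    refine ENNReal.ofReal_le_ofReal (integral_mono (hint i)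
      (integrable_finsetSum _ fun i _ => hint i) fun x => ?_)
    exact Finset.single_le_sum (f := fun i => ‖H i x‖ ^ 2) (fun j _ => by positivity)
      (Finset.mem_univ i)
  refine (Finset.sum_le_sum fun i _ => h1 i).trans ?_
  rw [Finset.sum_const, Finset.card_univ, Fintype.card_fin, nsmul_eq_mul,
    ENNReal.ofReal_mul (by positivity), ENNReal.ofReal_natCast]

/-- The relations between the scales `M⁻¹` and `N⁻¹` of the boundary data, and the resulting
precision `δ`. -/
structure IsScale (θ M N δ : ℝ) : Prop where
  M_pos : 0 < M
  N_pos : 0 < N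
  ratio_le : M / N ≤ δ
  rpow_le : (M⁻¹) ^ θ ≤ δ
  inv_le : M⁻¹ ≤ δ
  le_one : δ ≤ 1

theorem IsScale.pos {θ M N δ : ℝ} (h : IsScale θ M N δ) : 0 < δ :=
  (div_pos h.M_pos h.N_pos).trans_le h.ratio_le

/-- A constant that dominates the constants in the estimates of the gradient. -/
def fieldConst (E L : ℝ) : ℝ := 4 * (1 + E) * (1 + L) ^ 2

namespace BoundaryChart

section Energy

variable {d : ℕ} {D : Set (EuclideanSpace ℝ (Fin d))} {θ : ℝ} {P : EuclideanSpace ℝ (Fin d)}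
  {η : ℝ → ℝ} {k k₀ M N δ L : ℝ} {E : NNReal}

theorem norm_partialDeriv_sub_le (κ : BoundaryChart D θ P) (hθ : 0 ≤ θ) (hη : IsCutoff η)
    (hE : LipschitzWith E η) (hk : 0 ≤ k₀) (hs : IsScale θ M N δ) (hL : κ.bound ≤ L)
    {ξ : Coord d} (hξ : κ.IsAdmissible ξ) (i : Fin d) (y : EuclideanSpace ℝ (Fin d)) :
    ‖partialDeriv i (κ.amplitude η k₀ M N ξ) y - κ.leadField η (k₀ * N) M N ξ i y‖ ≤
      fieldConst E L * δ * weight d (k₀ * N) N M (κ.straighten y) := by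
  have hb := κ.bound_nonneg
  have hE0 := E.coe_nonneg
  have hδ := hs.pos
  have hL0 := hb.trans hL
  refine (κ.norm_partialDeriv_sub_leadField_le hθ hη hE hk hs.M_pos hs.N_pos hξ i y).trans ?_
  refine mul_le_mul_of_nonneg_right ?_ (weight_nonneg (mul_nonneg hk hs.N_pos.le) _)
  have h1 := hs.ratio_le
  have h2 := hs.rpow_le
  have h3 := (div_pos hs.M_pos hs.N_pos).le
  have h4 := (Real.rpow_pos_of_pos (inv_pos.mpr hs.M_pos) θ).le
  calc _ ≤ 2 * E * (1 + L) * δ + (2 + L) * L * δ := by gcongr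
    _ = (2 * E * (1 + L) + (2 + L) * L) * δ := by ring
    _ ≤ _ := by
      refine mul_le_mul_of_nonneg_right ?_ hδ.le
      rw [fieldConst]
      have h3 : 0 ≤ (E : ℝ) * (1 + L) := by positivity
      have h4 : 0 ≤ (E : ℝ) * L ^ 2 := by positivity
      have h5 : 0 ≤ (E : ℝ) * L := by positivity
      nlinarith

theorem norm_leadField_le' (κ : BoundaryChart D θ P) (hη : IsCutoff η) (hk : 0 ≤ k) (hM : 0 < M)
    (hL : κ.bound ≤ L) {ξ : Coord d} (hξ : κ.IsAdmissible ξ) (i : Fin d)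
    (y : EuclideanSpace ℝ (Fin d)) :
    ‖κ.leadField η k M N ξ i y‖ ≤ fieldConst E L * weight d k N M (κ.straighten y) := by
  refine (κ.norm_leadField_le hη hk hM hξ i y).trans ?_
  have hb := κ.bound_nonneg
  have hE0 := E.coe_nonneg
  refine mul_le_mul_of_nonneg_right ?_ (weight_nonneg hk _)
  rw [fieldConst]
  have h4 : 0 ≤ (E : ℝ) * (1 + L) ^ 2 := by positivity
  nlinarith

theorem norm_partialDeriv_le (κ : BoundaryChart D θ P) (hθ : 0 ≤ θ) (hη : IsCutoff η)
    (hE : LipschitzWith E η) (hk : 0 ≤ k₀) (hs : IsScale θ M N δ) (hL : κ.bound ≤ L)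
    {ξ : Coord d} (hξ : κ.IsAdmissible ξ) (i : Fin d) (y : EuclideanSpace ℝ (Fin d)) :
    ‖partialDeriv i (κ.amplitude η k₀ M N ξ) y‖ ≤
      2 * fieldConst E L * weight d (k₀ * N) N M (κ.straighten y) := by
  have h1 := κ.norm_partialDeriv_sub_le hθ hη hE hk hs hL hξ i y
  have h2 := κ.norm_leadField_le' (N := N) (E := E) hη (mul_nonneg hk hs.N_pos.le)
    hs.M_pos hL hξ i y
  have h3 := norm_le_norm_add_norm_sub (κ.leadField η (k₀ * N) M N ξ i y)
    (partialDeriv i (κ.amplitude η k₀ M N ξ) y)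
  rw [norm_sub_rev] at h3
  have hL0 := κ.bound_nonneg.trans hL
  have h4 : 0 ≤ fieldConst E L * weight d (k₀ * N) N M (κ.straighten y) :=
    (norm_nonneg _).trans h2
  have h5 := mul_le_of_le_one_left h4 hs.le_one
  linarith

theorem norm_nullField_sub_le' (κ : BoundaryChart D θ P) (hθ : 0 ≤ θ) (hη : IsCutoff η)
    (hk : 0 ≤ k) (hs : IsScale θ M N δ) (hL : κ.bound ≤ L)
    {ξ : Coord d} (hξ : κ.IsAdmissible ξ) (i : Fin d) (y : EuclideanSpace ℝ (Fin d)) :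
    ‖κ.nullField η k M N ξ i y - κ.leadField η k M N ξ i y‖ ≤
      fieldConst E L * δ * weight d k N M (κ.straighten y) := by
  have hb := κ.bound_nonneg
  have hE0 := E.coe_nonneg
  have hδ := hs.pos
  have hL0 := hb.trans hL
  refine (κ.norm_nullField_sub_le hθ hη hk hs.M_pos hξ i y).trans ?_
  refine mul_le_mul_of_nonneg_right ?_ (weight_nonneg hk _)
  have h2 := hs.rpow_le
  have h3 := (Real.rpow_pos_of_pos (inv_pos.mpr hs.M_pos) θ).le
  calc _ ≤ 2 * (1 + L) * L * δ := by gcongr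
    _ ≤ _ := by
      refine mul_le_mul_of_nonneg_right ?_ hδ.le
      rw [fieldConst]
      have h4 : 0 ≤ (E : ℝ) * (1 + L) ^ 2 := by positivity
      nlinarith

/-- The weight confines y to within (2 + L)/M of P, and 1/M ≤ δ. -/
theorem abs_conductivity_sub_mul_le (κ : BoundaryChart D θ P) (hP : P ∈ frontier D)
    (hk : 0 ≤ k) (hs : IsScale θ M N δ) (hL : κ.bound ≤ L) {γ₀ K : ℝ}
    {γ : EuclideanSpace ℝ (Fin d) → ℝ} (hγ : IsLipschitzConductivity D γ₀ K γ)
    {y : EuclideanSpace ℝ (Fin d)} (hy : y ∈ D) :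
    |γ y - γ P| * weight d k N M (κ.straighten y) ≤
      K * (2 + L) * δ * weight d k N M (κ.straighten y) := by
  have hPc := frontier_subset_closure hP
  have hK : 0 ≤ K := (abs_nonneg _).trans (hγ.upper P hPc)
  have hb := κ.bound_nonneg
  by_cases hbox : κ.straighten y ∈ box d M
  · refine mul_le_mul_of_nonneg_right ?_ (weight_nonneg hk _)
    refine (hγ.lipschitz y (subset_closure hy) P hPc).trans ?_
    rw [mul_assoc, dist_eq_norm]
    refine mul_le_mul_of_nonneg_left ?_ hK
    have hM := inv_pos.mpr hs.M_pos
    have h1 := mul_le_mul_of_nonneg_left hbox.1 (by linarith : 0 ≤ 1 + κ.bound)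
    have h2 : (2 + κ.bound) * M⁻¹ ≤ (2 + L) * δ := by
      have := hs.inv_le
      gcongr
      linarith
    linarith [κ.norm_sub_le_of_straighten hP y, hbox.2]
  · rw [weight, Set.indicator_of_notMem hbox, mul_zero, mul_zero]

theorem continuous_amplitude (κ : BoundaryChart D θ P) (hη : IsCutoff η) (ξ : Coord d) :
    Continuous (κ.amplitude η k M N ξ) :=
  continuous_const.mul ((contDiff_wave hη N ξ).continuous.comp κ.straighten.continuous)

theorem contDiff_amplitude (κ : BoundaryChart D θ P) (hθ : 0 < θ) (hη : IsCutoff η) (ξ : Coord d) :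
    ContDiff ℝ 1 (κ.amplitude η k M N ξ) :=
  contDiff_const.mul ((contDiff_wave hη N ξ).comp (κ.contDiff_straighten hθ))

theorem continuous_nullField (κ : BoundaryChart D θ P) (hθ : 0 < θ) (hη : IsCutoff η)
    (ξ : Coord d) (i : Fin d) : Continuous (κ.nullField η k M N ξ i) := by
  have h1 : Continuous κ.slopeAt := by
    have h2 : ∀ y, κ.slopeAt y = (InnerProductSpace.toDual ℝ _).symm
        (fderiv ℝ κ.φ (κ.coord y).fst) := fun y => rfl
    simp only [funext h2]
    exact (InnerProductSpace.toDual ℝ _).symm.continuous.comp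
      (((κ.contDiff hθ).continuous_fderiv one_ne_zero).comp
        ((WithLp.continuous_fst 2 _ _).comp κ.coord.continuous))
  have h3 : ∀ c, Continuous fun y => (κ.dunflat (κ.slopeAt y) (κ.imageA c)) i := by
    intro c
    simp only [dunflat_imageA, PiLp.add_apply, PiLp.smul_apply, smul_eq_mul]
    exact continuous_const.add (((h1.sub continuous_const).inner continuous_const).mul
      continuous_const)
  exact (κ.continuous_amplitude hη ξ).mul ((continuous_const.mul
    (Complex.continuous_ofReal.comp (h3 _))).sub (Complex.continuous_ofReal.comp (h3 _)))

theorem memLp_weight (κ : BoundaryChart D θ P) (hDbdd : Bornology.IsBounded D)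
    (hk : 0 ≤ k) (hN : 0 ≤ N) :
    MemLp (fun y => weight d k N M (κ.straighten y)) 2 (volume.restrict D) := by
  have : IsFiniteMeasure (volume.restrict D) := ⟨by
    rw [Measure.restrict_apply_univ]
    exact hDbdd.measure_lt_top⟩
  refine MemLp.of_bound (measurable_weight.comp
    κ.straighten.measurable).aestronglyMeasurable (k * Real.exp (N * M⁻¹))
    (Eventually.of_forall fun y => ?_)
  rw [Real.norm_eq_abs, abs_of_nonneg (weight_nonneg hk _)]
  exact weight_le hk hN _

theorem integrable_conductivity_mul_sum (hDopen : IsOpen D)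
    {γ₀ K : ℝ} {γ : EuclideanSpace ℝ (Fin d) → ℝ} (hγ : IsLipschitzConductivity D γ₀ K γ)
    {G : Fin d → EuclideanSpace ℝ (Fin d) → ℂ} (hG : ∀ i, MemLp (G i) 2 (volume.restrict D)) :
    Integrable (fun y => γ y * ∑ i, ‖G i y‖ ^ 2) (volume.restrict D) := by
  have h1 : Integrable (fun y => ∑ i, ‖G i y‖ ^ 2) (volume.restrict D) :=
    integrable_finsetSum _ fun i _ => (hG i).norm.integrable_sq
  refine h1.bdd_mul (c := K)
    (hγ.continuousOn.aestronglyMeasurable hDopen.measurableSet) ?_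
  exact (ae_restrict_iff' hDopen.measurableSet).mpr (Eventually.of_forall fun y hy =>
    hγ.upper y (subset_closure hy))

theorem abs_norm_sq_sub_le {a b : ℂ} {A ρ : ℝ} (ha : ‖a‖ ≤ A) (hb : ‖b‖ ≤ A)
    (hab : ‖a - b‖ ≤ ρ) : |‖a‖ ^ 2 - ‖b‖ ^ 2| ≤ 2 * A * ρ := by
  have h1 : ‖a‖ ^ 2 - ‖b‖ ^ 2 = (‖a‖ + ‖b‖) * (‖a‖ - ‖b‖) := by ring
  rw [h1, abs_mul, abs_of_nonneg (by positivity)]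
  exact mul_le_mul (by linarith) ((abs_norm_sub_norm_le a b).trans hab) (abs_nonneg _)
    (by linarith [norm_nonneg a])

/-- The energy of the boundary data is close to that of the leading field with the conductivity
frozen at `P`. -/
theorem abs_energy_sub_le (κ : BoundaryChart D θ P) (hθ : 0 < θ) (hη : IsCutoff η)
    (hE : LipschitzWith E η) (hDbdd : Bornology.IsBounded D) (hDopen : IsOpen D)
    (hP : P ∈ frontier D) (hk : 0 ≤ k₀) (hs : IsScale θ M N δ) (hL : κ.bound ≤ L)
    {ξ : Coord d} (hξ : κ.IsAdmissible ξ) {γ₀ K : ℝ} {γ : EuclideanSpace ℝ (Fin d) → ℝ}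
    (hγ : IsLipschitzConductivity D γ₀ K γ) :
    |(∫ y in D, γ y * ∑ i, ‖partialDeriv i (κ.amplitude η k₀ M N ξ) y‖ ^ 2) -
        γ P * ∫ y in D, ∑ i, ‖κ.leadField η (k₀ * N) M N ξ i y‖ ^ 2| ≤
      d * (4 * K * (3 + L) * fieldConst E L ^ 2 * δ) *
        ∫ y in D, weight d (k₀ * N) N M (κ.straighten y) ^ 2 := by
  have hkN := mul_nonneg hk hs.N_pos.le
  have hPc := frontier_subset_closure hP
  have hK : 0 ≤ K := (abs_nonneg _).trans (hγ.upper P hPc)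
  have hL0 := κ.bound_nonneg.trans hL
  have hE0 := E.coe_nonneg
  have hB : 0 ≤ fieldConst E L := by
    rw [fieldConst]
    positivity
  have hV : ∀ i, MemLp (partialDeriv i (κ.amplitude η k₀ M N ξ)) 2 (volume.restrict D) := fun i =>
    memLp_volume_of_continuous hDbdd hDopen
      (continuous_partialDeriv (κ.contDiff_amplitude hθ hη ξ) i)
  have hV0 : ∀ i, MemLp (κ.leadField η (k₀ * N) M N ξ i) 2 (volume.restrict D) := fun i =>
    memLp_volume_of_continuous hDbdd hDopen ((κ.continuous_amplitude hη ξ).mul continuous_const)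
  rw [← integral_const_mul, ← integral_sub (integrable_conductivity_mul_sum hDopen hγ hV)
    ((integrable_finsetSum _ fun i _ => (hV0 i).norm.integrable_sq).const_mul _),
    ← integral_const_mul, ← Real.norm_eq_abs]
  refine norm_integral_le_of_norm_le
    ((κ.memLp_weight hDbdd hkN hs.N_pos.le).integrable_sq.const_mul _) ?_
  refine (ae_restrict_iff' hDopen.measurableSet).mpr (Eventually.of_forall fun y hy => ?_)
  rw [Finset.mul_sum, Finset.mul_sum, ← Finset.sum_sub_distrib]
  refine (norm_sum_le _ _).trans ((Finset.sum_le_card_nsmul _ _ _ fun i _ => ?_).trans_eq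
    (by rw [Finset.card_univ, Fintype.card_fin, nsmul_eq_mul, mul_assoc]))
  have h1 := κ.norm_partialDeriv_le hθ.le hη hE hk hs hL hξ i y
  have h2 := κ.norm_leadField_le' (N := N) (E := E) hη hkN hs.M_pos hL hξ i y
  have h3 := κ.norm_partialDeriv_sub_le hθ.le hη hE hk hs hL hξ i y
  have h4 := κ.abs_conductivity_sub_mul_le hP hkN hs hL hγ hy
  have h5 := hγ.upper P hPc
  set V := partialDeriv i (κ.amplitude η k₀ M N ξ) y
  set V0 := κ.leadField η (k₀ * N) M N ξ i y
  set W := weight d (k₀ * N) N M (κ.straighten y)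
  have hW : 0 ≤ W := weight_nonneg hkN _
  have hδ := hs.pos
  have h6 := abs_norm_sq_sub_le h1 (h2.trans (by nlinarith [mul_nonneg hB hW])) h3
  -- Freezing the conductivity contributes 4K(2 + L) and replacing the gradient by the leading field
  -- contributes 4K, in sum 4K(3 + L).
  have h7 : γ y * ‖V‖ ^ 2 - γ P * ‖V0‖ ^ 2 =
      (γ y - γ P) * ‖V‖ ^ 2 + γ P * (‖V‖ ^ 2 - ‖V0‖ ^ 2) := by ring
  rw [h7, Real.norm_eq_abs]
  refine (abs_add_le _ _).trans ?_
  rw [abs_mul, abs_mul, abs_of_nonneg (by positivity : 0 ≤ ‖V‖ ^ 2)]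
  calc |γ y - γ P| * ‖V‖ ^ 2 + |γ P| * |‖V‖ ^ 2 - ‖V0‖ ^ 2|
      ≤ |γ y - γ P| * (2 * fieldConst E L * W) ^ 2 +
        K * (2 * (2 * fieldConst E L * W) * (fieldConst E L * δ * W)) := by gcongr
    _ = (|γ y - γ P| * W) * (4 * fieldConst E L ^ 2 * W) +
        4 * K * fieldConst E L ^ 2 * δ * W ^ 2 := by ring
    _ ≤ (K * (2 + L) * δ * W) * (4 * fieldConst E L ^ 2 * W) +
        4 * K * fieldConst E L ^ 2 * δ * W ^ 2 := by gcongr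
    _ = _ := by ring

/-- The energy of the leading field, by the choice of the normalization. -/
theorem abs_leadField_energy_sub_le (κ : BoundaryChart D θ P) (hη : IsCutoff η)
    (hDopen : IsOpen D) (hP : P ∈ frontier D) (hM : 0 < M) (hN : 0 < N)
    (hr : (2 + κ.bound) * M⁻¹ < κ.radius) {ξ : Coord d} (hξ : κ.IsAdmissible ξ)
    (hk : k ^ 2 * ((1 + ‖κ.slope‖ ^ 2) * ((M⁻¹) ^ (d - 1) *
      ∫ x : EuclideanSpace ℝ (Fin (d - 1)), η ‖x‖ ^ 2)) = N) :
    |(∫ y in D, ∑ i, ‖κ.leadField η k M N ξ i y‖ ^ 2) - 1| ≤ M / N := by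
  have h1 : ∀ y, ∑ i, ‖κ.leadField η k M N ξ i y‖ ^ 2 =
      (fun x : FlatCoord d => 2 * k ^ 2 * (1 + ‖κ.slope‖ ^ 2) *
        (cutoff η M x ^ 2 * Real.exp (-(2 * N * x.2)))) (κ.straighten y) := by
    intro y
    simp only [leadField, norm_mul, mul_pow]
    rw [← Finset.mul_sum, κ.sum_norm_phase_sq hξ, amplitude, wave, norm_mul, norm_mul,
      norm_exp_phase, Complex.norm_real, Complex.norm_real, mul_pow, mul_pow, Real.norm_eq_abs,
      Real.norm_eq_abs, sq_abs, sq_abs, ← Real.exp_nat_mul]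
    have : ((2 : ℕ) : ℝ) * -(N * (κ.straighten y).2) = -(2 * N * (κ.straighten y).2) := by
      push_cast
      ring
    rw [this]
    ring
  rw [funext h1, κ.setIntegral_straighten hDopen hP hr
    (Φ := fun x : FlatCoord d => 2 * k ^ 2 * (1 + ‖κ.slope‖ ^ 2) *
        (cutoff η M x ^ 2 * Real.exp (-(2 * N * x.2))))
    fun x hx => by simp [cutoff_eq_zero hη hM hx], integral_const_mul,
    integral_halfSpace_cutoff_sq η hM]
  -- By `hk` the tangential factors reduce to N, which leaves 2N times the half-line integral.
  convert abs_integral_cutoff_sq_exp_sub_le hη hM hN using 3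
  generalize (∫ t in Set.Ioi (0 : ℝ), η (M * t) ^ 2 * Real.exp (-(2 * N * t))) = T
  linear_combination 2 * T * hk

/-- The field γ∇f is compared with γ(P) times the null field. Their difference is pointwise O(δ)
times the weight and contributes 6 + 2L; the null field is almost free of divergence and contributes
1. -/
theorem norm_energyForm_le (κ : BoundaryChart D θ P) (hθ : 0 < θ) (hη : IsCutoff η)
    (hE : LipschitzWith E η) (hDbdd : Bornology.IsBounded D) (hDopen : IsOpen D)
    (hσ : surfaceMeasure D Set.univ < ⊤)
    (hP : P ∈ frontier D) (hk : 0 ≤ k₀) (hs : IsScale θ M N δ) (hL : κ.bound ≤ L)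
    (hr : (2 + κ.bound) * M⁻¹ < κ.radius)
    {ξ : Coord d} (hξ : κ.IsAdmissible ξ) {γ₀ K : ℝ} {γ : EuclideanSpace ℝ (Fin d) → ℝ}
    (h0 : 0 < γ₀) (hγ : IsLipschitzConductivity D γ₀ K γ)
    {H : Fin d → EuclideanSpace ℝ (Fin d) → ℂ} (hH : IsZeroTraceGradient D H) :
    ‖energyForm D γ (fun i => partialDeriv i (κ.amplitude η k₀ M N ξ)) H‖ ≤
      d * (K * (7 + 2 * L) * fieldConst E L * δ) *
        √(∫ y in D, weight d (k₀ * N) N M (κ.straighten y) ^ 2) *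
        √(∫ y in D, ∑ i, ‖H i y‖ ^ 2) := by
  have hkN := mul_nonneg hk hs.N_pos.le
  have hPc := frontier_subset_closure hP
  have hK : 0 ≤ K := (abs_nonneg _).trans (hγ.upper P hPc)
  have hb := κ.bound_nonneg
  have hL0 := hb.trans hL
  have hE0 := E.coe_nonneg
  have hδ := hs.pos
  have hB : 0 ≤ fieldConst E L := by
    rw [fieldConst]
    positivity
  have hHm := hH.memLp
  have hV : ∀ i, MemLp (partialDeriv i (κ.amplitude η k₀ M N ξ)) 2 (volume.restrict D) := fun i =>
    memLp_volume_of_continuous hDbdd hDopen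
      (continuous_partialDeriv (κ.contDiff_amplitude hθ hη ξ) i)
  have hJ : ∀ i, MemLp (κ.nullField η (k₀ * N) M N ξ i) 2 (volume.restrict D) := fun i =>
    memLp_volume_of_continuous hDbdd hDopen (κ.continuous_nullField hθ hη ξ i)
  have hJi : Integrable (fun y => ∑ i, κ.nullField η (k₀ * N) M N ξ i y * H i y)
      (volume.restrict D) :=
    integrable_finsetSum _ fun i _ => (hJ i).integrable_mul (hHm i)
  have hW := κ.memLp_weight (M := M) hDbdd hkN hs.N_pos.le
  set w : EuclideanSpace ℝ (Fin d) → ℝ := fun y => weight d (k₀ * N) N M (κ.straighten y) with hw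
  have hsplit : energyForm D γ (fun i => partialDeriv i (κ.amplitude η k₀ M N ξ)) H =
      (∫ y in D, ((γ y : ℂ) * ∑ i, partialDeriv i (κ.amplitude η k₀ M N ξ) y * H i y -
        (γ P : ℂ) * ∑ i, κ.nullField η (k₀ * N) M N ξ i y * H i y)) +
      (γ P : ℂ) * ∫ y in D, ∑ i, κ.nullField η (k₀ * N) M N ξ i y * H i y := by
    rw [integral_sub (integrable_energy h0 hDopen hγ hV hHm) (hJi.const_mul _), integral_const_mul]
    rw [energyForm]
    ring
  have hfirst : ‖∫ y in D, ((γ y : ℂ) * ∑ i, partialDeriv i (κ.amplitude η k₀ M N ξ) y * H i y -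
        (γ P : ℂ) * ∑ i, κ.nullField η (k₀ * N) M N ξ i y * H i y)‖ₑ ≤
      ENNReal.ofReal (K * (6 + 2 * L) * fieldConst E L * δ) *
        (eLpNorm w 2 (volume.restrict D) * ∑ i, eLpNorm (H i) 2 (volume.restrict D)) := by
    refine (enorm_integral_le_lintegral_enorm _).trans ?_
    have hpt : ∀ y ∈ D, ‖(γ y : ℂ) * ∑ i, partialDeriv i (κ.amplitude η k₀ M N ξ) y * H i y -
        (γ P : ℂ) * ∑ i, κ.nullField η (k₀ * N) M N ξ i y * H i y‖ₑ ≤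
        ENNReal.ofReal (K * (6 + 2 * L) * fieldConst E L * δ) * ∑ i, ‖w y‖ₑ * ‖H i y‖ₑ := by
      intro y hy
      rw [Finset.mul_sum, Finset.mul_sum, ← Finset.sum_sub_distrib, Finset.mul_sum]
      refine (enorm_sum_le _ _).trans (Finset.sum_le_sum fun i _ => ?_)
      rw [← mul_assoc, ← mul_assoc, ← sub_mul, enorm_mul, ← mul_assoc]
      refine mul_le_mul_left ?_ _
      have h1 := κ.norm_partialDeriv_le hθ.le hη hE hk hs hL hξ i y
      have h2 := κ.norm_nullField_sub_le' (E := E) hθ.le hη hkN hs hL hξ i y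
      have h3 := κ.norm_partialDeriv_sub_le hθ.le hη hE hk hs hL hξ i y
      have h4 := κ.abs_conductivity_sub_mul_le hP hkN hs hL hγ hy
      have h5 := hγ.upper P hPc
      have hwy : 0 ≤ w y := weight_nonneg hkN _
      rw [← ofReal_norm, ← ofReal_norm (w y), ← ENNReal.ofReal_mul (by positivity)]
      refine ENNReal.ofReal_le_ofReal ?_
      rw [Real.norm_eq_abs, abs_of_nonneg hwy]
      set V := partialDeriv i (κ.amplitude η k₀ M N ξ) y
      set V0 := κ.leadField η (k₀ * N) M N ξ i y
      set J := κ.nullField η (k₀ * N) M N ξ i y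
      have h6 : (γ y : ℂ) * V - (γ P : ℂ) * J =
          ((γ y - γ P : ℝ) : ℂ) * V + (γ P : ℂ) * ((V - V0) - (J - V0)) := by
        push_cast
        ring
      rw [h6]
      refine (norm_add_le _ _).trans ?_
      rw [norm_mul, norm_mul, Complex.norm_real, Complex.norm_real, Real.norm_eq_abs,
        Real.norm_eq_abs]
      have h7 := norm_sub_le (V - V0) (J - V0)
      calc |γ y - γ P| * ‖V‖ + |γ P| * ‖(V - V0) - (J - V0)‖
          ≤ |γ y - γ P| * (2 * fieldConst E L * w y) +
            K * (fieldConst E L * δ * w y + fieldConst E L * δ * w y) := by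
              gcongr
              exact h7.trans (add_le_add h3 h2)
        _ = (|γ y - γ P| * w y) * (2 * fieldConst E L) + 2 * K * fieldConst E L * δ * w y := by
            ring
        _ ≤ (K * (2 + L) * δ * w y) * (2 * fieldConst E L) + 2 * K * fieldConst E L * δ * w y := by
            gcongr
        _ = _ := by ring
    refine (setLIntegral_mono' hDopen.measurableSet hpt).trans ?_
    rw [lintegral_const_mul' _ _ ENNReal.ofReal_ne_top]
    refine mul_le_mul_right ?_ _
    have hm : ∀ i ∈ Finset.univ, AEMeasurable (fun y => ‖w y‖ₑ * ‖H i y‖ₑ) (volume.restrict D) :=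
      fun i _ => hW.1.enorm.mul (hHm i).1.enorm
    rw [lintegral_finsetSum' _ hm, Finset.mul_sum]
    exact Finset.sum_le_sum fun i _ => lintegral_enorm_mul_le_eLpNorm hW.1 (hHm i).1
  have hsecond : ‖(γ P : ℂ) * ∫ y in D, ∑ i, κ.nullField η (k₀ * N) M N ξ i y * H i y‖ₑ ≤
      ENNReal.ofReal (K * fieldConst E L * δ) *
        (eLpNorm w 2 (volume.restrict D) * ∑ i, eLpNorm (H i) 2 (volume.restrict D)) := by
    rw [enorm_mul, mul_assoc K, ENNReal.ofReal_mul hK, mul_assoc]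
    refine mul_le_mul' ?_ ?_
    · rw [← ofReal_norm, Complex.norm_real]
      exact ENNReal.ofReal_le_ofReal (hγ.upper P hPc)
    · refine (κ.enorm_integral_nullField_zeroTrace_le hθ hη hE hDbdd hDopen hσ hP hkN hs.M_pos
        hs.N_pos hr hξ hJ hH).trans (mul_le_mul_left (ENNReal.ofReal_le_ofReal ?_) _)
      rw [fieldConst]
      have := hs.ratio_le
      have := div_pos hs.M_pos hs.N_pos
      gcongr
      linarith
  have hwn : eLpNorm w 2 (volume.restrict D) ≤ ENNReal.ofReal √(∫ y in D, w y ^ 2) := by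
    refine eLpNorm_two_le_ofReal_sqrt (integral_nonneg fun y => sq_nonneg _) ?_
    rw [ofReal_integral_eq_lintegral_ofReal hW.integrable_sq
      (Eventually.of_forall fun y => sq_nonneg _)]
    refine lintegral_mono fun y => ?_
    rw [← ofReal_norm, ← ENNReal.ofReal_pow (norm_nonneg _), Real.norm_eq_abs, sq_abs]
  rw [← ENNReal.ofReal_le_ofReal_iff (by positivity), ofReal_norm, hsplit]
  refine (enorm_add_le _ _).trans ((add_le_add hfirst hsecond).trans ?_)
  rw [← add_mul, ← ENNReal.ofReal_add (by positivity) (by positivity)]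
  refine (mul_le_mul_right (mul_le_mul' hwn (sum_eLpNorm_le hHm)) _).trans_eq ?_
  rw [← ENNReal.ofReal_mul (by positivity), ← ENNReal.ofReal_mul (by positivity)]
  congr 1
  ring

theorem integral_weight_sq_le (κ : BoundaryChart D θ P) (hDbdd : Bornology.IsBounded D)
    (hDopen : IsOpen D) (hP : P ∈ frontier D) (hk : 0 ≤ k) (hM : 0 < M) (hN : 0 < N)
    (hr : (2 + κ.bound) * M⁻¹ < κ.radius) :
    ∫ y in D, weight d k N M (κ.straighten y) ^ 2 ≤ k ^ 2 * (M⁻¹) ^ (d - 1) / (2 * N) *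
      volume.real (Metric.closedBall (0 : EuclideanSpace ℝ (Fin (d - 1))) 1) := by
  have hint := (κ.memLp_weight (M := M) hDbdd hk hN.le).integrable_sq
  rw [← ENNReal.ofReal_le_ofReal_iff (by positivity),
    ofReal_integral_eq_lintegral_ofReal hint (Eventually.of_forall fun y => sq_nonneg _),
    κ.setLIntegral_straighten hDopen hP hr (Φ := fun x => ENNReal.ofReal (weight d k N M x ^ 2))
      fun x hx => by simp [weight, Set.indicator_of_notMem hx],
    ENNReal.ofReal_mul (by positivity), Measure.real, ENNReal.ofReal_toReal
      (isCompact_closedBall _ _).measure_lt_top.ne]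
  exact lintegral_weight_sq_le hN hM

end Energy

end BoundaryChart


/-! ### Uniform estimates -/

theorem IsCutoff.integral_norm_sq_pos {η : ℝ → ℝ} (hη : IsCutoff η) (n : ℕ) :
    0 < ∫ x : EuclideanSpace ℝ (Fin n), η ‖x‖ ^ 2 := by
  refine Continuous.integral_pos_of_hasCompactSupport_nonneg_nonzero (x := 0)
    ((hη.smooth.continuous.comp continuous_norm).pow 2) ?_ (fun x => sq_nonneg _) ?_
  · refine HasCompactSupport.intro (isCompact_closedBall 0 1) fun x hx => ?_
    rw [mem_closedBall_zero_iff, not_le] at hx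
    rw [hη.eq_zero _ (by rw [abs_of_nonneg (norm_nonneg x)]; exact hx.le)]
    simp
  · simp [hη.eq_one 0 (by norm_num)]

section Scales

variable {θ : ℝ} {N : ℕ}

/-- The exponent 1/(1+θ) is the one that balances the two main errors: M/N and M^{-θ} both equal
N^{-θ/(1+θ)}, and 1/M is smaller. -/
theorem isScale_rpow (hθ0 : 0 < θ) (hθ1 : θ < 1) (hN : 1 ≤ N) :
    IsScale θ ((N : ℝ) ^ (1 / (1 + θ))) N ((N : ℝ) ^ (-(θ / (1 + θ)))) := by
  have hN1 : (1 : ℝ) ≤ N := by exact_mod_cast hN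
  have hN0 : (0 : ℝ) < N := by linarith
  have hθ : 0 < 1 + θ := by linarith
  refine ⟨by positivity, hN0, le_of_eq ?_, le_of_eq ?_, ?_, ?_⟩
  · nth_rw 2 [← Real.rpow_one (N : ℝ)]
    rw [← Real.rpow_sub hN0]
    congr 1
    field_simp
    ring
  · rw [← Real.rpow_neg hN0.le, ← Real.rpow_mul hN0.le]
    congr 1
    field_simp
  · rw [← Real.rpow_neg hN0.le]
    refine Real.rpow_le_rpow_of_exponent_le hN1 (neg_le_neg ?_)
    gcongr
  · exact Real.rpow_le_one_of_one_le_of_nonpos hN1 (neg_nonpos.mpr (by positivity))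

theorem one_le_scale (hθ0 : 0 < θ) (hN : 1 ≤ N) : 1 ≤ (N : ℝ) ^ (1 / (1 + θ)) :=
  Real.one_le_rpow (by exact_mod_cast hN) (by positivity)

theorem le_scale_sq (hθ0 : 0 < θ) (hθ1 : θ < 1) (hN : 1 ≤ N) :
    (N : ℝ) ≤ ((N : ℝ) ^ (1 / (1 + θ))) ^ 2 := by
  have hN1 : (1 : ℝ) ≤ N := by exact_mod_cast hN
  have hθ : 0 < 1 + θ := by linarith
  rw [← Real.rpow_natCast, ← Real.rpow_mul (by linarith)]
  nth_rw 1 [← Real.rpow_one (N : ℝ)]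
  refine Real.rpow_le_rpow_of_exponent_le hN1 ?_
  push_cast
  rw [div_mul_eq_mul_div, le_div_iff₀ hθ]
  linarith

theorem mul_precision_eq (hθ0 : 0 < θ) (hN : 1 ≤ N) :
    (N : ℝ) * (N : ℝ) ^ (-(θ / (1 + θ))) = (N : ℝ) ^ (1 / (1 + θ)) := by
  have hN0 : (0 : ℝ) < N := by exact_mod_cast hN
  nth_rw 1 [← Real.rpow_one (N : ℝ)]
  rw [← Real.rpow_add hN0]
  congr 1
  have hθ : 0 < 1 + θ := by linarith
  field_simp
  ring

/-- The hypothesis gives N^{-(1-θ)/(1+θ)} ≤ ε, and M^{-2} = N^{-2/(1+θ)} is smaller still because 2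
≥ 1 - θ. -/
theorem inv_scale_sq_le (hθ0 : 0 < θ) (hθ1 : θ < 1) (hN : 1 ≤ N) {ε : ℝ} (hε : 0 < ε)
    (h : ε ^ (-((1 + θ) / (1 - θ))) ≤ (N : ℝ)) : (((N : ℝ) ^ (1 / (1 + θ))) ^ 2)⁻¹ ≤ ε := by
  have hN1 : (1 : ℝ) ≤ N := by exact_mod_cast hN
  have hN0 : (0 : ℝ) < N := by linarith
  have hθ : 0 < 1 + θ := by linarith
  have hθ' : 0 < 1 - θ := by linarith
  have h1 := Real.rpow_le_rpow_of_nonpos (Real.rpow_pos_of_pos hε _) h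
    (z := -((1 - θ) / (1 + θ))) (neg_nonpos.mpr (by positivity))
  rw [← Real.rpow_mul hε.le] at h1
  have h2 : -((1 + θ) / (1 - θ)) * -((1 - θ) / (1 + θ)) = 1 := by
    field_simp
  rw [h2, Real.rpow_one] at h1
  refine le_trans ?_ h1
  rw [← Real.rpow_natCast, ← Real.rpow_mul hN0.le, ← Real.rpow_neg hN0.le]
  refine Real.rpow_le_rpow_of_exponent_le hN1 (neg_le_neg ?_)
  push_cast
  rw [div_mul_eq_mul_div]
  gcongr
  linarith

end Scales

/-! ### Constants that depend on the chart only through r and L. -/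

namespace BoundaryChart

section Uniform

variable {d : ℕ} {D : Set (EuclideanSpace ℝ (Fin d))} {θ : ℝ} {P : EuclideanSpace ℝ (Fin d)}
  {η : ℝ → ℝ} {N : ℕ}

/-- The factor `N^{-1/2} M^{(d-1)/2} C_P` of the boundary data. -/
def coefficient (κ : BoundaryChart D θ P) (η : ℝ → ℝ) (N : ℕ) : ℝ :=
  (N : ℝ) ^ (-(1 / 2) : ℝ) * ((N : ℝ) ^ (1 / (1 + θ))) ^ (((d : ℝ) - 1) / 2) * κ.normConst η

theorem boundaryData_eq_amplitude (κ : BoundaryChart D θ P) (η : ℝ → ℝ) (ξ : Coord d) (N : ℕ) :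
    κ.boundaryData η ξ N =
      κ.amplitude η (κ.coefficient η N) ((N : ℝ) ^ (1 / (1 + θ))) N ξ :=
  funext fun y => κ.boundaryData_eq η ξ N y

theorem coefficient_nonneg (κ : BoundaryChart D θ P) (η : ℝ → ℝ) (N : ℕ) :
    0 ≤ κ.coefficient η N := by
  have : 0 ≤ κ.normConst η := by
    have : 0 ≤ ∫ x : EuclideanSpace ℝ (Fin (d - 1)), η ‖x‖ ^ 2 :=
      integral_nonneg fun x => sq_nonneg _
    rw [normConst]
    positivity
  rw [coefficient]
  positivity

/-- This is the normalization of the data: the amplitude k = cN of the gradient, c the coefficient,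
satisfies the hypothesis of `abs_leadField_energy_sub_le`. -/
theorem coefficient_sq (κ : BoundaryChart D θ P) (hd : 1 ≤ d) (hη : IsCutoff η) (hN : 1 ≤ N) :
    κ.coefficient η N ^ 2 * (N * ((1 + ‖κ.slope‖ ^ 2) * ((((N : ℝ) ^ (1 / (1 + θ)))⁻¹) ^ (d - 1) *
      ∫ x : EuclideanSpace ℝ (Fin (d - 1)), η ‖x‖ ^ 2))) = 1 := by
  have hN0 : (0 : ℝ) < N := by exact_mod_cast hN
  have hI := hη.integral_norm_sq_pos (d - 1)
  set M := (N : ℝ) ^ (1 / (1 + θ)) with hM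
  have hM0 : 0 < M := Real.rpow_pos_of_pos hN0 _
  set I := ∫ x : EuclideanSpace ℝ (Fin (d - 1)), η ‖x‖ ^ 2
  have h1 : ((N : ℝ) ^ (-(1 / 2) : ℝ)) ^ 2 = (N : ℝ)⁻¹ := by
    rw [← Real.rpow_natCast, ← Real.rpow_mul hN0.le, ← Real.rpow_neg_one]
    norm_num
  have h2 : (M ^ (((d : ℝ) - 1) / 2)) ^ 2 = M ^ (d - 1) := by
    rw [← Real.rpow_natCast, ← Real.rpow_mul hM0.le, ← Real.rpow_natCast M (d - 1),
      Nat.cast_sub hd]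
    congr 1
    push_cast
    ring
  have h3 : κ.normConst η ^ 2 = ((1 + ‖κ.slope‖ ^ 2) * I)⁻¹ := by
    rw [normConst, ← Real.rpow_natCast, ← Real.rpow_mul (by positivity), ← Real.rpow_neg_one]
    norm_num [I]
  rw [coefficient, ← hM, mul_pow, mul_pow, h1, h2, h3]
  have : 0 < 1 + ‖κ.slope‖ ^ 2 := by positivity
  rw [inv_pow]
  field_simp

theorem coefficient_sq_le (κ : BoundaryChart D θ P) (hd : 1 ≤ d) (hη : IsCutoff η) (hN : 1 ≤ N) :
    κ.coefficient η N ^ 2 ≤ ((N : ℝ) ^ (1 / (1 + θ))) ^ (d - 1) /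
      ((∫ x : EuclideanSpace ℝ (Fin (d - 1)), η ‖x‖ ^ 2) * N) := by
  have hN0 : (0 : ℝ) < N := by exact_mod_cast hN
  have hI := hη.integral_norm_sq_pos (d - 1)
  have h := κ.coefficient_sq hd hη hN
  set M := (N : ℝ) ^ (1 / (1 + θ)) with hM
  have hM0 : 0 < M := Real.rpow_pos_of_pos hN0 _
  set I := ∫ x : EuclideanSpace ℝ (Fin (d - 1)), η ‖x‖ ^ 2
  rw [le_div_iff₀ (by positivity)]
  have hM1 : M ^ (d - 1) * (M⁻¹) ^ (d - 1) = 1 := by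
    rw [← mul_pow, mul_inv_cancel₀ hM0.ne', one_pow]
  calc κ.coefficient η N ^ 2 * (I * N)
      = (κ.coefficient η N ^ 2 * (I * N)) * (M ^ (d - 1) * (M⁻¹) ^ (d - 1)) := by
        rw [hM1, mul_one]
    _ ≤ (κ.coefficient η N ^ 2 * (I * N)) * (M ^ (d - 1) * (M⁻¹) ^ (d - 1)) *
        (1 + ‖κ.slope‖ ^ 2) :=
          le_mul_of_one_le_right (by positivity) (by nlinarith [sq_nonneg ‖κ.slope‖])
    _ = M ^ (d - 1) * (κ.coefficient η N ^ 2 *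
        (N * ((1 + ‖κ.slope‖ ^ 2) * ((M⁻¹) ^ (d - 1) * I)))) := by ring
    _ = M ^ (d - 1) := by rw [h, mul_one]

/-- The uniform bound for the data in `L²(∂D)`. -/
theorem exists_lintegral_boundaryData_le (hd : 1 ≤ d) (hDbdd : Bornology.IsBounded D)
    (hθ0 : 0 < θ) (hθ1 : θ < 1) (hreg : HasC1HolderBoundary D θ) (hη : IsCutoff η)
    {r : ℝ} (hr : 0 < r) (L : ℝ) :
    ∃ C : ℝ, 0 < C ∧ ∀ P ∈ frontier D, ∀ κ : BoundaryChart D θ P, r ≤ κ.radius → κ.bound ≤ L →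
      ∀ (ξ : Coord d) (N : ℕ), 1 ≤ N →
        ∫⁻ y, ‖κ.boundaryData η ξ N y‖ₑ ^ 2 ∂(surfaceMeasure D) ≤ ENNReal.ofReal (C / N) := by
  have hσ := surfaceMeasure_univ_lt_top hDbdd hreg
  have hI := hη.integral_norm_sq_pos (d - 1)
  set I := ∫ x : EuclideanSpace ℝ (Fin (d - 1)), η ‖x‖ ^ 2 with hIdef
  -- If M > R the box lies in the chart ball. Otherwise M ≤ R and N ≤ M² ≤ R². The constants `C₁`
  -- and `C₂` belong to these two cases.
  set R := (2 + L) / r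
  set V := volume.real (Metric.closedBall (0 : EuclideanSpace ℝ (Fin (d - 1))) 1)
  set C₁ := (1 + L) ^ (d - 1) * V / I
  set C₂ := R ^ (d - 1) / I * Real.exp (2 * R ^ 2) * (surfaceMeasure D).real Set.univ
  -- The entry 1 only guarantees positivity, for arbitrary L.
  refine ⟨max 1 (max C₁ C₂), lt_max_of_lt_left one_pos, fun P hP κ hrκ hL ξ N hN => ?_⟩
  have hN0 : (0 : ℝ) < N := by exact_mod_cast hN
  have hb := κ.bound_nonneg
  have hL0 := hb.trans hL
  have hc := κ.coefficient_nonneg η N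
  have hcsq := κ.coefficient_sq_le hd hη hN
  have hM1 := one_le_scale hθ0 hN
  have hs := isScale_rpow hθ0 hθ1 hN
  have hNM := le_scale_sq hθ0 hθ1 hN
  rw [boundaryData_eq_amplitude]
  set M := (N : ℝ) ^ (1 / (1 + θ))
  set c := κ.coefficient η N
  have hM0 : 0 < M := hs.M_pos
  have hpt : ∀ y, ‖κ.amplitude η c M N ξ y‖ₑ ^ 2 ≤
      ENNReal.ofReal (weight d c N M (κ.straighten y) ^ 2) := by
    intro y
    rw [ENNReal.ofReal_pow (weight_nonneg hc _), ← ofReal_norm]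
    gcongr
    exact κ.norm_amplitude_le hη hc hM0 ξ y
  by_cases hsmall : (2 + κ.bound) * M⁻¹ < κ.radius
  · refine le_trans ?_ (ENNReal.ofReal_le_ofReal
      (div_le_div_of_nonneg_right ((le_max_left C₁ C₂).trans (le_max_right _ _)) hN0.le))
    let T : Set (EuclideanSpace ℝ (Fin d)) :=
      {y | y ∈ frontier D ∧ y ∈ Metric.ball P κ.radius ∧ ‖(κ.straighten y).1‖ ≤ M⁻¹}
    have hT : MeasurableSet T := by
      refine isClosed_frontier.measurableSet.inter (Metric.isOpen_ball.measurableSet.inter ?_)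
      exact (isClosed_le (continuous_norm.comp (continuous_fst.comp κ.straighten.continuous))
        continuous_const).measurableSet
    -- On the boundary x_d = 0, so the exponential has modulus 1 and |f_N| ≤ c. The area M^{-(d-1)}
    -- of the support then cancels the M^{d-1} in c², which leaves 1/N.
    have hle : ∀ y ∈ frontier D, ‖κ.amplitude η c M N ξ y‖ₑ ^ 2 ≤
        T.indicator (fun _ => ENNReal.ofReal (c ^ 2)) y := by
      intro y hy
      refine (hpt y).trans ?_
      by_cases hbox : κ.straighten y ∈ box d M
      · have hball := κ.mem_ball_of_straighten_mem_box hP hsmall hbox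
        rw [Set.indicator_of_mem (show y ∈ T from ⟨hy, hball, hbox.1⟩), weight,
          Set.indicator_of_mem hbox, (κ.mem_frontier_iff_straighten hball).mp hy]
        simp
      · rw [weight, Set.indicator_of_notMem hbox]
        simp
    rw [surfaceMeasure]
    refine (setLIntegral_mono' isClosed_frontier.measurableSet hle).trans ?_
    rw [lintegral_indicator_const hT]
    refine (mul_le_mul_right ((Measure.restrict_le_self _).trans
      (κ.surface_graph_le M⁻¹)) _).trans ?_
    rw [Measure.addHaar_closedBall' _ _ (inv_nonneg.mpr hM0.le), finrank_euclideanSpace_fin,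
      ← ENNReal.ofReal_toReal (isCompact_closedBall
        (0 : EuclideanSpace ℝ (Fin (d - 1))) 1).measure_lt_top.ne,
      ← ENNReal.ofReal_mul (by positivity), ← ENNReal.ofReal_mul (by positivity),
      ← ENNReal.ofReal_mul (by positivity)]
    refine ENNReal.ofReal_le_ofReal ?_
    change c ^ 2 * ((1 + κ.bound) ^ (d - 1) * ((M⁻¹) ^ (d - 1) * V)) ≤ _
    have hM2 : M ^ (d - 1) * (M⁻¹) ^ (d - 1) = 1 := by
      rw [← mul_pow, mul_inv_cancel₀ hM0.ne', one_pow]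
    calc _ ≤ (M ^ (d - 1) / (I * N)) * ((1 + L) ^ (d - 1) * ((M⁻¹) ^ (d - 1) * V)) := by
          gcongr
      _ = (M ^ (d - 1) * (M⁻¹) ^ (d - 1)) * ((1 + L) ^ (d - 1) * V) / (I * N) := by ring
      _ = C₁ / N := by
          rw [hM2, one_mul, div_div]
  · refine le_trans ?_ (ENNReal.ofReal_le_ofReal
      (div_le_div_of_nonneg_right ((le_max_right C₁ C₂).trans (le_max_right _ _)) hN0.le))
    have hMR : M ≤ R := by
      rw [le_div_iff₀ hr]
      rw [not_lt, ← div_eq_mul_inv, le_div_iff₀ hM0] at hsmall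
      nlinarith
    have hR0 : 0 < R := hM0.trans_le hMR
    have hle : ∀ y, ‖κ.amplitude η c M N ξ y‖ₑ ^ 2 ≤
        ENNReal.ofReal (R ^ (d - 1) / (I * N) * Real.exp (2 * R ^ 2)) := by
      intro y
      refine (hpt y).trans (ENNReal.ofReal_le_ofReal ?_)
      have h1 := weight_le (M := M) hc hN0.le (κ.straighten y)
      have h2 : (N : ℝ) * M⁻¹ ≤ R ^ 2 := by
        refine (mul_le_of_le_one_right hN0.le (inv_le_one_of_one_le₀ hM1)).trans (hNM.trans ?_)
        gcongr
      calc weight d c N M (κ.straighten y) ^ 2 ≤ (c * Real.exp (N * M⁻¹)) ^ 2 :=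
            pow_le_pow_left₀ (weight_nonneg hc _) h1 2
        _ = c ^ 2 * Real.exp (2 * (N * M⁻¹)) := by
            rw [mul_pow, ← Real.exp_nat_mul]
            norm_num
        _ ≤ _ := by
            gcongr
            exact hcsq.trans (by gcongr)
    refine (lintegral_mono hle).trans ?_
    rw [lintegral_const, ← ENNReal.ofReal_toReal hσ.ne, ← ENNReal.ofReal_mul (by positivity)]
    refine ENNReal.ofReal_le_ofReal (le_of_eq ?_)
    change _ * (surfaceMeasure D).real Set.univ = _
    simp only [C₂]
    field_simp

/-- The Dirichlet-to-Neumann pairing recovers the conductivity, at a uniform rate. -/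
theorem exists_norm_dnPairing_sub_le (hd : 1 ≤ d) (hDopen : IsOpen D)
    (hDbdd : Bornology.IsBounded D)
    (hθ0 : 0 < θ) (hθ1 : θ < 1) (hreg : HasC1HolderBoundary D θ) (hη : IsCutoff η)
    {r : ℝ} (hr : 0 < r) (L : ℝ) {γ₀ : ℝ} (h0 : 0 < γ₀) (K : ℝ) :
    ∃ C : ℝ, 0 < C ∧ ∀ P ∈ frontier D, ∀ κ : BoundaryChart D θ P, r ≤ κ.radius → κ.bound ≤ L →
      ∀ ξ : Coord d, κ.IsAdmissible ξ → ∀ γ : EuclideanSpace ℝ (Fin d) → ℝ,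
        IsLipschitzConductivity D γ₀ K γ → ∀ N : ℕ, 1 ≤ N →
        (∃! z, IsDNPairing D γ (κ.boundaryData η ξ N) (fun y => conj (κ.boundaryData η ξ N y)) z) ∧
        ‖dnPairing D γ (κ.boundaryData η ξ N) (fun y => conj (κ.boundaryData η ξ N y)) -
          (γ P : ℂ)‖ ≤ C * (N : ℝ) ^ (-(θ / (1 + θ))) := by
  have hσ := surfaceMeasure_univ_lt_top hDbdd hreg
  have hI := hη.integral_norm_sq_pos (d - 1)
  obtain ⟨E, hE⟩ := hη.exists_lipschitz
  set I := ∫ x : EuclideanSpace ℝ (Fin (d - 1)), η ‖x‖ ^ 2 with hIdef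
  set R := (2 + L) / r
  set G := volume.real (Metric.closedBall (0 : EuclideanSpace ℝ (Fin (d - 1))) 1) / (2 * I)
  set B := fieldConst E L
  set C₁ := d * (4 * K * (3 + L) * B ^ 2) * G + K + (d * (K * (7 + 2 * L) * B)) ^ 2 * G / γ₀
  -- The bound for M ≤ R: crude energy plus |γ(P)|, times R² because then R²δ ≥ Nδ = M ≥ 1.
  set C₂ := (d * (4 * K * B ^ 2) *
    (R ^ (d + 1) / I * Real.exp (2 * R ^ 2) * volume.real D) + K) * R ^ 2
  refine ⟨max 1 (max C₁ C₂), lt_max_of_lt_left one_pos,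
    fun P hP κ hrκ hL ξ hξ γ hγ N hN => ?_⟩
  have hPc := frontier_subset_closure hP
  have hK : 0 ≤ K := (abs_nonneg _).trans (hγ.upper P hPc)
  have hN0 : (0 : ℝ) < N := by exact_mod_cast hN
  have hb := κ.bound_nonneg
  have hL0 := hb.trans hL
  have hE0 := E.coe_nonneg
  have hB : 0 ≤ B := by
    simp only [B, fieldConst]
    positivity
  have hG : 0 ≤ G := by positivity
  have hc := κ.coefficient_nonneg η N
  have hcsq := κ.coefficient_sq_le hd hη hN
  have hcsq' := κ.coefficient_sq hd hη hN
  have hM1 := one_le_scale hθ0 hN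
  have hs := isScale_rpow hθ0 hθ1 hN
  have hNM := le_scale_sq hθ0 hθ1 hN
  have hNδ := mul_precision_eq hθ0 hN
  -- This constant may depend on the chart: it secures the existence of the projection and enters no
  -- estimate.
  obtain ⟨Cp, hCp⟩ := exists_poincare hDbdd hDopen κ
  have hf : ContDiff ℝ 1 (κ.boundaryData η ξ N) := κ.contDiff_boundaryData hθ0 hη ξ N
  rw [boundaryData_eq_amplitude] at hf ⊢
  set M := (N : ℝ) ^ (1 / (1 + θ))
  set δ := (N : ℝ) ^ (-(θ / (1 + θ)))
  set c := κ.coefficient η N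
  have hM0 : 0 < M := hs.M_pos
  have hδ := hs.pos
  obtain ⟨hex, hcrude, happrox⟩ := exists_unique_dnPairing h0 hDbdd hDopen hσ hγ hCp hf
  refine ⟨hex, ?_⟩
  have hγP := hγ.upper P hPc
  set f := κ.amplitude η c M N ξ
  set z := dnPairing D γ f fun y => conj (f y)
  by_cases hsmall : (2 + κ.bound) * M⁻¹ < κ.radius
  · refine le_trans ?_ (mul_le_mul_of_nonneg_right
      ((le_max_left C₁ C₂).trans (le_max_right _ _)) hδ.le)
    have hcN : 0 ≤ c * N := mul_nonneg hc hN0.le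
    have hw : ∫ y in D, weight d (c * N) N M (κ.straighten y) ^ 2 ≤ G := by
      refine (κ.integral_weight_sq_le hDbdd hDopen hP hcN hM0 hN0 hsmall).trans ?_
      have hM2 : M ^ (d - 1) * (M⁻¹) ^ (d - 1) = 1 := by
        rw [← mul_pow, mul_inv_cancel₀ hM0.ne', one_pow]
      have h1 : (c * N) ^ 2 * (M⁻¹) ^ (d - 1) / (2 * N) ≤ 1 / (2 * I) := by
        calc (c * N) ^ 2 * (M⁻¹) ^ (d - 1) / (2 * N)
            = c ^ 2 * (N ^ 2 * (M⁻¹) ^ (d - 1) / (2 * N)) := by ring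
          _ ≤ M ^ (d - 1) / (I * N) * (N ^ 2 * (M⁻¹) ^ (d - 1) / (2 * N)) := by gcongr
          _ = (M ^ (d - 1) * (M⁻¹) ^ (d - 1)) * (1 / (2 * I)) := by
            field_simp
          _ = _ := by rw [hM2, one_mul]
      refine (mul_le_mul_of_nonneg_right h1 measureReal_nonneg).trans_eq ?_
      simp only [G]
      ring
    have hw0 : 0 ≤ ∫ y in D, weight d (c * N) N M (κ.straighten y) ^ 2 :=
      integral_nonneg fun y => sq_nonneg _
    have h1 := κ.abs_energy_sub_le hθ0 hη hE hDbdd hDopen hP hc hs hL hξ hγ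
    have hk : (c * N) ^ 2 * ((1 + ‖κ.slope‖ ^ 2) * ((M⁻¹) ^ (d - 1) * I)) = N := by
      linear_combination (N : ℝ) * hcsq'
    have h2 := κ.abs_leadField_energy_sub_le hη hDopen hP hM0 hN0 hsmall hξ hk
    have h3 := happrox (d * (K * (7 + 2 * L) * B * δ) *
        √(∫ y in D, weight d (c * N) N M (κ.straighten y) ^ 2)) (by positivity) fun H hH =>
      κ.norm_energyForm_le hθ0 hη hE hDbdd hDopen hσ hP hc hs hL hsmall hξ h0 hγ hH
    rw [mul_pow, Real.sq_sqrt hw0] at h3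
    set w := ∫ y in D, weight d (c * N) N M (κ.straighten y) ^ 2
    set e := ∫ y in D, γ y * ∑ i, ‖partialDeriv i f y‖ ^ 2
    set e0 := ∫ y in D, ∑ i, ‖κ.leadField η (c * N) M N ξ i y‖ ^ 2
    have h4 : |e - γ P| ≤ d * (4 * K * (3 + L) * B ^ 2 * δ) * G + K * δ := by
      have h5 : e - γ P = (e - γ P * e0) + γ P * (e0 - 1) := by ring
      rw [h5]
      refine (abs_add_le _ _).trans (add_le_add (h1.trans (by gcongr)) ?_)
      rw [abs_mul]
      exact mul_le_mul hγP (h2.trans hs.ratio_le) (abs_nonneg _) hK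
    have h6 : z - (γ P : ℂ) = (z - (e : ℂ)) + ((e - γ P : ℝ) : ℂ) := by
      push_cast
      ring
    rw [h6]
    refine (norm_add_le _ _).trans ?_
    rw [Complex.norm_real, Real.norm_eq_abs]
    -- The projection error is quadratic in δ, and one factor is discarded through δ ≤ 1.
    have h7 : (d * (K * (7 + 2 * L) * B * δ)) ^ 2 * w / γ₀ ≤
        (d * (K * (7 + 2 * L) * B)) ^ 2 * G / γ₀ * δ := by
      calc (d * (K * (7 + 2 * L) * B * δ)) ^ 2 * w / γ₀
          = (d * (K * (7 + 2 * L) * B)) ^ 2 * w / γ₀ * (δ * δ) := by ring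
        _ ≤ (d * (K * (7 + 2 * L) * B)) ^ 2 * G / γ₀ * (δ * 1) := by
            have := hs.le_one
            gcongr
        _ = _ := by rw [mul_one]
    calc _ ≤ (d * (K * (7 + 2 * L) * B)) ^ 2 * G / γ₀ * δ +
          (d * (4 * K * (3 + L) * B ^ 2 * δ) * G + K * δ) := add_le_add (h3.trans h7) h4
      _ = C₁ * δ := by
          simp only [C₁]
          ring
  · refine le_trans ?_ (mul_le_mul_of_nonneg_right
      ((le_max_right C₁ C₂).trans (le_max_right _ _)) hδ.le)
    have hMR : M ≤ R := by
      rw [le_div_iff₀ hr]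
      rw [not_lt, ← div_eq_mul_inv, le_div_iff₀ hM0] at hsmall
      nlinarith
    have hR0 : 0 < R := hM0.trans_le hMR
    have hNR : (N : ℝ) ≤ R ^ 2 := hNM.trans (by gcongr)
    have hVol : volume D < ⊤ := hDbdd.measure_lt_top
    have hfin : IsFiniteMeasure (volume.restrict D) :=
      ⟨by rwa [Measure.restrict_apply_univ]⟩
    have hcN : 0 ≤ c * N := mul_nonneg hc hN0.le
    have hwle : ∀ y, weight d (c * N) N M (κ.straighten y) ^ 2 ≤
        R ^ (d + 1) / I * Real.exp (2 * R ^ 2) := by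
      intro y
      have h1 := weight_le (M := M) hcN hN0.le (κ.straighten y)
      have h2 : (N : ℝ) * M⁻¹ ≤ R ^ 2 :=
        (mul_le_of_le_one_right hN0.le (inv_le_one_of_one_le₀ hM1)).trans hNR
      have h3 : (c * N) ^ 2 ≤ R ^ (d + 1) / I := by
        calc (c * N) ^ 2 = c ^ 2 * N ^ 2 := by ring
          _ ≤ M ^ (d - 1) / (I * N) * N ^ 2 := by gcongr
          _ = M ^ (d - 1) * N / I := by field_simp
          _ ≤ R ^ (d - 1) * R ^ 2 / I := by gcongr
          _ = _ := by
            rw [← pow_add]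
            congr 2
            omega
      calc weight d (c * N) N M (κ.straighten y) ^ 2 ≤ (c * N * Real.exp (N * M⁻¹)) ^ 2 :=
            pow_le_pow_left₀ (weight_nonneg hcN _) h1 2
        _ = (c * N) ^ 2 * Real.exp (2 * (N * M⁻¹)) := by
            rw [mul_pow _ (Real.exp _), ← Real.exp_nat_mul]
            norm_num
        _ ≤ _ := by gcongr
    have henergy : ∫ y in D, γ y * ∑ i, ‖partialDeriv i f y‖ ^ 2 ≤
        d * (4 * K * B ^ 2) * (R ^ (d + 1) / I * Real.exp (2 * R ^ 2) * volume.real D) := by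
      have hpt : ∀ y ∈ D, γ y * ∑ i, ‖partialDeriv i f y‖ ^ 2 ≤
          d * (4 * K * B ^ 2) * (R ^ (d + 1) / I * Real.exp (2 * R ^ 2)) := by
        intro y hy
        have h1 : ∑ i, ‖partialDeriv i f y‖ ^ 2 ≤
            d * (4 * B ^ 2 * (R ^ (d + 1) / I * Real.exp (2 * R ^ 2))) := by
          refine (Finset.sum_le_card_nsmul _ _ _ fun i _ => ?_).trans_eq
            (by rw [Finset.card_univ, Fintype.card_fin, nsmul_eq_mul])
          have h2 := κ.norm_partialDeriv_le hθ0.le hη hE hc hs hL hξ i y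
          calc ‖partialDeriv i f y‖ ^ 2 ≤
                (2 * B * weight d (c * N) N M (κ.straighten y)) ^ 2 := by gcongr
            _ = 4 * B ^ 2 * weight d (c * N) N M (κ.straighten y) ^ 2 := by ring
            _ ≤ _ := by
              gcongr
              exact hwle y
        calc γ y * ∑ i, ‖partialDeriv i f y‖ ^ 2
            ≤ K * (d * (4 * B ^ 2 * (R ^ (d + 1) / I * Real.exp (2 * R ^ 2)))) := by
              refine mul_le_mul ((le_abs_self _).trans (hγ.upper y (subset_closure hy))) h1
                (by positivity) hK
          _ = _ := by ring
      have hmem : ∀ i, MemLp (partialDeriv i f) 2 (volume.restrict D) := fun i =>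
        memLp_volume_of_continuous hDbdd hDopen (continuous_partialDeriv hf i)
      refine (setIntegral_mono_on (integrable_conductivity_mul_sum hDopen hγ hmem)
        (integrable_const _) hDopen.measurableSet hpt).trans_eq ?_
      rw [setIntegral_const, smul_eq_mul]
      ring
    have h1 : ‖z - (γ P : ℂ)‖ ≤ d * (4 * K * B ^ 2) *
        (R ^ (d + 1) / I * Real.exp (2 * R ^ 2) * volume.real D) + K := by
      refine (norm_sub_le _ _).trans (add_le_add (hcrude.trans henergy) ?_)
      rwa [Complex.norm_real]
    have h2 : 1 ≤ R ^ 2 * δ := by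
      calc (1 : ℝ) ≤ M := hM1
        _ = N * δ := hNδ.symm
        _ ≤ _ := by gcongr
    have h3 : 0 ≤ d * (4 * K * B ^ 2) *
        (R ^ (d + 1) / I * Real.exp (2 * R ^ 2) * volume.real D) + K := by positivity
    calc ‖z - (γ P : ℂ)‖ ≤ _ := h1
      _ ≤ _ := le_mul_of_one_le_right h3 h2
      _ = C₂ * δ := by
        simp only [C₂]
        ring

end Uniform

end BoundaryChart

/-- A deterministic value with a small error, observed with small noise. -/
theorem one_sub_le_measureReal_norm_add_sub_le {Ω : Type*} [MeasurableSpace Ω] {μ : Measure Ω}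
    [IsProbabilityMeasure μ] (Y : Lp ℂ 2 μ) {z w : ℂ} {s t A ε : ℝ} (ht : 0 < t)
    (hz : ‖z - w‖ ≤ s) (hst : s + t ≤ A) (hY : ‖Y‖ ^ 2 / t ^ 2 ≤ ε) :
    1 - ε ≤ μ.real {ϖ | ‖z + Y ϖ - w‖ ≤ A} := by
  have h1 := one_sub_le_measureReal_norm_le Y ht
  refine le_trans (by linarith) (h1.trans (measureReal_mono fun ϖ hϖ => ?_))
  have h2 : ‖Y ϖ‖ ≤ t := hϖ
  have h3 : z + Y ϖ - w = (z - w) + Y ϖ := by ring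
  change ‖z + Y ϖ - w‖ ≤ A
  rw [h3]
  exact (norm_add_le _ _).trans (by linarith)

theorem norm_toLp_mul_conj_le {X : Type*} [MeasurableSpace X] {μ : Measure X} {f : X → ℂ}
    (hf : MemLp f 2 μ) (hg : MemLp (fun x => conj (f x)) 2 μ) {A : ℝ} (hA : 0 ≤ A)
    (h : ∫⁻ x, ‖f x‖ₑ ^ 2 ∂μ ≤ ENNReal.ofReal A) : ‖hf.toLp f‖ * ‖hg.toLp _‖ ≤ A := by
  have h1 : eLpNorm (fun x => conj (f x)) 2 μ = eLpNorm f 2 μ :=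
    eLpNorm_congr_norm_ae (Eventually.of_forall fun x => RCLike.norm_conj (f x))
  rw [Lp.norm_toLp, Lp.norm_toLp, h1, ← ENNReal.toReal_mul, ← sq, eLpNorm_two_sq]
  exact ENNReal.toReal_le_of_le_ofReal hA h


end Calderon

end

/-! ### The reconstruction theorem: pairing and noise combined. -/

theorem theorem2 (d : ℕ) (hd : 2 ≤ d) (D : Set (EuclideanSpace ℝ (Fin d)))
    (hDopen : IsOpen D) (hDconn : IsConnected D) (hDbdd : Bornology.IsBounded D)
    (θ : ℝ) (hθ0 : 0 < θ) (hθ1 : θ < 1) (hreg : Calderon.HasC1HolderBoundary D θ)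
    (η : ℝ → ℝ) (hη : Calderon.IsCutoff η) :
    -- at every boundary point there are a chart, with uniform bounds, and an admissible vector
    (∃ r : ℝ, 0 < r ∧ ∃ L : ℝ, ∀ P ∈ frontier D, ∃ κ : Calderon.BoundaryChart D θ P,
      r ≤ κ.radius ∧ κ.bound ≤ L ∧ ∃ ξ : Calderon.Coord d, κ.IsAdmissible ξ) ∧
    -- and the explicit sequence attached to any such choice recovers the conductivity
    ∀ r : ℝ, 0 < r → ∀ L : ℝ, ∃ c : ℝ, 0 < c ∧
      ∀ γ₀ : ℝ, 0 < γ₀ → ∀ K : ℝ, ∃ C : ℝ, 0 < C ∧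
        ∀ P ∈ frontier D, ∀ κ : Calderon.BoundaryChart D θ P, r ≤ κ.radius → κ.bound ≤ L →
        ∀ ξ : Calderon.Coord d, κ.IsAdmissible ξ →
        ∀ γ : EuclideanSpace ℝ (Fin d) → ℝ, Calderon.IsLipschitzConductivity D γ₀ K γ →
          (∀ N : ℕ, 1 ≤ N →
            Calderon.MemHHalf D (κ.boundaryData η ξ N) ∧
            ∃! z : ℂ, Calderon.IsDNPairing D γ (κ.boundaryData η ξ N)
              (fun y => conj (κ.boundaryData η ξ N y)) z) ∧
          ∀ (e : HilbertBasis ℕ ℂ (Lp ℂ 2 (Calderon.surfaceMeasure D)))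
            (Ω : Type*) [MeasurableSpace Ω] (μ : Measure Ω) [IsProbabilityMeasure μ]
            (X : ℕ × ℕ → Ω → ℂ) (hX : Calderon.IsComplexWhiteNoise μ X),
            (∀ N : ℕ, 1 ≤ N →
              Summable (Calderon.noiseSummand D e hX (κ.boundaryData η ξ N)
                (fun y => conj (κ.boundaryData η ξ N y)))) ∧
            ∀ ε : ℝ, 0 < ε → ∀ N : ℕ, 1 ≤ N →
              c * ε ^ (-((1 + θ) / (1 - θ))) ≤ (N : ℝ) →
              1 - ε ≤ μ.real {ϖ | ‖Calderon.noisyData D γ e hX (κ.boundaryData η ξ N)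
                (fun y => conj (κ.boundaryData η ξ N y)) ϖ - (γ P : ℂ)‖
                  ≤ C * (N : ℝ) ^ (-(θ / (1 + θ)))} := by
  obtain ⟨r₀, hr₀, L₀, hcharts⟩ := Calderon.exists_uniform_charts hDbdd hreg
  -- The threshold works with c = 1, since the deviation allowed to the noise is scaled by the
  -- constant of its own bound.
  refine ⟨⟨r₀, hr₀, L₀, fun P hP => ?_⟩, fun r hr L => ⟨1, one_pos, fun γ₀ h0 K => ?_⟩⟩
  · obtain ⟨κ, h1, h2⟩ := hcharts P hP
    exact ⟨κ, h1, h2, κ.exists_isAdmissible hd⟩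
  have hd1 : 1 ≤ d := by omega
  have hσ := Calderon.surfaceMeasure_univ_lt_top hDbdd hreg
  obtain ⟨C₁, hC₁, hnoise⟩ := Calderon.BoundaryChart.exists_lintegral_boundaryData_le hd1 hDbdd
    hθ0 hθ1 hreg hη hr L
  obtain ⟨C₂, hC₂, hpairing⟩ := Calderon.BoundaryChart.exists_norm_dnPairing_sub_le hd1 hDopen
    hDbdd hθ0 hθ1 hreg hη hr L h0 K
  refine ⟨C₂ + C₁, by positivity, fun P hP κ hrκ hL ξ hξ γ hγ => ?_⟩
  have hf := κ.contDiff_boundaryData hθ0 hη ξ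
  refine ⟨fun N hN => ⟨⟨_, _, Calderon.IsH1.of_contDiff hDbdd hDopen (hf N),
    Calderon.HasTrace.of_contDiff hDbdd hσ (hf N)⟩,
    (hpairing P hP κ hrκ hL ξ hξ γ hγ N hN).1⟩, fun e Ω _ μ _ X hX => ?_⟩
  have hfm : ∀ N, MemLp (κ.boundaryData η ξ N) 2 (Calderon.surfaceMeasure D) := fun N =>
    Calderon.memLp_surface_of_continuous hDbdd hσ (hf N).continuous
  have hY := fun N => Calderon.noise_summable_and_norm e hX (hfm N) (Calderon.memLp_conj (hfm N))
  refine ⟨fun N _ => (hY N).1, fun ε hε N hN hNε => ?_⟩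
  rw [one_mul] at hNε
  have hN0 : (0 : ℝ) < N := by exact_mod_cast hN
  have hδ := (Calderon.isScale_rpow hθ0 hθ1 hN).pos
  have hY2 := Calderon.norm_toLp_mul_conj_le (hfm N) (Calderon.memLp_conj (hfm N))
    (div_pos hC₁ hN0).le (hnoise P hP κ hrκ hL ξ N hN)
  rw [← (hY N).2] at hY2
  -- The error C₂δ of the pairing and the deviation C₁δ of the noise add up to the final bound.
  refine Calderon.one_sub_le_measureReal_norm_add_sub_le _ (mul_pos hC₁ hδ)
    (hpairing P hP κ hrκ hL ξ hξ γ hγ N hN).2 (add_mul _ _ _).ge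
    (le_trans ?_ (Calderon.inv_scale_sq_le hθ0 hθ1 hN hε hNε))
  rw [← Calderon.mul_precision_eq hθ0 hN]
  -- The constant C₁ cancels, and the failure probability is at most (Nδ)^{-2} = M^{-2}.
  calc _ ≤ (C₁ / N) ^ 2 / (C₁ * (N : ℝ) ^ (-(θ / (1 + θ)))) ^ 2 := by gcongr
    _ = _ := by
      field_simp
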